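/- Notation. For a real number $w\ge 1$ put $W=8\prod_{2<p\le w}p$ ($p$ prime). Let $b$ be an integer with $1\le b\le W$, $(b,W)=1$, that is a square modulo $W$, and let $\sigma(b)=\#\{y\in\{1,\dots,W\}:y^2\equiv b\ (\mathrm{mod}\ W)\}$. For $0<\delta<1/8$ and a positive integer $N$ put $z=N^{1/4-2\delta}$, let $P$ be the product of all primes $p<z$ with $p\nmid W$, and let $J=\sum_{d\mid P,\,d<z}1/\phi(d)$. Let $\rho_d$ be the weights of Selberg's upper bound sieve, $$\rho_d=\mu(d)\,\frac{d}{J}\sum_{\substack{m\mid P,\ m<z\\ d\mid m}}\frac{1}{\phi(m)}\quad\text{if } d\mid P,\ d<z,\qquad \rho_d=0\ \text{otherwise.}$$ Define $v:\mathbb{Z}\to\mathbb{R}$ by $$v(n)=\frac{2\phi(W)\sqrt{Wn+b}\,\log z}{W\sigma(b)}\Big(\sum_{d\mid(\sqrt{Wn+b},\,P)}\rho_d\Big)^2$$ if $1\le n\le N$ and $Wn+b$ is the square of a natural number, and $v(n)=0$ otherwise. Let $\hat v(\theta)=\sum_{n\in\mathbb{Z}}v(n)e^{2\pi i n\theta}$.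 Lemma. There are constants $C_\epsilon$ ($\epsilon>0$), each depending only on $\epsilon$, such that the following holds. Let $0<\delta<1/8$, let $w\ge1$, and let $N$ be sufficiently large depending only on $w$ and $\delta$. Then for every $b$ as above, every $r\in\mathbb{Z}/N\mathbb{Z}$ and every $\epsilon>0$, $$\big|\hat v(r/N)-\delta_{r,0}N\big|\le C_\epsilon\,w^{-1/2+\epsilon}N,$$ where $\delta_{r,0}$ is $1$ if $r=0$ and $0$ otherwise. -/

import Mathlib

noncomputable section

namespace PrimeSquares

/-- The Fourier transform `∑_{n ∈ ℤ} f(n) e(nθ)`, `e(t) = exp(2πit)`, of a finitely supported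
function on the integers. -/
def fourierHat (f : ℤ → ℝ) (θ : ℝ) : ℂ :=
  ∑' n : ℤ, (f n : ℂ) * Complex.exp (2 * Real.pi * Complex.I * n * θ)

/-- `W = 8 ∏_{2 < p ≤ w} p`. -/
def bigW (w : ℝ) : ℕ :=
  8 * ∏ p ∈ (Finset.Icc 3 ⌊w⌋₊).filter Nat.Prime, p

/-- `σ(b) = #{y ∈ {1, …, W} : y² ≡ b (mod W)}`. -/
def sigma (W b : ℕ) : ℕ :=
  ((Finset.Icc 1 W).filter fun y => y ^ 2 ≡ b [MOD W]).card

/-- The sieving level `z = N^{1/4 - 2δ}`. -/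
def level (δ : ℝ) (N : ℕ) : ℝ :=
  (N : ℝ) ^ (1 / 4 - 2 * δ)

/-- The product `P` of all primes `p < z` not dividing `W`
(`p ∈ Finset.range ⌈z⌉₊` means `p < z`). -/
def sieveProduct (W : ℕ) (z : ℝ) : ℕ :=
  ∏ p ∈ (Finset.range ⌈z⌉₊).filter fun p => p.Prime ∧ p.Coprime W, p

/-- `J = ∑_{d ∣ P, d < z} 1/φ(d)`. -/
def sieveJ (W : ℕ) (z : ℝ) : ℝ :=
  ∑ d ∈ (sieveProduct W z).divisors.filter fun d : ℕ => (d : ℝ) < z, 1 / (d.totient : ℝ)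

/-- The weights of Selberg's upper bound sieve of level `z` for the primes dividing `P`:
`ρ_d = μ(d) (d / J) ∑_{m ∣ P, m < z, d ∣ m} 1/φ(m)` for `d ∣ P`, `d < z`, and `ρ_d = 0` otherwise.
They are the minimizers of `∑_{d₁, d₂} ρ_{d₁} ρ_{d₂} / [d₁, d₂]` subject to this support
condition and `ρ_1 = 1`. -/
def selbergWeight (W : ℕ) (z : ℝ) (d : ℕ) : ℝ :=
  open Classical in
  if d ∣ sieveProduct W z ∧ (d : ℝ) < z then
    (ArithmeticFunction.moebius d : ℝ) * (d / sieveJ W z) *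
      ∑ m ∈ (sieveProduct W z).divisors.filter fun m : ℕ => (m : ℝ) < z ∧ d ∣ m,
        1 / (m.totient : ℝ)
  else 0

/-- The Selberg majorant `v` on `{1, …, N}`, extended by zero. Where `Wn + b` is a perfect square
`x²`, the number `Nat.sqrt (Wn + b)` is `x`. -/
def majorant (W b N : ℕ) (z : ℝ) (n : ℤ) : ℝ :=
  open Classical in
  if 1 ≤ n ∧ ∃ x : ℕ, (W : ℤ) * n + b = (x : ℤ) ^ 2 ∧ (x : ℝ) ≤ √((W : ℝ) * N + b) then
    2 * (W.totient : ℝ) * √((W : ℝ) * n + b) * Real.log z / ((W : ℝ) * sigma W b) *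
      (∑ d ∈ (Nat.gcd (Nat.sqrt ((W : ℤ) * n + b).toNat) (sieveProduct W z)).divisors,
        selbergWeight W z d) ^ 2
  else 0

end PrimeSquares

end

noncomputable section

namespace PrimeSquares

open Finset

/-! ### The divisor bound -/

theorem exists_add_one_le_mul_rpow (ε : ℝ) (hε : 0 < ε) :
    ∃ C : ℝ, 1 ≤ C ∧ ∀ a : ℕ, (a + 1 : ℝ) ≤ C * (2 : ℝ) ^ (a * ε) := by
  have h2 : 0 < Real.log 2 := Real.log_pos (by norm_num)
  refine ⟨max 1 (1 / (ε * Real.log 2)), le_max_left _ _, fun a => ?_⟩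
  set C := max 1 (1 / (ε * Real.log 2)) with hC
  have hC1 : 1 ≤ C := le_max_left _ _
  have hC2 : 1 / (ε * Real.log 2) ≤ C := le_max_right _ _
  have h3 : (2 : ℝ) ^ (a * ε) ≥ 1 + a * ε * Real.log 2 := by
    rw [Real.rpow_def_of_pos (by norm_num)]
    have := Real.add_one_le_exp (Real.log 2 * (a * ε))
    linarith
  have h4 : 1 ≤ C * (ε * Real.log 2) := by
    rwa [div_le_iff₀ (by positivity)] at hC2
  have ha : (0 : ℝ) ≤ a := Nat.cast_nonneg a
  nlinarith

/-- The divisor bound: `τ(n) ≪ n ^ ε`. -/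
theorem exists_card_divisors_le (ε : ℝ) (hε : 0 < ε) :
    ∃ C : ℝ, 1 ≤ C ∧ ∀ n : ℕ, n ≠ 0 → (n.divisors.card : ℝ) ≤ C * (n : ℝ) ^ ε := by
  obtain ⟨C₁, hC₁, h₁⟩ := exists_add_one_le_mul_rpow ε hε
  set B : ℕ := ⌈(2 : ℝ) ^ (1 / ε)⌉₊
  refine ⟨C₁ ^ B, one_le_pow₀ hC₁, fun n hn => ?_⟩
  have hfac : (n : ℝ) ^ ε = ∏ p ∈ n.primeFactors, (p : ℝ) ^ (n.factorization p * ε) := by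
    conv_lhs => rw [← Nat.prod_factorization_pow_eq_self hn]
    rw [Finsupp.prod, Nat.cast_prod, ← Real.finsetProd_rpow _ _ (fun i _ => by positivity)]
    refine prod_congr rfl fun p _ => ?_
    rw [Nat.cast_pow, ← Real.rpow_natCast, ← Real.rpow_mul (by positivity)]
  have hcard : (∏ p ∈ n.primeFactors, if p < B then C₁ else 1) ≤ C₁ ^ B := by
    rw [prod_ite, prod_const, prod_const_one, mul_one]
    refine pow_le_pow_right₀ hC₁ ?_
    calc _ ≤ (range B).card := card_le_card fun p hp => by simp at hp ⊢; exact hp.2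
      _ = B := card_range B
  rw [Nat.card_divisors hn, hfac]
  push_cast
  calc ∏ p ∈ n.primeFactors, ((n.factorization p : ℝ) + 1)
      ≤ ∏ p ∈ n.primeFactors, ((if p < B then C₁ else 1) *
          (p : ℝ) ^ (n.factorization p * ε)) := by
        refine prod_le_prod (fun p _ => by positivity) fun p hp => ?_
        have hp2 : 2 ≤ p := (Nat.prime_of_mem_primeFactors hp).two_le
        have hp2' : (2 : ℝ) ≤ p := by exact_mod_cast hp2
        split_ifs with h
        · refine (h₁ _).trans ?_
          gcongr
        · rw [one_mul]
          have hB : (2 : ℝ) ^ (1 / ε) ≤ p :=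
            (Nat.le_ceil _).trans (by exact_mod_cast not_lt.mp h)
          have h2 : (2 : ℝ) ≤ (p : ℝ) ^ ε := by
            calc (2 : ℝ) = ((2 : ℝ) ^ (1 / ε)) ^ ε := by
                  rw [← Real.rpow_mul (by norm_num), one_div_mul_cancel hε.ne', Real.rpow_one]
              _ ≤ _ := by gcongr
          calc (n.factorization p : ℝ) + 1 ≤ (2 : ℝ) ^ (n.factorization p) := by
                exact_mod_cast Nat.lt_two_pow_self
            _ ≤ ((p : ℝ) ^ ε) ^ (n.factorization p) := by gcongr
            _ = _ := by
                rw [← Real.rpow_natCast, ← Real.rpow_mul (by positivity), mul_comm ε]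
    _ = (∏ p ∈ n.primeFactors, if p < B then C₁ else 1) *
          ∏ p ∈ n.primeFactors, (p : ℝ) ^ (n.factorization p * ε) := prod_mul_distrib
    _ ≤ _ := by gcongr

/-! ### Exponential sums -/

/-- `e(t) = exp(2πit)`. -/
def ee (t : ℝ) : ℂ := Complex.exp (2 * Real.pi * Complex.I * t)

theorem ee_add (s t : ℝ) : ee (s + t) = ee s * ee t := by
  simp only [ee, ← Complex.exp_add]; congr 1; push_cast; ring

@[simp] theorem ee_zero : ee 0 = 1 := by simp [ee]

theorem ee_neg (t : ℝ) : ee (-t) = (starRingEnd ℂ) (ee t) := by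
  simp only [ee, ← Complex.exp_conj]; congr 1
  simp only [map_mul, Complex.conj_ofReal, Complex.conj_I, map_ofNat]
  push_cast; ring

@[simp] theorem norm_ee (t : ℝ) : ‖ee t‖ = 1 := by
  rw [ee, show (2 * Real.pi * Complex.I * t : ℂ) = ((2 * Real.pi * t : ℝ) : ℂ) * Complex.I by
    push_cast; ring]
  exact Complex.norm_exp_ofReal_mul_I _

@[simp] theorem ee_intCast (n : ℤ) : ee n = 1 := by
  rw [ee, Complex.exp_eq_one_iff]; exact ⟨n, by push_cast; ring⟩

theorem ee_natCast_mul (n : ℕ) (t : ℝ) : ee (n * t) = ee t ^ n := by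
  rw [ee, ee, ← Complex.exp_nat_mul]; congr 1; push_cast; ring

theorem ee_sub (s t : ℝ) : ee (s - t) = ee s * (starRingEnd ℂ) (ee t) := by
  rw [sub_eq_add_neg, ee_add, ee_neg]

theorem norm_circle_le_norm_ee_sub_one (t : ℝ) : 4 * ‖(t : UnitAddCircle)‖ ≤ ‖ee t - 1‖ := by
  have h1 : ee t = ee (t - round t) := by
    rw [sub_eq_add_neg, ee_add]
    have := ee_intCast (-(round t))
    push_cast at this
    rw [this, mul_one]
  rw [UnitAddCircle.norm_eq, h1]
  set u := t - round t with hu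
  have hu2 : |u| ≤ 1 / 2 := abs_sub_round t
  have h2 : ee u = Complex.exp (Complex.I * ((2 * Real.pi * u : ℝ) : ℂ)) := by
    rw [ee]; congr 1; push_cast; ring
  rw [h2, Complex.norm_exp_I_mul_ofReal_sub_one, Real.norm_eq_abs, abs_mul, abs_two]
  have hpi := Real.pi_pos
  have h3 : |Real.sin (2 * Real.pi * u / 2)| = Real.sin (Real.pi * |u|) := by
    rw [show 2 * Real.pi * u / 2 = Real.pi * u by ring]
    rcases abs_cases u with ⟨h, h'⟩ | ⟨h, h'⟩
    · rw [h, abs_of_nonneg]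
      apply Real.sin_nonneg_of_nonneg_of_le_pi (by positivity)
      rw [h] at hu2; nlinarith
    · rw [h, mul_neg, Real.sin_neg, abs_of_nonpos]
      apply Real.sin_nonpos_of_nonpos_of_neg_pi_le
      · nlinarith
      · rw [h] at hu2; nlinarith
  rw [h3]
  have := Real.mul_le_sin (x := Real.pi * |u|) (by positivity) (by nlinarith)
  have h4 : 2 / Real.pi * (Real.pi * |u|) = 2 * |u| := by field_simp
  linarith

/-- A majorant of a multiple of `min(Y, 1 / ‖x‖)`. -/
def fejer (Y : ℝ) (x : UnitAddCircle) : ℝ := 2 * Y / (1 + Y * ‖x‖)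

theorem fejer_nonneg {Y : ℝ} (hY : 0 ≤ Y) (x : UnitAddCircle) : 0 ≤ fejer Y x := by
  unfold fejer; positivity

theorem fejer_le {Y : ℝ} (hY : 0 ≤ Y) (x : UnitAddCircle) : fejer Y x ≤ 2 * Y := by
  unfold fejer
  exact div_le_self (by positivity) (by nlinarith [mul_nonneg hY (norm_nonneg x)])

theorem fejer_mono {Y Z : ℝ} (hY : 0 ≤ Y) (hYZ : Y ≤ Z) (x : UnitAddCircle) :
    fejer Y x ≤ fejer Z x := by
  have hZ := hY.trans hYZ
  unfold fejer
  rw [div_le_div_iff₀ (by positivity) (by positivity)]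
  nlinarith [norm_nonneg x]

theorem fejer_mul_norm_le {Y : ℝ} (hY : 0 ≤ Y) (x : UnitAddCircle) : fejer Y x * ‖x‖ ≤ 2 := by
  unfold fejer
  rw [div_mul_eq_mul_div, div_le_iff₀ (by positivity)]
  nlinarith [norm_nonneg x]

theorem fejer_neg (Y : ℝ) (x : UnitAddCircle) : fejer Y (-x) = fejer Y x := by
  simp [fejer]

theorem norm_sum_range_ee_le (c ξ : ℝ) (n : ℕ) (Y : ℝ) (hn : (n : ℝ) ≤ Y) :
    ‖∑ j ∈ range n, ee (c + j * ξ)‖ ≤ fejer Y (ξ : UnitAddCircle) := by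
  have hY : (0 : ℝ) ≤ Y := (Nat.cast_nonneg n).trans hn
  set S := ∑ j ∈ range n, ee (c + j * ξ) with hS
  have h1 : ‖S‖ ≤ Y := by
    refine (norm_sum_le _ _).trans ?_
    simpa using hn
  have h2 : S = ee c * ∑ j ∈ range n, ee ξ ^ j := by
    rw [hS, mul_sum]
    exact sum_congr rfl fun j _ => by rw [ee_add, ee_natCast_mul]
  have h3 : ‖S‖ * ‖ee ξ - 1‖ ≤ 2 := by
    rw [← norm_mul, h2, mul_assoc, geom_sum_mul, norm_mul, norm_ee, one_mul]
    refine (norm_sub_le _ _).trans ?_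
    rw [norm_pow, norm_ee]; norm_num
  have h4 := norm_circle_le_norm_ee_sub_one ξ
  unfold fejer
  rw [le_div_iff₀ (by positivity)]
  have h5 : ‖S‖ * ‖(ξ : UnitAddCircle)‖ ≤ 1 := by
    nlinarith [norm_nonneg S]
  nlinarith [norm_nonneg S]

theorem norm_sum_Ico_ee_le (c ξ : ℝ) (a b : ℤ) (Y : ℝ) (hY : 0 ≤ Y) (hn : (b - a : ℝ) ≤ Y) :
    ‖∑ j ∈ Ico a b, ee (c + j * ξ)‖ ≤ fejer Y (ξ : UnitAddCircle) := by
  rcases lt_or_ge b a with h | h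
  · rw [Ico_eq_empty (by omega)]; simpa using fejer_nonneg hY _
  · obtain ⟨n, rfl⟩ : ∃ n : ℕ, b = a + n := ⟨(b - a).toNat, by omega⟩
    have h1 : ∑ j ∈ Ico a (a + n), ee (c + j * ξ) = ∑ j ∈ range n, ee ((c + a * ξ) + j * ξ) := by
      symm
      refine sum_bij (fun j _ => a + (j : ℤ)) (fun j hj => ?_) (fun i _ j _ h => by simpa using h)
        (fun j hj => ?_) (fun j _ => ?_)
      · simp at hj ⊢; omega
      · simp only [mem_Ico] at hj
        exact ⟨(j - a).toNat, by simp; omega, by omega⟩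
      · congr 1; push_cast; ring
    rw [h1]
    refine norm_sum_range_ee_le _ _ _ _ ?_
    push_cast at hn; linarith

/-- The quadratic exponential sum over `1 ≤ y ≤ Y`. -/
def quadSum (ξ : ℝ) (Y : ℕ) : ℂ := ∑ y ∈ Icc 1 Y, ee (ξ * (y : ℝ) ^ 2)

theorem norm_sq_quadSum (ξ : ℝ) (Y : ℕ) :
    ((‖quadSum ξ Y‖ ^ 2 : ℝ) : ℂ) =
      ∑ y₁ ∈ Icc 1 Y, ∑ y₂ ∈ Icc 1 Y, ee (ξ * ((y₁ : ℝ) ^ 2 - (y₂ : ℝ) ^ 2)) := by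
  rw [← Complex.normSq_eq_norm_sq, ← Complex.mul_conj, quadSum, map_sum, sum_mul_sum]
  refine sum_congr rfl fun y₁ _ => sum_congr rfl fun y₂ _ => ?_
  rw [mul_sub, ee_sub]

theorem norm_sq_quadSum_le (ξ : ℝ) (Y : ℕ) :
    ‖quadSum ξ Y‖ ^ 2 ≤ 2 * Y + 2 * ∑ s ∈ Ico 1 Y, fejer Y ((2 * s * ξ : ℝ) : UnitAddCircle) := by
  set F : ℤ → ℝ := fun s => fejer Y ((2 * s * ξ : ℝ) : UnitAddCircle) with hF
  have hZ : ((‖quadSum ξ Y‖ ^ 2 : ℝ) : ℂ) =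
      ∑ y₂ ∈ Ico (1 : ℤ) (Y + 1), ∑ y₁ ∈ Ico (1 : ℤ) (Y + 1),
        ee (ξ * ((y₁ : ℝ) ^ 2 - (y₂ : ℝ) ^ 2)) := by
    have key : ∀ f : ℤ → ℂ, ∑ y ∈ Icc 1 Y, f y = ∑ y ∈ Ico (1 : ℤ) (Y + 1), f y := by
      intro f
      refine sum_bij (fun j _ => (j : ℤ)) (fun j hj => ?_) (fun i _ j _ h => by simpa using h)
        (fun j hj => ?_) (fun j _ => rfl)
      · simp at hj ⊢; omega
      · simp only [mem_Ico] at hj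
        exact ⟨j.toNat, by simp; omega, by omega⟩
    rw [norm_sq_quadSum, sum_comm,
      ← key (fun y₂ => ∑ y₁ ∈ Ico (1 : ℤ) (Y + 1), ee (ξ * ((y₁ : ℝ) ^ 2 - (y₂ : ℝ) ^ 2)))]
    refine sum_congr rfl fun y₂ _ => ?_
    rw [← key (fun y₁ => ee (ξ * ((y₁ : ℝ) ^ 2 - (((y₂ : ℕ) : ℤ) : ℝ) ^ 2)))]
    simp
  have hswap : ∑ y₂ ∈ Ico (1 : ℤ) (Y + 1), ∑ y₁ ∈ Ico (1 : ℤ) (Y + 1),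
        ee (ξ * ((y₁ : ℝ) ^ 2 - (y₂ : ℝ) ^ 2)) =
      ∑ s ∈ Ioo (-Y : ℤ) Y, ∑ y ∈ Ico (max 1 (1 - s)) (min (Y + 1) (Y + 1 - s)),
        ee (ξ * s ^ 2 + y * (2 * s * ξ)) := by
    rw [sum_sigma', sum_sigma']
    refine sum_bij' (fun p _ => ⟨p.2 - p.1, p.1⟩) (fun p _ => ⟨p.2, p.2 + p.1⟩) ?_ ?_ ?_ ?_ ?_
    · rintro ⟨a, b⟩ h; simp at h ⊢; omega
    · rintro ⟨a, b⟩ h; simp at h ⊢; omega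
    · rintro ⟨a, b⟩ h; simp
    · rintro ⟨a, b⟩ h; simp
    · rintro ⟨a, b⟩ h; congr 1; push_cast; ring
  have hbound : ‖quadSum ξ Y‖ ^ 2 ≤ ∑ s ∈ Ioo (-Y : ℤ) Y, F s := by
    have : ‖quadSum ξ Y‖ ^ 2 = ‖((‖quadSum ξ Y‖ ^ 2 : ℝ) : ℂ)‖ := by
      rw [Complex.norm_real, Real.norm_of_nonneg (by positivity)]
    rw [this, hZ, hswap]
    refine (norm_sum_le _ _).trans (sum_le_sum fun s _ => ?_)
    refine norm_sum_Ico_ee_le _ _ _ _ _ (by positivity) ?_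
    have h1 : (min (Y + 1) (Y + 1 - s) : ℤ) - (max 1 (1 - s) : ℤ) ≤ Y := by omega
    exact_mod_cast h1
  have hFneg : ∀ s, F (-s) = F s := by
    intro s
    simp only [hF]
    rw [← fejer_neg, ← AddCircle.coe_neg]; congr 3; push_cast; ring
  rcases Nat.eq_zero_or_pos Y with rfl | hY
  · simp [quadSum]
  have hsplit : Ioo (-Y : ℤ) Y = ((Ioo (-Y : ℤ) 0) ∪ {0}) ∪ Ioo (0 : ℤ) Y := by
    ext s; simp; omega
  have hpos : ∑ s ∈ Ioo (0 : ℤ) Y, F s = ∑ s ∈ Ico 1 Y, F s := by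
    symm
    refine sum_bij (fun j _ => (j : ℤ)) (fun j hj => ?_) (fun i _ j _ h => by simpa using h)
      (fun j hj => ?_) (fun j _ => rfl)
    · simp at hj ⊢; omega
    · simp only [mem_Ioo] at hj
      exact ⟨j.toNat, by simp; omega, by omega⟩
  have hneg : ∑ s ∈ Ioo (-Y : ℤ) 0, F s = ∑ s ∈ Ioo (0 : ℤ) Y, F s := by
    refine sum_bij' (fun j _ => -j) (fun j _ => -j) ?_ ?_ ?_ ?_ ?_
    · intro a h; simp at h ⊢; omega
    · intro a h; simp at h ⊢; omega
    · simp
    · simp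
    · intro a _; exact (hFneg a).symm
  have h0 : F 0 ≤ 2 * Y := fejer_le (by positivity) _
  rw [hsplit, sum_union, sum_union, sum_singleton, hneg, hpos] at hbound
  · simp only [hF, Int.cast_natCast] at hbound h0 ⊢
    linarith
  · rw [disjoint_left]; intro a; simp; omega
  · rw [disjoint_left]; intro a; simp; omega

/-! ### Averaging the Fejér-type kernel over multiples of `α` -/

theorem sum_range_mul_le {f : ℕ → ℝ} {B : ℝ} {q : ℕ} (h : ∀ i, ∑ j ∈ range q, f (i + j) ≤ B) (k : ℕ) :
    ∑ m ∈ range (k * q), f m ≤ k * B := by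
  induction k with
  | zero => simp
  | succ k ih =>
    rw [Nat.succ_mul, sum_range_add]
    have := h (k * q)
    push_cast
    linarith

theorem sum_natAbs_le {ι : Type*} (s : Finset ι) (v : ι → ℤ) (hv : Set.InjOn v s) (q : ℕ)
    (hq : ∀ i ∈ s, (v i).natAbs ≤ q) (f : ℕ → ℝ) (hf : ∀ n, 0 ≤ f n) :
    ∑ i ∈ s, f (v i).natAbs ≤ 2 * ∑ n ∈ range (q + 1), f n := by
  classical
  calc ∑ i ∈ s, f (v i).natAbs = ∑ n ∈ range (q + 1), ∑ i ∈ s with (v i).natAbs = n,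
        f (v i).natAbs := by
        rw [sum_fiberwise_of_maps_to]
        intro i hi; have := hq i hi; simp; omega
    _ ≤ ∑ n ∈ range (q + 1), 2 * f n := by
        refine sum_le_sum fun n _ => ?_
        have h1 : ∑ i ∈ s with (v i).natAbs = n, f (v i).natAbs =
            ∑ i ∈ s with (v i).natAbs = n, f n :=
          sum_congr rfl fun i hi => by rw [(mem_filter.mp hi).2]
        rw [h1, sum_const, nsmul_eq_mul]
        have h2 : (s.filter fun i => (v i).natAbs = n).card ≤ ({(n : ℤ), -(n : ℤ)} : Finset ℤ).card := by
          refine card_le_card_of_injOn v (fun i hi => ?_) (fun i hi j hj h => ?_)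
          · have := (mem_filter.mp hi).2
            simp; omega
          · exact hv (mem_filter.mp hi).1 (mem_filter.mp hj).1 h
        have h3 : ({(n : ℤ), -(n : ℤ)} : Finset ℤ).card ≤ 2 := card_le_two
        have h4 : ((s.filter fun i => (v i).natAbs = n).card : ℝ) ≤ 2 := by
          exact_mod_cast h2.trans h3
        exact mul_le_mul_of_nonneg_right h4 (hf n)
    _ = _ := (mul_sum _ _ _).symm

theorem norm_unitAddCircle_div (q : ℕ) [NeZero q] (v : ℤ) (h : (v.natAbs : ℝ) ≤ q / 2) :
    ‖((v / q : ℝ) : UnitAddCircle)‖ = v.natAbs / q := by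
  have hq : (0 : ℝ) < q := by exact_mod_cast Nat.pos_of_ne_zero (NeZero.ne q)
  have h1 : |(v / q : ℝ)| = v.natAbs / q := by
    rw [abs_div, Nat.cast_natAbs, abs_of_pos hq, Int.cast_abs]
  rw [← h1]
  rw [AddCircle.norm_coe_eq_abs_iff 1 (by norm_num), h1, abs_one, div_le_iff₀ hq]
  linarith

theorem sum_range_fejer_le {α : ℝ} {a : ℤ} {q : ℕ} [NeZero q] (hc : IsCoprime a (q : ℤ))
    (hα : |α - a / q| ≤ 1 / (q : ℝ) ^ 2) {Y : ℝ} (hY : 0 ≤ Y) (m : ℕ) :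
    ∑ j ∈ range q, fejer Y (((m + j : ℕ) * α : ℝ) : UnitAddCircle) ≤
      12 * Y + 12 * q * (1 + Real.log q) := by
  have hq : (0 : ℝ) < q := by exact_mod_cast Nat.pos_of_ne_zero (NeZero.ne q)
  set c : ℤ := ⌊q * (m * α)⌋
  set v : ℕ → ℤ := fun j => ((c + j * a : ℤ) : ZMod q).valMinAbs with hv
  set G : ℕ → ℝ := fun n => (if n ≤ 2 then 2 * Y else 0) + 6 * q * (1 / n) with hG
  have hGnn : ∀ n, 0 ≤ G n := fun n => by simp only [hG]; split_ifs <;> positivity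
  have hvq : ∀ j, 2 * (v j).natAbs ≤ q := fun j => by
    have := ZMod.natAbs_valMinAbs_le (n := q) ((c + j * a : ℤ) : ZMod q)
    simp only [hv]; omega
  have hbound : ∀ j ∈ range q, fejer Y (((m + j : ℕ) * α : ℝ) : UnitAddCircle) ≤ G (v j).natAbs := by
    intro j hj
    have hjq : (j : ℝ) ≤ q := by exact_mod_cast (mem_range.mp hj).le
    set x : UnitAddCircle := (((m + j : ℕ) * α : ℝ) : UnitAddCircle) with hx
    set ε : ℝ := (m + j : ℕ) * α - (c + j * a) / q with hε
    have hεb : |ε| ≤ 2 / q := by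
      have e1 : ε = (q * (m * α) - c) / q + j * (α - a / q) := by
        rw [hε]; push_cast; field_simp; ring
      have h1 : |(q * (m * α) - c) / q| ≤ 1 / q := by
        rw [abs_div, abs_of_pos hq]
        gcongr
        rw [abs_le]
        have := Int.floor_le (q * (m * α)); have := Int.lt_floor_add_one (q * (m * α))
        constructor <;> linarith
      have h2 : |j * (α - a / q)| ≤ 1 / q := by
        rw [abs_mul, Nat.abs_cast]
        calc (j : ℝ) * |α - a / q| ≤ q * (1 / (q : ℝ) ^ 2) := by gcongr
          _ = 1 / q := by field_simp
      rw [e1]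
      refine (abs_add_le _ _).trans ?_
      have : (2 : ℝ) / q = 1 / q + 1 / q := by ring
      linarith
    have hxv : x = ((v j / q : ℝ) : UnitAddCircle) + (ε : UnitAddCircle) := by
      have hdvd : (q : ℤ) ∣ (c + j * a) - v j := by
        rw [← ZMod.intCast_eq_intCast_iff_dvd_sub]
        simp only [hv, ZMod.coe_valMinAbs]
      obtain ⟨k, hk⟩ := hdvd
      have hk' : (c + j * a : ℝ) = v j + q * k := by
        have : (c + j * a : ℤ) = v j + q * k := by linarith
        exact_mod_cast this
      rw [hx, ← AddCircle.coe_add, hε, hk']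
      have : ((m + j : ℕ) * α : ℝ) = (v j / q + ((m + j : ℕ) * α - (v j + q * k) / q)) + (k : ℤ) := by
        field_simp; ring
      rw [this, AddCircle.coe_add]
      have hk0 : (((k : ℤ) : ℝ) : UnitAddCircle) = 0 := by
        rw [AddCircle.coe_eq_zero_iff]; exact ⟨k, by simp⟩
      rw [hk0, add_zero]
      congr 1; field_simp; ring
    have hnorm : ((v j).natAbs : ℝ) / q - 2 / q ≤ ‖x‖ := by
      have h1 : ‖((v j / q : ℝ) : UnitAddCircle)‖ = (v j).natAbs / q := by
        apply norm_unitAddCircle_div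
        have : (2 * (v j).natAbs : ℝ) ≤ q := by exact_mod_cast hvq j
        linarith
      have h2 : ‖(ε : UnitAddCircle)‖ ≤ |ε| := by
        have := round_le ε 0
        rw [UnitAddCircle.norm_eq]; simpa using this
      have h3 : ‖((v j / q : ℝ) : UnitAddCircle)‖ ≤ ‖x‖ + ‖(ε : UnitAddCircle)‖ := by
        have : ((v j / q : ℝ) : UnitAddCircle) = x - (ε : UnitAddCircle) := by rw [hxv]; abel
        rw [this]; exact norm_sub_le _ _
      linarith
    simp only [hG]
    split_ifs with h
    · have := fejer_le hY x
      have h0 : (0 : ℝ) ≤ 6 * q * (1 / (v j).natAbs) := by positivity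
      linarith
    · rw [zero_add]
      have h3 : (3 : ℝ) ≤ (v j).natAbs := by exact_mod_cast (by omega : 3 ≤ (v j).natAbs)
      set V : ℝ := ((v j).natAbs : ℝ)
      have h4 : V / (3 * q) ≤ ‖x‖ := by
        refine le_trans ?_ hnorm
        rw [← sub_div, div_le_div_iff₀ (by positivity) hq]
        nlinarith
      have h5 := fejer_mul_norm_le hY x
      have h6 : fejer Y x * (V / (3 * q)) ≤ 2 :=
        (mul_le_mul_of_nonneg_left h4 (fejer_nonneg hY x)).trans h5
      have hV : 0 < V := by linarith
      rw [mul_div_assoc', div_le_iff₀ (by positivity)] at h6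
      rw [mul_one_div, le_div_iff₀ hV]
      linarith
  have hinj : Set.InjOn v (range q) := by
    intro i hi j hj hij
    have h1 := ZMod.injective_valMinAbs hij
    rw [ZMod.intCast_eq_intCast_iff_dvd_sub] at h1
    have h2 : (q : ℤ) ∣ a * (j - i) := by
      have : c + j * a - (c + i * a) = a * ((j : ℤ) - i) := by ring
      rwa [this] at h1
    have h3 := hc.symm.dvd_of_dvd_mul_left h2
    have h4 : ((i : ℕ) : ZMod q) = (j : ℕ) := by
      have := (ZMod.intCast_eq_intCast_iff_dvd_sub (i : ℤ) (j : ℤ) q).mpr h3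
      exact_mod_cast this
    rw [ZMod.natCast_eq_natCast_iff'] at h4
    simp at hi hj
    rwa [Nat.mod_eq_of_lt hi, Nat.mod_eq_of_lt hj] at h4
  calc ∑ j ∈ range q, fejer Y (((m + j : ℕ) * α : ℝ) : UnitAddCircle)
      ≤ ∑ j ∈ range q, G (v j).natAbs := sum_le_sum hbound
    _ ≤ 2 * ∑ n ∈ range (q + 1), G n :=
        sum_natAbs_le _ v hinj q (fun j _ => by have := hvq j; omega) G hGnn
    _ ≤ _ := by
        have h1 : ∑ n ∈ range (q + 1), (if n ≤ 2 then 2 * Y else 0) ≤ 6 * Y := by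
          rw [← sum_filter, sum_const, nsmul_eq_mul]
          have : ((range (q + 1)).filter (· ≤ 2)).card ≤ (range 3).card :=
            card_le_card fun n hn => by simp at hn ⊢; omega
          have : (((range (q + 1)).filter (· ≤ 2)).card : ℝ) ≤ 3 := by
            rw [card_range] at this; exact_mod_cast this
          nlinarith
        have h2 : ∑ n ∈ range (q + 1), (1 / (n : ℝ)) ≤ 1 + Real.log q := by
          refine le_trans (le_of_eq ?_) (harmonic_le_one_add_log q)
          rw [sum_range_succ', harmonic]
          push_cast; simp
        simp only [hG]
        rw [sum_add_distrib, ← mul_sum]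
        have h3 : 6 * (q : ℝ) * ∑ n ∈ range (q + 1), (1 / (n : ℝ)) ≤ 6 * q * (1 + Real.log q) := by
          gcongr
        linarith

theorem sum_Icc_fejer_le {α : ℝ} {a : ℤ} {q : ℕ} [NeZero q] (hc : IsCoprime a (q : ℤ))
    (hα : |α - a / q| ≤ 1 / (q : ℝ) ^ 2) {Y : ℝ} (hY : 0 ≤ Y) (M : ℕ) :
    ∑ m ∈ Icc 1 M, fejer Y ((m * α : ℝ) : UnitAddCircle) ≤
      ((M : ℝ) / q + 1) * (12 * Y + 12 * q * (1 + Real.log q)) := by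
  have hq0 : 0 < q := Nat.pos_of_ne_zero (NeZero.ne q)
  have hq : (1 : ℝ) ≤ q := by exact_mod_cast hq0
  have hlog := Real.log_nonneg hq
  calc ∑ m ∈ Icc 1 M, fejer Y ((m * α : ℝ) : UnitAddCircle)
      ≤ ∑ m ∈ range ((M / q + 1) * q), fejer Y ((m * α : ℝ) : UnitAddCircle) := by
        refine sum_le_sum_of_subset_of_nonneg (fun m hm => ?_) (fun _ _ _ => fejer_nonneg hY _)
        simp at hm ⊢
        exact lt_of_le_of_lt hm.2 (by rw [add_mul, one_mul]; exact Nat.lt_div_mul_add hq0)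
    _ ≤ ((M / q + 1 : ℕ) : ℝ) * (12 * Y + 12 * q * (1 + Real.log q)) :=
        sum_range_mul_le (f := fun m => fejer Y ((m * α : ℝ) : UnitAddCircle))
          (fun i => sum_range_fejer_le hc hα hY i) _
    _ ≤ _ := by
        push_cast
        gcongr
        exact Nat.cast_div_le

/-! ### Bilinear sums with a quadratic phase -/

theorem quadSum_norm_le (ξ : ℝ) (Y : ℕ) : ‖quadSum ξ Y‖ ≤ Y := by
  refine (norm_sum_le _ _).trans ?_
  simp

theorem norm_sq_quadSum_mul_sq_le (α : ℝ) {D : ℕ} (hD : 1 ≤ D) (t : ℕ) :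
    ‖quadSum (α * (D : ℝ) ^ 2) (t / D)‖ ^ 2 ≤
      2 * t + 2 * ∑ m ∈ Icc 1 (2 * D * t), fejer t ((m * α : ℝ) : UnitAddCircle) := by
  have hle : ((t / D : ℕ) : ℝ) ≤ t := by exact_mod_cast Nat.div_le_self t D
  refine (norm_sq_quadSum_le _ _).trans ?_
  gcongr ?_ + 2 * ?_
  · gcongr
  calc ∑ s ∈ Ico 1 (t / D), fejer ((t / D : ℕ) : ℝ) ((2 * s * (α * (D : ℝ) ^ 2) : ℝ) : UnitAddCircle)
      ≤ ∑ s ∈ Ico 1 (t / D), fejer t (((2 * s * D ^ 2 : ℕ) * α : ℝ) : UnitAddCircle) := by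
        refine sum_le_sum fun s _ => ?_
        have : (2 * s * (α * (D : ℝ) ^ 2) : ℝ) = ((2 * s * D ^ 2 : ℕ) * α : ℝ) := by
          push_cast; ring
        rw [this]
        exact fejer_mono (by positivity) hle _
    _ = ∑ m ∈ (Ico 1 (t / D)).image (fun s : ℕ => 2 * s * D ^ 2),
          fejer t (((m : ℕ) * α : ℝ) : UnitAddCircle) := by
        rw [sum_image]
        intro a _ b _ h
        have : 0 < D ^ 2 := by positivity
        have h' : 2 * a = 2 * b := Nat.eq_of_mul_eq_mul_right this h
        omega
    _ ≤ _ := by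
        refine sum_le_sum_of_subset_of_nonneg (fun m hm => ?_)
          (fun _ _ _ => fejer_nonneg (by positivity) _)
        simp only [mem_image, mem_Ico, mem_Icc] at hm ⊢
        obtain ⟨s, ⟨h1, h2⟩, rfl⟩ := hm
        refine ⟨Nat.pos_of_ne_zero (by have : 0 < s := h1; positivity), ?_⟩
        have h3 : s * D ≤ t := (Nat.mul_le_mul_right D h2.le).trans (Nat.div_mul_le_self t D)
        calc 2 * s * D ^ 2 = 2 * D * (s * D) := by ring
          _ ≤ _ := by gcongr

theorem sq_norm_sum_mul_le {ι : Type*} (s : Finset ι) (c : ι → ℝ) (f : ι → ℂ) {B : ℝ}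
    (hc : ∀ i ∈ s, |c i| ≤ B) :
    ‖∑ i ∈ s, (c i : ℂ) * f i‖ ^ 2 ≤ s.card * B ^ 2 * ∑ i ∈ s, ‖f i‖ ^ 2 := by
  calc ‖∑ i ∈ s, (c i : ℂ) * f i‖ ^ 2 ≤ (∑ i ∈ s, |c i| * ‖f i‖) ^ 2 := by
        gcongr
        refine (norm_sum_le _ _).trans (le_of_eq (sum_congr rfl fun i _ => ?_))
        rw [norm_mul, Complex.norm_real, Real.norm_eq_abs]
    _ ≤ (∑ i ∈ s, |c i| ^ 2) * ∑ i ∈ s, ‖f i‖ ^ 2 := sum_mul_sq_le_sq_mul_sq _ _ _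
    _ ≤ _ := by
        gcongr
        rw [← nsmul_eq_mul]
        refine sum_le_card_nsmul _ _ _ fun i hi => ?_
        have := hc i hi
        gcongr

theorem sq_norm_sum_le {ι : Type*} (s : Finset ι) (f : ι → ℂ) :
    ‖∑ i ∈ s, f i‖ ^ 2 ≤ s.card * ∑ i ∈ s, ‖f i‖ ^ 2 := by
  simpa using sq_norm_sum_mul_le s (fun _ => (1 : ℝ)) f (B := 1) (by simp)

/-- The coefficients of the differenced bilinear sum. -/
def pairPhase (α : ℝ) (t D : ℕ) (y : ℕ × ℕ) : ℂ :=
  if y.1 ≤ t / D ∧ y.2 ≤ t / D then ee (α * (D : ℝ) ^ 2 * ((y.1 : ℝ) ^ 2 - (y.2 : ℝ) ^ 2)) else 0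

theorem sum_norm_sq_eq_sum_pairPhase (α : ℝ) {K : ℕ} (hK : 1 ≤ K) (t : ℕ) :
    ((∑ D ∈ Ico K (2 * K), ‖quadSum (α * (D : ℝ) ^ 2) (t / D)‖ ^ 2 : ℝ) : ℂ) =
      ∑ y ∈ Icc 1 (t / K) ×ˢ Icc 1 (t / K), ∑ D ∈ Ico K (2 * K), pairPhase α t D y := by
  rw [sum_comm]
  push_cast
  refine sum_congr rfl fun D hD => ?_
  have hDK : t / D ≤ t / K := Nat.div_le_div_left (mem_Ico.mp hD).1 hK
  have := norm_sq_quadSum (α * (D : ℝ) ^ 2) (t / D)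
  push_cast at this
  rw [this, ← sum_product']
  simp only [pairPhase]
  rw [← sum_filter]
  refine sum_congr ?_ fun _ _ => rfl
  ext ⟨a, b⟩
  simp; omega

theorem sum_norm_sq_sum_pairPhase (α : ℝ) {K : ℕ} (hK : 1 ≤ K) (t : ℕ) :
    ∑ y ∈ Icc 1 (t / K) ×ˢ Icc 1 (t / K), ‖∑ D ∈ Ico K (2 * K), pairPhase α t D y‖ ^ 2 =
      ∑ D₁ ∈ Ico K (2 * K), ∑ D₂ ∈ Ico K (2 * K),
        ‖quadSum (α * ((D₁ : ℝ) ^ 2 - (D₂ : ℝ) ^ 2)) (min (t / D₁) (t / D₂))‖ ^ 2 := by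
  rw [← Complex.ofReal_inj]
  push_cast
  have h1 : ∀ y : ℕ × ℕ, ((‖∑ D ∈ Ico K (2 * K), pairPhase α t D y‖ : ℂ)) ^ 2 =
      ∑ D₁ ∈ Ico K (2 * K), ∑ D₂ ∈ Ico K (2 * K),
        pairPhase α t D₁ y * (starRingEnd ℂ) (pairPhase α t D₂ y) := by
    intro y
    rw [← Complex.ofReal_pow, ← Complex.normSq_eq_norm_sq, ← Complex.mul_conj, map_sum, sum_mul_sum]
  simp only [h1]
  rw [sum_comm]
  refine sum_congr rfl fun D₁ hD₁ => ?_
  rw [sum_comm]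
  refine sum_congr rfl fun D₂ hD₂ => ?_
  have hDK₁ : t / D₁ ≤ t / K := Nat.div_le_div_left (mem_Ico.mp hD₁).1 hK
  have hDK₂ : t / D₂ ≤ t / K := Nat.div_le_div_left (mem_Ico.mp hD₂).1 hK
  have := norm_sq_quadSum (α * ((D₁ : ℝ) ^ 2 - (D₂ : ℝ) ^ 2)) (min (t / D₁) (t / D₂))
  push_cast at this
  rw [this, ← sum_product']
  have h2 : ∀ y : ℕ × ℕ, pairPhase α t D₁ y * (starRingEnd ℂ) (pairPhase α t D₂ y) =
      if (y.1 ≤ t / D₁ ∧ y.2 ≤ t / D₁) ∧ (y.1 ≤ t / D₂ ∧ y.2 ≤ t / D₂) then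
        ee (α * ((D₁ : ℝ) ^ 2 - (D₂ : ℝ) ^ 2) * ((y.1 : ℝ) ^ 2 - (y.2 : ℝ) ^ 2)) else 0 := by
    intro y
    simp only [pairPhase]
    by_cases ha : y.1 ≤ t / D₁ ∧ y.2 ≤ t / D₁ <;> by_cases hb : y.1 ≤ t / D₂ ∧ y.2 ≤ t / D₂
    · rw [if_pos ha, if_pos hb, if_pos ⟨ha, hb⟩, ← ee_sub]; congr 1; ring
    · rw [if_neg hb, map_zero, mul_zero, if_neg (fun h => hb h.2)]
    · rw [if_neg ha, zero_mul, if_neg (fun h => ha h.1)]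
    · rw [if_neg ha, zero_mul, if_neg (fun h => ha h.1)]
  simp only [h2]
  rw [← sum_filter]
  refine sum_congr ?_ fun _ _ => rfl
  ext ⟨a, b⟩
  simp; omega

theorem norm_pow_four_bilinear_le (α : ℝ) (lam : ℕ → ℝ) {Λ : ℝ} {K : ℕ} (hK : 1 ≤ K) (t : ℕ)
    (hlam : ∀ D ∈ Ico K (2 * K), |lam D| ≤ Λ) :
    ‖∑ D ∈ Ico K (2 * K), (lam D : ℂ) * quadSum (α * (D : ℝ) ^ 2) (t / D)‖ ^ 4 ≤
      Λ ^ 4 * (t : ℝ) ^ 2 * ∑ D₁ ∈ Ico K (2 * K), ∑ D₂ ∈ Ico K (2 * K),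
        ‖quadSum (α * ((D₁ : ℝ) ^ 2 - (D₂ : ℝ) ^ 2)) (min (t / D₁) (t / D₂))‖ ^ 2 := by
  set S := ∑ D ∈ Ico K (2 * K), (lam D : ℂ) * quadSum (α * (D : ℝ) ^ 2) (t / D)
  set Q := ∑ D ∈ Ico K (2 * K), ‖quadSum (α * (D : ℝ) ^ 2) (t / D)‖ ^ 2
  set R := ∑ D₁ ∈ Ico K (2 * K), ∑ D₂ ∈ Ico K (2 * K),
        ‖quadSum (α * ((D₁ : ℝ) ^ 2 - (D₂ : ℝ) ^ 2)) (min (t / D₁) (t / D₂))‖ ^ 2 with hR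
  have hR0 : 0 ≤ R := by positivity
  have hQ0 : 0 ≤ Q := by positivity
  have h1 : ‖S‖ ^ 2 ≤ K * Λ ^ 2 * Q := by
    have := sq_norm_sum_mul_le (Ico K (2 * K)) lam
      (fun D => quadSum (α * (D : ℝ) ^ 2) (t / D)) hlam
    rw [Nat.card_Ico, show 2 * K - K = K by omega] at this
    exact this
  have h2 : Q ^ 2 ≤ ((t / K : ℕ) : ℝ) ^ 2 * R := by
    have e1 : Q = ‖(Q : ℂ)‖ := by rw [Complex.norm_real, Real.norm_of_nonneg hQ0]
    rw [e1, sum_norm_sq_eq_sum_pairPhase α hK t, hR, ← sum_norm_sq_sum_pairPhase α hK t]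
    refine (sq_norm_sum_le _ _).trans (le_of_eq ?_)
    rw [card_product, Nat.card_Icc, Nat.add_sub_cancel]; push_cast; ring
  have h3 : (K : ℝ) * ((t / K : ℕ) : ℝ) ≤ t := by exact_mod_cast Nat.mul_div_le t K
  clear_value S Q R
  calc ‖S‖ ^ 4 = (‖S‖ ^ 2) ^ 2 := by ring
    _ ≤ (K * Λ ^ 2 * Q) ^ 2 := by gcongr
    _ = Λ ^ 4 * (K : ℝ) ^ 2 * Q ^ 2 := by ring
    _ ≤ Λ ^ 4 * (K : ℝ) ^ 2 * (((t / K : ℕ) : ℝ) ^ 2 * R) := by gcongr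
    _ = Λ ^ 4 * ((K : ℝ) * ((t / K : ℕ) : ℝ)) ^ 2 * R := by ring
    _ ≤ _ := by gcongr

theorem natAbs_sq_sub_sq (a b : ℕ) :
    ((a : ℤ) ^ 2 - (b : ℤ) ^ 2).natAbs = ((a : ℤ) - b).natAbs * (a + b) := by
  rw [sq_sub_sq, Int.natAbs_mul, mul_comm]; norm_cast

theorem sum_offDiag_fejer_le (α : ℝ) {K : ℕ} (t : ℕ) {τ₀ : ℝ}
    (hτ : ∀ m ∈ Icc 1 (8 * t * K), (m.divisors.card : ℝ) ≤ τ₀) {Y : ℝ} (hY : 0 ≤ Y) :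
    ∑ i ∈ (Ico K (2 * K)).offDiag ×ˢ Ico 1 (t / K),
      fejer Y (((2 * i.2 * ((i.1.1 : ℤ) ^ 2 - (i.1.2 : ℤ) ^ 2).natAbs : ℕ) * α : ℝ) : UnitAddCircle) ≤
      2 * τ₀ ^ 3 * ∑ m ∈ Icc 1 (8 * t * K), fejer Y ((m * α : ℝ) : UnitAddCircle) := by
  classical
  set φ : (ℕ × ℕ) × ℕ → ℕ := fun i => 2 * i.2 * ((i.1.1 : ℤ) ^ 2 - (i.1.2 : ℤ) ^ 2).natAbs with hφ
  set s := (Ico K (2 * K)).offDiag ×ˢ Ico 1 (t / K)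
  have hmaps : ∀ i ∈ s, φ i ∈ Icc 1 (8 * t * K) := by
    rintro ⟨⟨a, b⟩, c⟩ hi
    simp only [s, mem_product, mem_offDiag, mem_Ico] at hi
    obtain ⟨⟨⟨ha1, ha2⟩, ⟨hb1, hb2⟩, hab⟩, hc1, hc2⟩ := hi
    simp only [hφ, natAbs_sq_sub_sq, mem_Icc]
    have h1 : 0 < ((a : ℤ) - b).natAbs := by omega
    have h2 : ((a : ℤ) - b).natAbs ≤ K := by omega
    refine ⟨Nat.one_le_iff_ne_zero.mpr ?_, ?_⟩
    · have : 0 < a + b := by omega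
      positivity
    · have h3 : c * K ≤ t := (Nat.mul_le_mul_right K hc2.le).trans (Nat.div_mul_le_self t K)
      calc 2 * c * (((a : ℤ) - b).natAbs * (a + b)) ≤ 2 * c * (K * (4 * K)) := by
            gcongr; omega
        _ = 8 * (c * K) * K := by ring
        _ ≤ _ := by gcongr
  calc ∑ i ∈ s, fejer Y (((φ i : ℕ) * α : ℝ) : UnitAddCircle)
      = ∑ m ∈ Icc 1 (8 * t * K), ∑ i ∈ s with φ i = m,
          fejer Y (((φ i : ℕ) * α : ℝ) : UnitAddCircle) := by
        rw [sum_fiberwise_of_maps_to hmaps]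
    _ ≤ ∑ m ∈ Icc 1 (8 * t * K), 2 * τ₀ ^ 3 * fejer Y ((m * α : ℝ) : UnitAddCircle) := by
        refine sum_le_sum fun m hm => ?_
        have h1 : ∑ i ∈ s with φ i = m, fejer Y (((φ i : ℕ) * α : ℝ) : UnitAddCircle) =
            ∑ i ∈ s with φ i = m, fejer Y ((m * α : ℝ) : UnitAddCircle) :=
          sum_congr rfl fun i hi => by rw [(mem_filter.mp hi).2]
        rw [h1, sum_const, nsmul_eq_mul]
        refine mul_le_mul_of_nonneg_right ?_ (fejer_nonneg hY _)
        have hm0 : m ≠ 0 := by have := (mem_Icc.mp hm).1; omega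
        have h2 : (s.filter fun i => φ i = m).card ≤
            ((m.divisors ×ˢ m.divisors) ×ˢ (m.divisors ×ˢ (univ : Finset Bool))).card := by
          refine card_le_card_of_injOn
            (fun i => ((i.2, ((i.1.1 : ℤ) - i.1.2).natAbs), (i.1.1 + i.1.2, decide (i.1.1 < i.1.2))))
            ?_ ?_
          · rintro ⟨⟨a, b⟩, c⟩ hi
            have h := (mem_filter.mp hi).2
            simp only [hφ, natAbs_sq_sub_sq] at h
            simp only [coe_product, Set.mem_prod, mem_coe, Nat.mem_divisors, mem_univ, and_true]
            refine ⟨⟨⟨?_, hm0⟩, ⟨?_, hm0⟩⟩, ⟨?_, hm0⟩⟩ <;> rw [← h]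
            · exact Dvd.dvd.mul_right (dvd_mul_left _ _) _
            · exact Dvd.dvd.mul_left (dvd_mul_right _ _) _
            · exact Dvd.dvd.mul_left (dvd_mul_left _ _) _
          · rintro ⟨⟨a, b⟩, c⟩ _ ⟨⟨a', b'⟩, c'⟩ _ h
            simp only [Prod.mk.injEq, decide_eq_decide] at h ⊢
            omega
        have h3 : ((s.filter fun i => φ i = m).card : ℝ) ≤ 2 * (m.divisors.card : ℝ) ^ 3 := by
          refine (Nat.cast_le.mpr h2).trans (le_of_eq ?_)
          simp only [card_product, card_univ, Fintype.card_bool]; push_cast; ring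
        refine h3.trans ?_
        have := hτ m hm
        gcongr
    _ = _ := (mul_sum _ _ _).symm

theorem norm_pow_four_block_le (α : ℝ) (lam : ℕ → ℝ) {Λ : ℝ} {K : ℕ} (hK : 1 ≤ K) (t : ℕ)
    (hlam : ∀ D ∈ Ico K (2 * K), |lam D| ≤ Λ) {τ₀ : ℝ}
    (hτ : ∀ m ∈ Icc 1 (8 * t * K), (m.divisors.card : ℝ) ≤ τ₀) :
    ‖∑ D ∈ Ico K (2 * K), (lam D : ℂ) * quadSum (α * (D : ℝ) ^ 2) (t / D)‖ ^ 4 ≤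
      Λ ^ 4 * (t : ℝ) ^ 2 * ((t : ℝ) ^ 2 / K + 2 * t * K + 4 * τ₀ ^ 3 *
        ∑ m ∈ Icc 1 (8 * t * K), fejer (t / K) ((m * α : ℝ) : UnitAddCircle)) := by
  refine (norm_pow_four_bilinear_le α lam hK t hlam).trans ?_
  have hK0 : (0 : ℝ) < K := by exact_mod_cast hK
  have hlam0 : 0 ≤ Λ := (abs_nonneg _).trans (hlam K (by simp; omega))
  have hY : ((t / K : ℕ) : ℝ) ≤ t / K := Nat.cast_div_le
  have hcard : (Ico K (2 * K)).card = K := by rw [Nat.card_Ico]; omega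
  have hmin : ∀ D₁ ∈ Ico K (2 * K), ∀ D₂, min (t / D₁) (t / D₂) ≤ t / K := fun D₁ h D₂ =>
    (min_le_left _ _).trans (Nat.div_le_div_left (mem_Ico.mp h).1 hK)
  refine mul_le_mul_of_nonneg_left ?_ (by positivity)
  rw [← sum_product', ← diag_union_offDiag, sum_union (disjoint_diag_offDiag _)]
  have hdiag : ∑ p ∈ (Ico K (2 * K)).diag,
      ‖quadSum (α * ((p.1 : ℝ) ^ 2 - (p.2 : ℝ) ^ 2)) (min (t / p.1) (t / p.2))‖ ^ 2 ≤
      (t : ℝ) ^ 2 / K := by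
    calc _ ≤ ∑ p ∈ (Ico K (2 * K)).diag, ((t : ℝ) / K) ^ 2 := by
          refine sum_le_sum fun p hp => ?_
          have h1 := hmin p.1 (mem_diag.mp hp).1 p.2
          have h2 := quadSum_norm_le (α * ((p.1 : ℝ) ^ 2 - (p.2 : ℝ) ^ 2)) (min (t / p.1) (t / p.2))
          gcongr
          exact h2.trans ((Nat.cast_le.mpr h1).trans hY)
      _ = _ := by
          rw [sum_const, diag_card, hcard, nsmul_eq_mul]; field_simp
  have hoff : ∑ p ∈ (Ico K (2 * K)).offDiag,
      ‖quadSum (α * ((p.1 : ℝ) ^ 2 - (p.2 : ℝ) ^ 2)) (min (t / p.1) (t / p.2))‖ ^ 2 ≤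
      2 * t * K + 4 * τ₀ ^ 3 *
        ∑ m ∈ Icc 1 (8 * t * K), fejer (t / K) ((m * α : ℝ) : UnitAddCircle) := by
    calc _ ≤ ∑ p ∈ (Ico K (2 * K)).offDiag, (2 * ((t : ℝ) / K) + 2 * ∑ s ∈ Ico 1 (t / K),
            fejer (t / K) (((2 * s * ((p.1 : ℤ) ^ 2 - (p.2 : ℤ) ^ 2).natAbs : ℕ) * α : ℝ) :
              UnitAddCircle)) := by
          refine sum_le_sum fun p hp => ?_
          have h1 := hmin p.1 (mem_offDiag.mp hp).1 p.2
          have h1' : ((min (t / p.1) (t / p.2) : ℕ) : ℝ) ≤ t / K := (Nat.cast_le.mpr h1).trans hY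
          refine (norm_sq_quadSum_le _ _).trans ?_
          gcongr ?_ + 2 * ?_
          · gcongr
          refine (sum_le_sum fun s _ => fejer_mono (by positivity) h1' _).trans ?_
          refine (sum_le_sum_of_subset_of_nonneg (Ico_subset_Ico_right h1)
            (fun _ _ _ => fejer_nonneg (by positivity) _)).trans (le_of_eq ?_)
          refine sum_congr rfl fun s _ => ?_
          rcases abs_choice ((p.1 : ℤ) ^ 2 - (p.2 : ℤ) ^ 2) with h | h
          · congr 2
            push_cast
            rw [Nat.cast_natAbs, h]; push_cast; ring
          · rw [← fejer_neg, ← AddCircle.coe_neg]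
            congr 2
            push_cast
            rw [Nat.cast_natAbs, h]; push_cast; ring
      _ ≤ _ := by
          rw [sum_add_distrib, sum_const, ← mul_sum, ← sum_product', offDiag_card, hcard, nsmul_eq_mul]
          have h1 := sum_offDiag_fejer_le α t hτ (Y := t / K) (by positivity)
          have h2 : ((K * K - K : ℕ) : ℝ) * (2 * (t / K)) ≤ 2 * t * K := by
            calc ((K * K - K : ℕ) : ℝ) * (2 * ((t : ℝ) / K)) ≤ ((K * K : ℕ) : ℝ) * (2 * (t / K)) := by
                  gcongr; exact Nat.sub_le _ _
              _ = _ := by push_cast; field_simp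
          linarith
  linarith

/-! ### The minor arc estimate -/

/-- A Diophantine and size configuration in which type I quadratic sums exhibit cancellation.
The parameter `x` is a small power of `R ^ 2`, `ℓ` bounds logarithms and divisor functions. -/
structure MinorData (α : ℝ) (t q : ℕ) (a c x R : ℝ) : Prop where
  one_le_a : 1 ≤ a
  one_le_c : 1 ≤ c
  one_le_x : 1 ≤ x
  t_le : (t : ℝ) ≤ a * R
  le_R : x ^ 256 ≤ R
  le_q : x ^ 64 ≤ q
  q_le : (q : ℝ) ≤ R ^ 2 / x ^ 64
  log_le : 1 + Real.log q ≤ c * x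
  approx : ∃ b : ℤ, IsCoprime b (q : ℤ) ∧ |α - b / q| ≤ 1 / (q : ℝ) ^ 2

theorem MinorData.one_le_q {α : ℝ} {t q : ℕ} {a c x R : ℝ} (h : MinorData α t q a c x R) :
    (1 : ℝ) ≤ q := (one_le_pow₀ h.one_le_x).trans h.le_q

theorem MinorData.block_large {α : ℝ} {t q : ℕ} {a c x R : ℝ} (h : MinorData α t q a c x R)
    (lam : ℕ → ℝ) {K : ℕ} (hK : x ^ 16 ≤ K) (hKR : (K : ℝ) ≤ R / x ^ 16)
    (hlam : ∀ D ∈ Ico K (2 * K), |lam D| ≤ c * x)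
    (hτ : ∀ m ∈ Icc 1 (8 * t * K), (m.divisors.card : ℝ) ≤ c * x) :
    ‖∑ D ∈ Ico K (2 * K), (lam D : ℂ) * quadSum (α * (D : ℝ) ^ 2) (t / D)‖ ^ 4 ≤
      867 * a ^ 4 * c ^ 8 * (R ^ 4 / x ^ 8) := by
  obtain ⟨ha, hc, hx, ht, hR, hq, hq', hlog, b, hb, hbα⟩ := id h
  have hq1 := h.one_le_q
  have hx0 : 0 < x := by linarith
  have hK1 : (1 : ℝ) ≤ K := (one_le_pow₀ hx).trans hK
  have hKn : 1 ≤ K := by exact_mod_cast hK1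
  have hR0 : 0 < R := lt_of_lt_of_le (by positivity) hR
  have : NeZero q := ⟨by rintro rfl; norm_num at hq1⟩
  refine (norm_pow_four_block_le α lam hKn t hlam hτ).trans ?_
  have hsum := sum_Icc_fejer_le hb hbα (Y := t / K) (by positivity) (8 * t * K)
  set S := ∑ m ∈ Icc 1 (8 * t * K), fejer (t / K) ((m * α : ℝ) : UnitAddCircle)
  set P := R ^ 2 / x ^ 16 with hP
  have hP0 : 0 < P := by positivity
  have hcx : 1 ≤ c * x := one_le_mul_of_one_le_of_one_le hc hx
  have e1 : (t : ℝ) ^ 2 / K ≤ a ^ 2 * P := by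
    calc (t : ℝ) ^ 2 / K ≤ (a * R) ^ 2 / x ^ 16 := by gcongr
      _ = _ := by rw [hP]; ring
  have e2 : (t : ℝ) * K ≤ a * P := by
    calc (t : ℝ) * K ≤ (a * R) * (R / x ^ 16) := by gcongr
      _ = _ := by rw [hP]; ring
  have e3 : (t : ℝ) ^ 2 / q ≤ a ^ 2 * P := by
    calc (t : ℝ) ^ 2 / q ≤ (a * R) ^ 2 / x ^ 64 := by gcongr
      _ ≤ (a * R) ^ 2 / x ^ 16 := by gcongr; norm_num
      _ = _ := by rw [hP]; ring
  have e4 : (t : ℝ) / K ≤ a * P := by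
    calc (t : ℝ) / K ≤ t * K := by
          rw [div_le_iff₀ (by linarith), mul_assoc]
          exact le_mul_of_one_le_right (by positivity) (by nlinarith)
      _ ≤ _ := e2
  have e5 : (q : ℝ) ≤ P := hq'.trans (by rw [hP]; gcongr; norm_num)
  set ℓ := 1 + Real.log q
  have hℓ : 1 ≤ ℓ := by have := Real.log_nonneg hq1; linarith
  have haa : a ≤ a ^ 2 := by nlinarith
  have hS : S ≤ 216 * a ^ 2 * (c * x) * P := by
    refine hsum.trans ?_
    have e6 : (((8 * t * K : ℕ) : ℝ) / q + 1) * (12 * (t / K) + 12 * q * ℓ) =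
        96 * ((t : ℝ) ^ 2 / q) + 96 * (t * K) * ℓ + 12 * (t / K) + 12 * q * ℓ := by
      push_cast; field_simp; ring
    rw [e6]
    have f1 : (t : ℝ) ^ 2 / q ≤ a ^ 2 * (c * x) * P := by
      refine e3.trans ?_
      gcongr
      exact le_mul_of_one_le_right (by positivity) hcx
    have f2 : (t : ℝ) * K * ℓ ≤ a ^ 2 * (c * x) * P := by
      calc (t : ℝ) * K * ℓ ≤ a * P * (c * x) := by gcongr
        _ ≤ a ^ 2 * P * (c * x) := by gcongr
        _ = _ := by ring
    have f3 : (t : ℝ) / K ≤ a ^ 2 * (c * x) * P := by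
      calc (t : ℝ) / K ≤ a * P * 1 := by linarith
        _ ≤ a ^ 2 * P * (c * x) := by gcongr
        _ = _ := by ring
    have f4 : (q : ℝ) * ℓ ≤ a ^ 2 * (c * x) * P := by
      calc (q : ℝ) * ℓ ≤ 1 * P * (c * x) := by rw [one_mul]; gcongr
        _ ≤ a ^ 2 * P * (c * x) := by gcongr; exact one_le_pow₀ ha
        _ = _ := by ring
    linarith
  have hbr : (t : ℝ) ^ 2 / K + 2 * t * K + 4 * (c * x) ^ 3 * S ≤ 867 * a ^ 2 * (c * x) ^ 4 * P := by
    have g1 : 4 * (c * x) ^ 3 * S ≤ 864 * a ^ 2 * (c * x) ^ 4 * P := by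
      calc 4 * (c * x) ^ 3 * S ≤ 4 * (c * x) ^ 3 * (216 * a ^ 2 * (c * x) * P) := by gcongr
        _ = _ := by ring
    have g2 : a ^ 2 * P ≤ a ^ 2 * (c * x) ^ 4 * P := by
      gcongr
      exact le_mul_of_one_le_right (by positivity) (one_le_pow₀ hcx)
    have g3 : a * P ≤ a ^ 2 * P := by gcongr
    linarith
  have hS0 : 0 ≤ S := sum_nonneg fun _ _ => fejer_nonneg (by positivity) _
  calc (c * x) ^ 4 * (t : ℝ) ^ 2 * ((t : ℝ) ^ 2 / K + 2 * t * K + 4 * (c * x) ^ 3 * S)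
      ≤ (c * x) ^ 4 * (a * R) ^ 2 * (867 * a ^ 2 * (c * x) ^ 4 * P) := by gcongr
    _ = _ := by rw [hP]; field_simp

theorem MinorData.block_small {α : ℝ} {t q : ℕ} {a c x R : ℝ} (h : MinorData α t q a c x R)
    (lam : ℕ → ℝ) {K : ℕ} (hKn : 1 ≤ K) (hK : (K : ℝ) ≤ x ^ 16)
    (hlam : ∀ D ∈ Ico K (2 * K), |lam D| ≤ c * x) :
    ‖∑ D ∈ Ico K (2 * K), (lam D : ℂ) * quadSum (α * (D : ℝ) ^ 2) (t / D)‖ ^ 4 ≤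
      242 ^ 2 * a ^ 4 * c ^ 8 * (R ^ 4 / x ^ 8) := by
  obtain ⟨ha, hc, hx, ht, hR, hq, hq', hlog, b, hb, hbα⟩ := id h
  have hq1 := h.one_le_q
  have hx0 : 0 < x := by linarith
  have hR0 : 0 < R := lt_of_lt_of_le (by positivity) hR
  have : NeZero q := ⟨by rintro rfl; norm_num at hq1⟩
  set ℓ := 1 + Real.log q
  have hℓ : 1 ≤ ℓ := by have := Real.log_nonneg hq1; linarith
  set P := R ^ 2 / x ^ 47 with hP
  have hP0 : 0 < P := by positivity
  have haa : a ≤ a ^ 2 := by nlinarith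
  have hRP : R * x ^ 17 ≤ P := by
    rw [hP, le_div_iff₀ (by positivity)]
    calc R * x ^ 17 * x ^ 47 = R * x ^ 64 := by ring
      _ ≤ R * x ^ 256 := by gcongr; norm_num
      _ ≤ R * R := by gcongr
      _ = _ := by ring
  have hquad : ∀ D ∈ Ico K (2 * K), ‖quadSum (α * (D : ℝ) ^ 2) (t / D)‖ ^ 2 ≤
      242 * a ^ 2 * c * P := by
    intro D hD
    have hD1 : 1 ≤ D := hKn.trans (mem_Ico.mp hD).1
    have hDx : (D : ℝ) ≤ 2 * x ^ 16 := by
      have : (D : ℝ) ≤ 2 * K := by exact_mod_cast (mem_Ico.mp hD).2.le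
      linarith
    refine (norm_sq_quadSum_mul_sq_le α hD1 t).trans ?_
    have hsum := sum_Icc_fejer_le hb hbα (Y := t) (by positivity) (2 * D * t)
    have e6 : (((2 * D * t : ℕ) : ℝ) / q + 1) * (12 * t + 12 * q * ℓ) =
        24 * (D * (t : ℝ) ^ 2 / q) + 24 * (D * t) * ℓ + 12 * t + 12 * q * ℓ := by
      push_cast; field_simp; ring
    rw [e6] at hsum
    have f1 : D * (t : ℝ) ^ 2 / q ≤ 2 * (a ^ 2 * c * P) := by
      calc D * (t : ℝ) ^ 2 / q ≤ (2 * x ^ 16) * (a * R) ^ 2 / x ^ 64 := by gcongr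
        _ = 2 * (a ^ 2 * (R ^ 2 / x ^ 48)) := by field_simp
        _ ≤ 2 * (a ^ 2 * c * P) := by
          gcongr
          · exact le_mul_of_one_le_right (by positivity) hc
          · rw [hP]; gcongr; norm_num
    have f2 : (D : ℝ) * t * ℓ ≤ 2 * (a ^ 2 * c * P) := by
      calc (D : ℝ) * t * ℓ ≤ (2 * x ^ 16) * (a * R) * (c * x) := by gcongr
        _ = 2 * (a * c * (R * x ^ 17)) := by ring
        _ ≤ 2 * (a ^ 2 * c * P) := by gcongr
    have f3 : (t : ℝ) ≤ a ^ 2 * c * P := by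
      calc (t : ℝ) ≤ a * 1 * (R * 1) := by linarith
        _ ≤ a ^ 2 * c * (R * x ^ 17) := by gcongr; exact one_le_pow₀ hx
        _ ≤ a ^ 2 * c * P := by gcongr
    have f4 : (q : ℝ) * ℓ ≤ a ^ 2 * c * P := by
      calc (q : ℝ) * ℓ ≤ (R ^ 2 / x ^ 64) * (c * x) := by gcongr
        _ = 1 * c * (R ^ 2 / x ^ 63) := by field_simp
        _ ≤ a ^ 2 * c * P := by
          gcongr
          · exact one_le_pow₀ ha
          · rw [hP]; gcongr; norm_num
    linarith
  have h1 := sq_norm_sum_mul_le (Ico K (2 * K)) lam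
      (fun D => quadSum (α * (D : ℝ) ^ 2) (t / D)) hlam
  rw [Nat.card_Ico, show 2 * K - K = K by omega] at h1
  have h2 : ∑ D ∈ Ico K (2 * K), ‖quadSum (α * (D : ℝ) ^ 2) (t / D)‖ ^ 2 ≤
      K * (242 * a ^ 2 * c * P) := by
    refine (sum_le_card_nsmul _ _ _ hquad).trans (le_of_eq ?_)
    rw [Nat.card_Ico, show 2 * K - K = K by omega, nsmul_eq_mul]
  set S := ∑ D ∈ Ico K (2 * K), (lam D : ℂ) * quadSum (α * (D : ℝ) ^ 2) (t / D)
  have h3 : ‖S‖ ^ 2 ≤ 242 * a ^ 2 * c ^ 3 * (x ^ 34 * P) := by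
    calc ‖S‖ ^ 2 ≤ K * (c * x) ^ 2 * (K * (242 * a ^ 2 * c * P)) := h1.trans (by gcongr)
      _ ≤ x ^ 16 * (c * x) ^ 2 * (x ^ 16 * (242 * a ^ 2 * c * P)) := by gcongr
      _ = _ := by ring
  clear_value S
  calc ‖S‖ ^ 4 = (‖S‖ ^ 2) ^ 2 := by ring
    _ ≤ (242 * a ^ 2 * c ^ 3 * (x ^ 34 * P)) ^ 2 := by gcongr
    _ = 242 ^ 2 * a ^ 4 * c ^ 6 * (R ^ 4 / x ^ 26) := by rw [hP]; field_simp
    _ ≤ _ := by gcongr <;> first | assumption | norm_num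

theorem sum_Icc_divisorSum_mul (lam : ℕ → ℝ) (α : ℝ) (t : ℕ) :
    ∑ x ∈ Icc 1 t, ((∑ D ∈ x.divisors, lam D : ℝ) : ℂ) * ee (α * (x : ℝ) ^ 2) =
      ∑ D ∈ Icc 1 t, (lam D : ℂ) * quadSum (α * (D : ℝ) ^ 2) (t / D) := by
  simp only [quadSum, Complex.ofReal_sum, sum_mul, mul_sum]
  rw [sum_sigma', sum_sigma']
  refine sum_bij' (fun p _ => ⟨p.2, p.1 / p.2⟩) (fun p _ => ⟨p.1 * p.2, p.1⟩) ?_ ?_ ?_ ?_ ?_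
  · rintro ⟨x, D⟩ h
    simp only [mem_sigma, mem_Icc, Nat.mem_divisors] at h ⊢
    obtain ⟨⟨h1, h2⟩, ⟨k, rfl⟩, h4⟩ := h
    have hD : 0 < D := Nat.pos_of_ne_zero (by rintro rfl; simp at h4)
    have hk : 0 < k := Nat.pos_of_ne_zero (by rintro rfl; simp at h4)
    rw [Nat.mul_div_cancel_left _ hD, Nat.le_div_iff_mul_le hD]
    exact ⟨⟨hD, (Nat.le_mul_of_pos_right _ hk).trans h2⟩, hk, by rwa [mul_comm]⟩
  · rintro ⟨D, y⟩ h
    simp only [mem_sigma, mem_Icc, Nat.mem_divisors] at h ⊢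
    obtain ⟨⟨h1, h2⟩, h3, h4⟩ := h
    rw [Nat.le_div_iff_mul_le h1] at h4
    have : 0 < D * y := Nat.mul_pos h1 h3
    exact ⟨⟨this, by rwa [mul_comm]⟩, dvd_mul_right _ _, this.ne'⟩
  · rintro ⟨x, D⟩ h
    simp only [mem_sigma, mem_Icc, Nat.mem_divisors] at h
    simp [Nat.mul_div_cancel' h.2.1]
  · rintro ⟨D, y⟩ h
    simp only [mem_sigma, mem_Icc] at h
    have : 0 < D := h.1.1
    simp [Nat.mul_div_cancel_left _ this]
  · rintro ⟨x, D⟩ h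
    simp only [mem_sigma, mem_Icc, Nat.mem_divisors] at h
    obtain ⟨_, ⟨k, rfl⟩, h4⟩ := h
    have hD : 0 < D := Nat.pos_of_ne_zero (by rintro rfl; simp at h4)
    rw [Nat.mul_div_cancel_left _ hD]
    congr 2; push_cast; ring

theorem sum_Ico_two_pow (f : ℕ → ℂ) (L : ℕ) :
    ∑ D ∈ Ico 1 (2 ^ L), f D = ∑ i ∈ range L, ∑ D ∈ Ico (2 ^ i) (2 * 2 ^ i), f D := by
  induction L with
  | zero => simp
  | succ L ih =>
    rw [sum_range_succ, ← ih, pow_succ', sum_Ico_consecutive]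
    · exact Nat.one_le_two_pow
    · omega

/-- Type I quadratic exponential sums with divisor-bounded coefficients of level below `R`
save a power of `x` on the minor arcs. -/
theorem MinorData.norm_sum_le {α : ℝ} {t q : ℕ} {a c x R : ℝ} (h : MinorData α t q a c x R)
    (lam : ℕ → ℝ) (hlam : ∀ D, |lam D| ≤ c * x) (hsupp : ∀ D : ℕ, R / x ^ 16 < D → lam D = 0)
    (hτ : ∀ m : ℕ, m ≠ 0 → (m : ℝ) ≤ 8 * a * R ^ 2 → (m.divisors.card : ℝ) ≤ c * x) :
    ‖∑ y ∈ Icc 1 t, ((∑ D ∈ y.divisors, lam D : ℝ) : ℂ) * ee (α * (y : ℝ) ^ 2)‖ ≤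
      (Nat.log 2 t + 1) * (242 * a * c ^ 2 * (R / x ^ 2)) := by
  have hx0 : 0 < x := by linarith [h.one_le_x]
  have hR0 : 0 < R := lt_of_lt_of_le (by positivity) h.le_R
  have ha := h.one_le_a
  have hc := h.one_le_c
  have htlt : t < 2 ^ (Nat.log 2 t + 1) := Nat.lt_pow_succ_log_self (by norm_num) t
  rw [sum_Icc_divisorSum_mul]
  have hext : ∑ D ∈ Icc 1 t, (lam D : ℂ) * quadSum (α * (D : ℝ) ^ 2) (t / D) =
      ∑ D ∈ Ico 1 (2 ^ (Nat.log 2 t + 1)), (lam D : ℂ) * quadSum (α * (D : ℝ) ^ 2) (t / D) := by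
    refine sum_subset (fun D hD => ?_) (fun D hD hD' => ?_)
    · simp at hD ⊢; omega
    · simp at hD hD'
      rw [Nat.div_eq_of_lt (by omega)]; simp [quadSum]
  rw [hext, sum_Ico_two_pow]
  have hblock : ∀ i ∈ range (Nat.log 2 t + 1), ‖∑ D ∈ Ico (2 ^ i) (2 * 2 ^ i),
      (lam D : ℂ) * quadSum (α * (D : ℝ) ^ 2) (t / D)‖ ≤ 242 * a * c ^ 2 * (R / x ^ 2) := by
    intro i _
    set K := 2 ^ i
    set S := ∑ D ∈ Ico K (2 * K), (lam D : ℂ) * quadSum (α * (D : ℝ) ^ 2) (t / D) with hS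
    have hK1 : 1 ≤ K := Nat.one_le_two_pow
    suffices h4 : ‖S‖ ^ 4 ≤ 242 ^ 2 * a ^ 4 * c ^ 8 * (R ^ 4 / x ^ 8) by
      refine le_of_pow_le_pow_left₀ (n := 4) (by norm_num) (by positivity) (h4.trans ?_)
      have : (242 * a * c ^ 2 * (R / x ^ 2)) ^ 4 = 242 ^ 4 * a ^ 4 * c ^ 8 * (R ^ 4 / x ^ 8) := by
        field_simp
      rw [this]
      gcongr <;> norm_num
    rcases le_total (x ^ 16) (K : ℝ) with hK | hK
    · rcases le_or_gt (K : ℝ) (R / x ^ 16) with hKR | hKR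
      · refine (h.block_large lam hK hKR (fun D _ => hlam D) fun m hm => ?_).trans ?_
        · simp only [mem_Icc] at hm
          refine hτ m (by omega) ?_
          have h1 : (m : ℝ) ≤ 8 * t * K := by exact_mod_cast hm.2
          have h2 : (K : ℝ) ≤ R := hKR.trans (div_le_self hR0.le (one_le_pow₀ h.one_le_x))
          calc (m : ℝ) ≤ 8 * t * K := h1
            _ ≤ 8 * (a * R) * R := by gcongr; exact h.t_le
            _ = _ := by ring
        · gcongr; norm_num
      · have : S = 0 := by
          refine sum_eq_zero fun D hD => ?_
          have h1 : (K : ℝ) ≤ D := by exact_mod_cast (mem_Ico.mp hD).1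
          rw [hsupp D (lt_of_lt_of_le hKR h1)]; simp
        rw [this]
        rw [norm_zero, zero_pow (by norm_num)]
        positivity
    · exact h.block_small lam hK1 hK (fun D _ => hlam D)
  refine (_root_.norm_sum_le _ _).trans ((sum_le_card_nsmul _ _ _ hblock).trans (le_of_eq ?_))
  rw [card_range, nsmul_eq_mul]; push_cast; ring

/-! ### Summing periodic sequences against a smooth weight -/

theorem norm_sum_range_le_of_norm_le_one {c : ℕ → ℂ} (hc : ∀ x, ‖c x‖ ≤ 1) (n : ℕ) :
    ‖∑ x ∈ range n, c x‖ ≤ n := by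
  refine (norm_sum_le _ _).trans ((sum_le_sum fun x _ => hc x).trans ?_)
  simp

theorem norm_sum_range_sub_le_of_periodic {c : ℕ → ℂ} (hc : ∀ x, ‖c x‖ ≤ 1) {K : ℕ} (hK : 0 < K)
    (hper : ∀ x, c (x + K) = c x) (n : ℕ) :
    ‖∑ x ∈ range n, c x - (n / K : ℂ) * ∑ x ∈ range K, c x‖ ≤ 2 * K := by
  have hK0 : (0 : ℝ) < K := by exact_mod_cast hK
  have hKc : (K : ℂ) ≠ 0 := by exact_mod_cast hK.ne'
  induction n using Nat.strong_induction_on with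
  | _ n ih =>
    rcases lt_or_ge n K with h | h
    · have h1 := norm_sum_range_le_of_norm_le_one hc n
      have h2 := norm_sum_range_le_of_norm_le_one hc K
      refine (norm_sub_le _ _).trans ?_
      rw [norm_mul, norm_div, Complex.norm_natCast, Complex.norm_natCast]
      have h3 : (n : ℝ) ≤ K := by exact_mod_cast h.le
      have h4 : (n : ℝ) / K ≤ 1 := by rw [div_le_one hK0]; exact h3
      have h5 : (n : ℝ) / K * ‖∑ x ∈ range K, c x‖ ≤ 1 * K := by gcongr
      linarith
    · obtain ⟨m, rfl⟩ : ∃ m, n = K + m := ⟨n - K, by omega⟩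
      have := ih m (by omega)
      rw [sum_range_add]
      have e : ∀ x, c (K + x) = c x := fun x => by rw [add_comm, hper]
      simp only [e]
      convert this using 2
      push_cast
      field_simp
      ring

theorem sum_Icc_ite_dvd (f : ℕ → ℂ) {D : ℕ} (hD : 0 < D) (n : ℕ) :
    ∑ x ∈ Icc 0 n, (if D ∣ x then f x else 0) = ∑ s ∈ range (n / D + 1), f (D * s) := by
  rw [← sum_filter]
  refine (sum_bij (fun s _ => D * s) (fun s hs => ?_) (fun i _ j _ h => ?_) (fun x hx => ?_)
    (fun _ _ => rfl)).symm
  · simp only [mem_range, mem_filter, mem_Icc] at hs ⊢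
    exact ⟨⟨Nat.zero_le _, (Nat.mul_le_mul_left D (Nat.lt_succ_iff.mp hs)).trans
      (Nat.mul_div_le n D)⟩, dvd_mul_right _ _⟩
  · exact Nat.eq_of_mul_eq_mul_left hD h
  · simp only [mem_filter, mem_Icc] at hx
    obtain ⟨⟨_, h⟩, s, rfl⟩ := hx
    refine ⟨s, ?_, rfl⟩
    rw [mem_range, Nat.lt_succ_iff, Nat.le_div_iff_mul_le hD, mul_comm]; exact h

theorem norm_sum_multiples_sub_le {c : ℕ → ℂ} (hc : ∀ x, ‖c x‖ ≤ 1) {D K : ℕ} (hD : 0 < D)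
    (hK : 0 < K) (hper : ∀ x, c (x + D * K) = c x) {t : ℝ} (ht : 0 ≤ t) :
    ‖∑ x ∈ Icc 0 ⌊t⌋₊, (if D ∣ x then c x else 0) -
      (t : ℂ) * ((∑ s ∈ range K, c (D * s)) / (D * K : ℂ))‖ ≤ 3 * K := by
  rw [sum_Icc_ite_dvd c hD]
  have hK0 : (0 : ℝ) < K := by exact_mod_cast hK
  have hD0 : (0 : ℝ) < D := by exact_mod_cast hD
  have hKc : (K : ℂ) ≠ 0 := by exact_mod_cast hK.ne'
  have hDc : (D : ℂ) ≠ 0 := by exact_mod_cast hD.ne'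
  set n := ⌊t⌋₊ / D + 1
  have h1 := norm_sum_range_sub_le_of_periodic (c := fun s => c (D * s)) (fun s => hc _) hK
    (fun s => by rw [mul_add, hper]) n
  set Γ := ∑ s ∈ range K, c (D * s)
  have hΓ : ‖Γ‖ ≤ K := norm_sum_range_le_of_norm_le_one (fun s => hc _) K
  have hn : |(n : ℝ) - t / D| ≤ 1 := by
    have hfl : ⌊t⌋₊ / D = ⌊t / D⌋₊ := by rw [Nat.floor_div_natCast]
    have e : (n : ℝ) = ⌊t / D⌋₊ + 1 := by simp only [n, hfl]; push_cast; ring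
    rw [e, abs_le]
    have := Nat.floor_le (a := t / D) (by positivity)
    have := Nat.lt_floor_add_one (t / D)
    constructor <;> linarith
  have h2 : ‖(n / K : ℂ) * Γ - (t : ℂ) * (Γ / (D * K : ℂ))‖ ≤ 1 := by
    have e : (n / K : ℂ) * Γ - (t : ℂ) * (Γ / (D * K : ℂ)) = (((n : ℝ) - t / D : ℝ) : ℂ) * (Γ / K) := by
      push_cast; field_simp
    rw [e, norm_mul, Complex.norm_real, Real.norm_eq_abs, norm_div, Complex.norm_natCast]
    have h3 : ‖Γ‖ / K ≤ 1 := by rw [div_le_one hK0]; exact hΓ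
    exact mul_le_one₀ hn (by positivity) h3
  have hK1 : (1 : ℝ) ≤ K := by exact_mod_cast hK
  calc _ = ‖(∑ s ∈ range n, c (D * s) - (n / K : ℂ) * Γ) +
        ((n / K : ℂ) * Γ - (t : ℂ) * (Γ / (D * K : ℂ)))‖ := by congr 1; ring
    _ ≤ 2 * K + 1 := (norm_add_le _ _).trans (add_le_add h1 h2)
    _ ≤ _ := by linarith

/-- Abel summation for a sequence with partial sums `κ t + O(E)`. -/
theorem norm_sum_mul_sub_integral_le (c : ℕ → ℂ) (κ : ℂ) {E Y A B : ℝ} (hY : 0 ≤ Y)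
    (hE : ∀ t : ℝ, 0 ≤ t → ‖∑ k ∈ Icc 0 ⌊t⌋₊, c k - (t : ℂ) * κ‖ ≤ E) {F : ℝ → ℂ} (hF : ContDiff ℝ 1 F)
    (hA : ‖F Y‖ ≤ A) (hB : ∀ t ∈ Set.Icc 0 Y, ‖deriv F t‖ ≤ B) :
    ‖∑ k ∈ Icc 0 ⌊Y⌋₊, F k * c k - κ * ∫ t in (0 : ℝ)..Y, F t‖ ≤ E * (A + Y * B) := by
  have hE0 : 0 ≤ E := (norm_nonneg _).trans (hE 0 le_rfl)
  have hdiff : ∀ t, HasDerivAt F (deriv F t) t := fun t =>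
    (hF.differentiable (by norm_num) t).hasDerivAt
  have hcont : Continuous (deriv F) := hF.continuous_deriv (by norm_num)
  have habel := sum_mul_eq_sub_integral_mul c (f := F) hY
    (fun t _ => (hdiff t).differentiableAt) hcont.continuousOn.integrableOn_Icc
  rw [habel, ← intervalIntegral.integral_of_le hY]
  have hint1 : IntervalIntegrable (fun t : ℝ => deriv F t * ∑ k ∈ Icc 0 ⌊t⌋₊, c k)
      MeasureTheory.volume 0 Y := by
    rw [intervalIntegrable_iff_integrableOn_Icc_of_le hY]
    exact integrableOn_mul_sum_Icc c le_rfl hcont.continuousOn.integrableOn_Icc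
  have hint2 : IntervalIntegrable (fun t : ℝ => deriv F t * ((t : ℂ) * κ))
      MeasureTheory.volume 0 Y :=
    (hcont.mul (Complex.continuous_ofReal.mul continuous_const)).intervalIntegrable _ _
  have hparts : ∫ t in (0 : ℝ)..Y, deriv F t * ((t : ℂ) * κ) =
      F Y * ((Y : ℂ) * κ) - κ * ∫ t in (0 : ℝ)..Y, F t := by
    have := intervalIntegral.integral_deriv_mul_eq_sub (a := 0) (b := Y) (u := F)
      (v := fun t : ℝ => (t : ℂ) * κ) (u' := deriv F) (v' := fun _ => κ)
      (fun t _ => hdiff t) (fun t _ => by simpa using (Complex.ofRealCLM.hasDerivAt (x := t)).mul_const κ)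
      (hcont.intervalIntegrable _ _) (by simp)
    have hint3 : IntervalIntegrable (fun t : ℝ => F t * κ) MeasureTheory.volume 0 Y :=
      (hF.continuous.mul continuous_const).intervalIntegrable _ _
    rw [intervalIntegral.integral_add hint2 hint3,
      intervalIntegral.integral_mul_const] at this
    rw [eq_sub_iff_add_eq, mul_comm κ, this]; simp
  have e : F Y * ∑ k ∈ Icc 0 ⌊Y⌋₊, c k - (∫ t in (0 : ℝ)..Y, deriv F t * ∑ k ∈ Icc 0 ⌊t⌋₊, c k) -
      κ * ∫ t in (0 : ℝ)..Y, F t =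
      F Y * (∑ k ∈ Icc 0 ⌊Y⌋₊, c k - (Y : ℂ) * κ) -
        ∫ t in (0 : ℝ)..Y, deriv F t * (∑ k ∈ Icc 0 ⌊t⌋₊, c k - (t : ℂ) * κ) := by
    simp only [mul_sub (deriv F _)]
    rw [intervalIntegral.integral_sub hint1 hint2, hparts]; ring
  rw [e]
  refine (norm_sub_le _ _).trans ?_
  have h1 : ‖F Y * (∑ k ∈ Icc 0 ⌊Y⌋₊, c k - (Y : ℂ) * κ)‖ ≤ A * E := by
    rw [norm_mul]; exact mul_le_mul hA (hE Y hY) (norm_nonneg _) ((norm_nonneg _).trans hA)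
  have h2 : ‖∫ t in (0 : ℝ)..Y, deriv F t * (∑ k ∈ Icc 0 ⌊t⌋₊, c k - (t : ℂ) * κ)‖ ≤ B * E * |Y - 0| := by
    refine intervalIntegral.norm_integral_le_of_norm_le_const fun t ht => ?_
    rw [Set.uIoc_of_le hY] at ht
    rw [norm_mul]
    have hb := hB t ⟨ht.1.le, ht.2⟩
    exact mul_le_mul hb (hE t ht.1.le) (norm_nonneg _) ((norm_nonneg _).trans hb)
  rw [sub_zero, abs_of_nonneg hY] at h2
  linarith

/-! ### The archimedean weight -/

/-- The weight `t e(β(t² - b)/W)`. -/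
def archWeight (W b β t : ℝ) : ℂ := t * ee (β * (t ^ 2 - b) / W)

theorem contDiff_ee : ContDiff ℝ ⊤ ee := by
  unfold ee
  exact (contDiff_const.mul Complex.ofRealCLM.contDiff).cexp

theorem hasDerivAt_ee (t : ℝ) : HasDerivAt ee (2 * Real.pi * Complex.I * ee t) t := by
  unfold ee
  have h := ((Complex.ofRealCLM.hasDerivAt (x := t)).const_mul (2 * Real.pi * Complex.I : ℂ)).cexp
  simpa [mul_comm] using h

theorem contDiff_archWeight (W b β : ℝ) : ContDiff ℝ 1 (archWeight W b β) := by
  unfold archWeight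
  refine Complex.ofRealCLM.contDiff.mul ((contDiff_ee.of_le le_top).comp ?_)
  fun_prop

theorem norm_archWeight (W b β : ℝ) {t : ℝ} (ht : 0 ≤ t) : ‖archWeight W b β t‖ = t := by
  rw [archWeight, norm_mul, norm_ee, Complex.norm_real, Real.norm_of_nonneg ht, mul_one]

theorem hasDerivAt_phase (W b β t : ℝ) :
    HasDerivAt (fun t => ee (β * (t ^ 2 - b) / W))
      (4 * Real.pi * Complex.I * (β / W) * t * ee (β * (t ^ 2 - b) / W)) t := by
  have h1 : HasDerivAt (fun t : ℝ => β * (t ^ 2 - b) / W) (β * (2 * t) / W) t := by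
    simpa using (((hasDerivAt_pow 2 t).sub_const b).const_mul β).div_const W
  refine ((hasDerivAt_ee _).scomp t h1).congr_deriv ?_
  rw [Complex.real_smul]; push_cast; ring

theorem norm_deriv_archWeight_le {W b β Y : ℝ} (hW : 0 < W) {t : ℝ} (ht : t ∈ Set.Icc 0 Y) :
    ‖deriv (archWeight W b β) t‖ ≤ 1 + 4 * Real.pi * |β| * Y ^ 2 / W := by
  have h := (Complex.ofRealCLM.hasDerivAt (x := t)).mul (hasDerivAt_phase W b β t)
  have e : deriv (archWeight W b β) t = 1 * ee (β * (t ^ 2 - b) / W) +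
      t * (4 * Real.pi * Complex.I * (β / W) * t * ee (β * (t ^ 2 - b) / W)) := by
    have h' : archWeight W b β = ⇑Complex.ofRealCLM * fun t => ee (β * (t ^ 2 - b) / W) := by
      funext t; simp [archWeight]
    rw [h', h.deriv]; simp
  rw [e]
  refine (norm_add_le _ _).trans ?_
  have hpi := Real.pi_pos
  simp only [norm_mul, norm_ee, norm_one, mul_one, norm_div, Complex.norm_real, Complex.norm_I,
    Real.norm_eq_abs, abs_of_nonneg ht.1, abs_of_pos hW, abs_of_pos hpi, Complex.norm_ofNat]
  have h2 : t * (4 * Real.pi * (|β| / W) * t) ≤ 4 * Real.pi * |β| * Y ^ 2 / W := by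
    calc t * (4 * Real.pi * (|β| / W) * t) = 4 * Real.pi * |β| * t ^ 2 / W := by ring
      _ ≤ _ := by
        have := ht.1
        have := ht.2
        gcongr
  linarith

theorem norm_integral_archWeight_le (W b β : ℝ) {Y : ℝ} (hY : 0 ≤ Y) :
    ‖∫ t in (0 : ℝ)..Y, archWeight W b β t‖ ≤ Y ^ 2 := by
  have := intervalIntegral.norm_integral_le_of_norm_le_const (a := 0) (b := Y) (C := Y)
    (f := archWeight W b β) fun t ht => by
      rw [Set.uIoc_of_le hY] at ht
      rw [norm_archWeight _ _ _ ht.1.le]; exact ht.2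
  rw [sub_zero, abs_of_nonneg hY] at this
  linarith

theorem integral_archWeight_zero (W b : ℝ) (Y : ℝ) :
    ∫ t in (0 : ℝ)..Y, archWeight W b 0 t = Y ^ 2 / 2 := by
  simp only [archWeight, zero_mul, zero_div, ee_zero, mul_one]
  rw [intervalIntegral.integral_ofReal, integral_id]
  push_cast; ring

theorem norm_ee_sub_one_le (t : ℝ) : ‖ee t - 1‖ ≤ 2 * Real.pi * |t| := by
  have h2 : ee t = Complex.exp (Complex.I * ((2 * Real.pi * t : ℝ) : ℂ)) := by
    rw [ee]; congr 1; push_cast; ring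
  rw [h2]
  refine (Real.norm_exp_I_mul_ofReal_sub_one_le).trans (le_of_eq ?_)
  rw [Real.norm_eq_abs, abs_mul, abs_mul, abs_two, abs_of_pos Real.pi_pos]

/-- When `βN` is a nonzero integer the oscillatory integral over the full range is bounded. -/
theorem norm_integral_archWeight_le_of_int {W b β Y : ℝ} {N : ℤ} (hW : 0 < W) (hb : 0 ≤ b)
    (hY : Y ^ 2 = W * N + b) (hβ : β ≠ 0) {m : ℤ} (hm : β * N = m) :
    ‖∫ t in (0 : ℝ)..Y, archWeight W b β t‖ ≤ b / 2 := by
  have hpi := Real.pi_pos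
  set k : ℂ := 4 * Real.pi * Complex.I * (β / W) with hk
  have hk0 : k ≠ 0 := by
    have h1 : (W : ℂ) ≠ 0 := by exact_mod_cast hW.ne'
    have h2 : (β : ℂ) ≠ 0 := by exact_mod_cast hβ
    have h3 : (Real.pi : ℂ) ≠ 0 := by exact_mod_cast hpi.ne'
    exact mul_ne_zero (mul_ne_zero (mul_ne_zero (by norm_num) h3) Complex.I_ne_zero)
      (div_ne_zero h2 h1)
  have h1 : ∫ t in (0 : ℝ)..Y, archWeight W b β t =
      k⁻¹ * ee (β * (Y ^ 2 - b) / W) - k⁻¹ * ee (β * (0 ^ 2 - b) / W) := by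
    refine intervalIntegral.integral_eq_sub_of_hasDerivAt
      (f := fun t => k⁻¹ * ee (β * (t ^ 2 - b) / W)) (fun t _ => ?_)
      ((contDiff_archWeight W b β).continuous.intervalIntegrable _ _)
    refine ((hasDerivAt_phase W b β t).const_mul k⁻¹).congr_deriv ?_
    simp only [archWeight, ← hk]; field_simp
  have h2 : β * (Y ^ 2 - b) / W = (m : ℤ) := by
    rw [hY, ← hm]; field_simp; ring
  rw [h1, h2, ee_intCast, ← mul_sub, norm_mul, norm_inv, norm_sub_rev]
  have h3 := norm_ee_sub_one_le (β * (0 ^ 2 - b) / W)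
  have h4 : |β * (0 ^ 2 - b) / W| = |β| * b / W := by
    rw [abs_div, abs_mul, abs_of_pos hW]; congr 2
    rw [show (0 : ℝ) ^ 2 - b = -b by ring, abs_neg, abs_of_nonneg hb]
  have h5 : ‖k‖ = 4 * Real.pi * (|β| / W) := by
    simp [hk, abs_of_pos hpi, abs_of_pos hW]
  rw [h4] at h3
  rw [h5]
  have hβ' : 0 < |β| := abs_pos.mpr hβ
  calc (4 * Real.pi * (|β| / W))⁻¹ * ‖ee (β * (0 ^ 2 - b) / W) - 1‖
      ≤ (4 * Real.pi * (|β| / W))⁻¹ * (2 * Real.pi * (|β| * b / W)) := by gcongr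
    _ = b / 2 := by field_simp; norm_num

/-! ### Local factors -/

theorem sum_range_zmod (n : ℕ) [NeZero n] (f : ZMod n → ℂ) :
    ∑ s ∈ range n, f (s : ZMod n) = ∑ s : ZMod n, f s := by
  refine sum_bij' (fun s _ => (s : ZMod n)) (fun s _ => s.val) ?_ ?_ ?_ ?_ ?_
  · simp
  · intro s _; simpa using ZMod.val_lt s
  · intro s hs; exact ZMod.val_cast_of_lt (by simpa using hs)
  · simp
  · simp

theorem stdAddChar_intCast_eq_ee (n : ℕ) [NeZero n] (j : ℤ) :
    ZMod.stdAddChar (j : ZMod n) = ee (j / n) := by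
  rw [ZMod.stdAddChar_coe, ee]; congr 1; push_cast; ring

/-- The arithmetic part `1_{x² ≡ b (W)} e(a(x² - b)/(Wq))` of the phase. -/
def localPhase (W b q : ℕ) (a : ℤ) (x : ℕ) : ℂ :=
  if x ^ 2 ≡ b [MOD W] then ee (a * ((x : ℝ) ^ 2 - b) / (W * q)) else 0

/-- The sum of the arithmetic phase over the multiples of `D` in a period. -/
def localSum (W b q : ℕ) (a : ℤ) (D : ℕ) : ℂ :=
  ∑ s ∈ range (W * q), localPhase W b q a (D * s)

theorem norm_localPhase_le (W b q : ℕ) (a : ℤ) (x : ℕ) : ‖localPhase W b q a x‖ ≤ 1 := by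
  unfold localPhase; split_ifs <;> simp

/-- The arithmetic phase as a function on `ℤ/Wq`. -/
def zmodPhase (W b q : ℕ) [NeZero (W * q)] (a : ℤ) (y : ZMod (W * q)) : ℂ :=
  if ZMod.castHom (dvd_mul_right W q) (ZMod W) (y ^ 2 - b) = 0 then
    ZMod.stdAddChar ((a : ZMod (W * q)) * (y ^ 2 - (b : ZMod (W * q)))) else 0

theorem localPhase_eq_zmodPhase (W b q : ℕ) [NeZero (W * q)] (a : ℤ) (x : ℕ) :
    localPhase W b q a x = zmodPhase W b q a (x : ZMod (W * q)) := by
  unfold localPhase zmodPhase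
  have h1 : x ^ 2 ≡ b [MOD W] ↔
      ZMod.castHom (dvd_mul_right W q) (ZMod W) ((x : ZMod (W * q)) ^ 2 - b) = 0 := by
    rw [← ZMod.natCast_eq_natCast_iff, ← sub_eq_zero]; simp
  have h2 : ((a : ZMod (W * q)) * ((x : ZMod (W * q)) ^ 2 - b)) =
      ((a * ((x : ℤ) ^ 2 - b) : ℤ) : ZMod (W * q)) := by push_cast; ring
  rw [h2, stdAddChar_intCast_eq_ee]
  by_cases h : x ^ 2 ≡ b [MOD W]
  · rw [if_pos h, if_pos (h1.mp h)]; push_cast; rfl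
  · rw [if_neg h, if_neg (fun h' => h (h1.mpr h'))]

theorem localPhase_add_mul (W b q : ℕ) [NeZero (W * q)] (a : ℤ) (D x : ℕ) :
    localPhase W b q a (x + D * (W * q)) = localPhase W b q a x := by
  rw [localPhase_eq_zmodPhase, localPhase_eq_zmodPhase]; congr 1
  push_cast
  have : ((W : ZMod (W * q)) * q) = 0 := by exact_mod_cast ZMod.natCast_self (W * q)
  rw [this]; simp

theorem localSum_eq_sum_zmod (W b q : ℕ) [NeZero (W * q)] (a : ℤ) (D : ℕ) :
    localSum W b q a D = ∑ s : ZMod (W * q), zmodPhase W b q a (D * s) := by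
  rw [localSum, ← sum_range_zmod]
  refine sum_congr rfl fun s _ => ?_
  rw [localPhase_eq_zmodPhase]; push_cast; rfl

/-- The local factor vanishes unless `q` is coprime to `W`. -/
theorem localSum_eq_zero {W b q : ℕ} [NeZero (W * q)] {a : ℤ} {D p : ℕ} (hp : p.Prime)
    (hpW : 4 * p ∣ W) (hpq : p ∣ q) (haq : IsCoprime a (q : ℤ)) (hbW : b.Coprime W)
    (hDW : D.Coprime W) : localSum W b q a D = 0 := by
  rw [localSum_eq_sum_zmod]
  set n := W * q with hn
  have hn0 : n ≠ 0 := NeZero.ne n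
  obtain ⟨W₁, hW₁⟩ := hpW
  obtain ⟨q₁, hq₁⟩ := hpq
  have hpdW : p ∣ W := ⟨4 * W₁, by rw [hW₁]; ring⟩
  set t : ZMod n := ((2 * p * W₁ * q₁ : ℕ) : ZMod n) with ht
  have htt : t * t = 0 := by
    rw [ht, ← Nat.cast_mul, ZMod.natCast_eq_zero_iff]
    exact ⟨W₁ * q₁, by rw [hn, hW₁, hq₁]; ring⟩
  have h2t : 2 * t = ((W * q₁ : ℕ) : ZMod n) := by
    rw [ht, hW₁]; push_cast; ring
  have hp2t : (p : ZMod n) * (2 * t) = 0 := by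
    rw [h2t, ← Nat.cast_mul, ZMod.natCast_eq_zero_iff]
    exact ⟨1, by rw [hn, hq₁]; ring⟩
  have hcast2t : ZMod.castHom (dvd_mul_right W q) (ZMod W) (2 * t) = 0 := by
    rw [h2t, map_natCast, ZMod.natCast_eq_zero_iff]; exact dvd_mul_right _ _
  have hinner : ∀ s : ZMod n, ∑ j ∈ range p, zmodPhase W b q a (D * (s + j * t)) = 0 := by
    intro s
    have hsq : ∀ j : ℕ, ((D : ZMod n) * (s + j * t)) ^ 2 - b =
        ((D : ZMod n) * s) ^ 2 - b + j * (D ^ 2 * s) * (2 * t) := by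
      intro j
      have : ((D : ZMod n) * (s + j * t)) ^ 2 - b =
        ((D : ZMod n) * s) ^ 2 - b + j * (D ^ 2 * s) * (2 * t) + D ^ 2 * j ^ 2 * (t * t) := by ring
      rw [this, htt]; ring
    have hc : ∀ j : ℕ, ZMod.castHom (dvd_mul_right W q) (ZMod W) (((D : ZMod n) * (s + j * t)) ^ 2 - b) =
        ZMod.castHom (dvd_mul_right W q) (ZMod W) (((D : ZMod n) * s) ^ 2 - b) := by
      intro j
      rw [hsq, map_add, map_mul _ _ (2 * t), hcast2t]; simp
    simp only [zmodPhase]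
    by_cases hcond : ZMod.castHom (dvd_mul_right W q) (ZMod W) (((D : ZMod n) * s) ^ 2 - b) = 0
    swap
    · refine sum_eq_zero fun j _ => ?_
      rw [if_neg]; rw [hc]; exact hcond
    set ζ : ℂ := ZMod.stdAddChar ((a : ZMod n) * ((D : ZMod n) ^ 2 * s) * (2 * t)) with hζ
    have hterm : ∀ j ∈ range p, (if ZMod.castHom (dvd_mul_right W q) (ZMod W)
        (((D : ZMod n) * (s + j * t)) ^ 2 - b) = 0 then
        (ZMod.stdAddChar ((a : ZMod n) * (((D : ZMod n) * (s + (j : ZMod n) * t)) ^ 2 - (b : ZMod n))) : ℂ) else 0) =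
        ZMod.stdAddChar ((a : ZMod n) * (((D : ZMod n) * s) ^ 2 - (b : ZMod n))) * ζ ^ j := by
      intro j _
      rw [hc, if_pos hcond, hsq, hζ, ← AddChar.map_nsmul_eq_pow, ← AddChar.map_add_eq_mul]
      congr 1; rw [nsmul_eq_mul]; ring
    rw [sum_congr rfl hterm, ← mul_sum]
    have hζp : ζ ^ p = 1 := by
      rw [hζ, ← AddChar.map_nsmul_eq_pow, nsmul_eq_mul]
      have : (p : ZMod n) * ((a : ZMod n) * (D ^ 2 * s) * (2 * t)) =
        (a : ZMod n) * (D ^ 2 * s) * ((p : ZMod n) * (2 * t)) := by ring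
      rw [this, hp2t, mul_zero, AddChar.map_zero_eq_one]
    have hζ1 : ζ ≠ 1 := by
      intro h1
      rw [hζ, ← AddChar.map_zero_eq_one (ZMod.stdAddChar (N := n))] at h1
      have h0 := ZMod.injective_stdAddChar h1
      have h2 : (a : ZMod n) * (D ^ 2 * s) * (2 * t) =
          ((a * (D ^ 2 * s.val) * (W * q₁) : ℤ) : ZMod n) := by
        rw [h2t]; push_cast; simp
      rw [h2, ZMod.intCast_zmod_eq_zero_iff_dvd] at h0
      have hq₁0 : (W * q₁ : ℤ) ≠ 0 := by
        intro h
        apply hn0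
        have h' : W * q₁ = 0 := by exact_mod_cast h
        rw [hn, hq₁, mul_left_comm, h', mul_zero]
      have h3 : (p : ℤ) ∣ a * (D ^ 2 * s.val) := by
        have e : ((n : ℕ) : ℤ) = p * (W * q₁) := by rw [hn, hq₁]; push_cast; ring
        rw [e] at h0
        exact Int.dvd_of_mul_dvd_mul_right hq₁0 h0
      have hpp : Prime (p : ℤ) := Nat.prime_iff_prime_int.mp hp
      rcases hpp.dvd_or_dvd h3 with h4 | h4
      · have hu := haq.isUnit_of_dvd' h4 (by rw [hq₁]; push_cast; exact dvd_mul_right _ _)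
        exact hpp.not_isUnit hu
      rcases hpp.dvd_or_dvd h4 with h5 | h5
      · have h6 : p ∣ D := by exact_mod_cast hpp.dvd_of_dvd_pow h5
        exact hp.one_lt.ne' (Nat.eq_one_of_dvd_coprimes hDW h6 hpdW)
      · have h6 : p ∣ s.val := by exact_mod_cast h5
        have h7 : ZMod.castHom (dvd_mul_right W q) (ZMod W) (((D : ZMod n) * s) ^ 2 - b) =
            ((((D * s.val : ℕ) : ℤ) ^ 2 - b : ℤ) : ZMod W) := by
          have : ((D : ZMod n) * s) ^ 2 - b = ((((D * s.val : ℕ) : ℤ) ^ 2 - b : ℤ) : ZMod n) := by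
            push_cast; simp
          rw [this, map_intCast]
        rw [h7, ZMod.intCast_zmod_eq_zero_iff_dvd] at hcond
        have h8 : (p : ℤ) ∣ ((D * s.val : ℕ) : ℤ) ^ 2 - b :=
          (Int.natCast_dvd_natCast.mpr hpdW).trans hcond
        have h9 : (p : ℤ) ∣ ((D * s.val : ℕ) : ℤ) ^ 2 :=
          Dvd.dvd.pow (Int.natCast_dvd_natCast.mpr (h6.mul_left D)) (by norm_num)
        have h10 : p ∣ b := by
          have := dvd_sub h9 h8
          rw [sub_sub_cancel] at this
          exact_mod_cast this
        exact hp.one_lt.ne' (Nat.eq_one_of_dvd_coprimes hbW h10 hpdW)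
    have hgeom : ∑ j ∈ range p, ζ ^ j = 0 := by
      have := geom_sum_mul ζ p
      rw [hζp, sub_self] at this
      exact (mul_eq_zero.mp this).resolve_right (sub_ne_zero.mpr hζ1)
    rw [hgeom, mul_zero]
  have hshift : ∀ j ∈ range p, ∑ s : ZMod n, zmodPhase W b q a (D * (s + j * t)) =
      ∑ s : ZMod n, zmodPhase W b q a (D * s) := fun j _ =>
    Equiv.sum_comp (Equiv.addRight ((j : ZMod n) * t)) fun s => zmodPhase W b q a (D * s)
  have h1 : (p : ℂ) * ∑ s : ZMod n, zmodPhase W b q a (D * s) = 0 := by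
    rw [← nsmul_eq_mul, ← card_range p, ← sum_const, ← sum_congr rfl hshift, sum_comm]
    exact sum_eq_zero fun s _ => hinner s
  exact (mul_eq_zero.mp h1).resolve_left (by exact_mod_cast hp.ne_zero)

/-- The quadratic Gauss sum `∑_s e(c (Ds)² / q)`. -/
def gaussSq (q : ℕ) [NeZero q] (c : ZMod q) (D : ℕ) : ℂ :=
  ∑ s : ZMod q, ZMod.stdAddChar (c * ((D : ZMod q) * s) ^ 2)

theorem gaussSq_mul_coprime (q : ℕ) [NeZero q] (c : ZMod q) (D : ℕ) {D' : ℕ} (h : D'.Coprime q) :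
    gaussSq q c (D * D') = gaussSq q c D := by
  unfold gaussSq
  have hu : IsUnit (D' : ZMod q) := (ZMod.isUnit_iff_coprime D' q).mpr h
  refine Eq.trans (sum_congr rfl fun s _ => ?_) (Equiv.sum_comp (Units.mulLeft hu.unit)
    fun s => (ZMod.stdAddChar (c * ((D : ZMod q) * s) ^ 2) : ℂ))
  simp only [Units.mulLeft_apply, IsUnit.unit_spec]
  push_cast
  congr 2; ring

theorem norm_gaussSq_le (q : ℕ) [NeZero q] {c : ZMod q} (hc : IsUnit c) (hq : Odd q) {D : ℕ}
    (hD : 0 < D) : ‖gaussSq q c D‖ ≤ √q * D := by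
  classical
  set χ : AddChar (ZMod q) ℂ := ZMod.stdAddChar
  have hnorm : ∀ y, ‖χ y‖ = 1 := fun y => AddChar.norm_apply χ y
  have h2 : IsUnit (2 : ZMod q) := by
    have := (ZMod.isUnit_iff_coprime 2 q).mpr (Nat.coprime_two_left.mpr hq)
    exact_mod_cast this
  have hsq : ((‖gaussSq q c D‖ ^ 2 : ℝ) : ℂ) =
      ∑ h : ZMod q, χ (c * (D * h) ^ 2) * ∑ s : ZMod q, χ (s * (2 * c * D ^ 2 * h)) := by
    rw [← Complex.normSq_eq_norm_sq, ← Complex.mul_conj, gaussSq, map_sum, sum_mul_sum, sum_comm]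
    simp only [mul_sum]
    rw [sum_comm (γ := ZMod q)]
    conv_rhs => rw [sum_comm]
    rw [sum_comm]
    refine sum_congr rfl fun s _ => ?_
    rw [← Equiv.sum_comp (Equiv.addRight s)]
    refine sum_congr rfl fun h _ => ?_
    change χ _ * (starRingEnd ℂ) (χ _) = _
    rw [← AddChar.map_neg_eq_conj, ← AddChar.map_add_eq_mul, ← AddChar.map_add_eq_mul]
    congr 1
    simp only [Equiv.coe_addRight]; ring
  have hsum : ∀ h : ZMod q, ‖∑ s : ZMod q, χ (s * (2 * c * D ^ 2 * h))‖ ≤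
      if (D ^ 2) • h = 0 then (q : ℝ) else 0 := by
    intro h
    rw [AddChar.sum_mulShift _ (ZMod.isPrimitive_stdAddChar q)]
    have : 2 * c * (D : ZMod q) ^ 2 * h = 0 ↔ (D ^ 2) • h = 0 := by
      rw [mul_assoc, (h2.mul hc).mul_right_eq_zero, nsmul_eq_mul]; push_cast; rfl
    by_cases hh : (D ^ 2) • h = 0
    · rw [if_pos hh, if_pos (this.mpr hh)]; simp [ZMod.card]
    · rw [if_neg hh, if_neg (fun h' => hh (this.mp h'))]; simp
  have hbound : ‖gaussSq q c D‖ ^ 2 ≤ q * (D : ℝ) ^ 2 := by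
    have e : ‖gaussSq q c D‖ ^ 2 = ‖((‖gaussSq q c D‖ ^ 2 : ℝ) : ℂ)‖ := by
      rw [Complex.norm_real, Real.norm_of_nonneg (by positivity)]
    rw [e, hsq]
    calc _ ≤ ∑ h : ZMod q, if (D ^ 2) • h = 0 then (q : ℝ) else 0 := by
          refine (norm_sum_le _ _).trans (sum_le_sum fun h _ => ?_)
          rw [norm_mul, hnorm, one_mul]; exact hsum h
      _ = (univ.filter fun h : ZMod q => (D ^ 2) • h = 0).card * q := by
          rw [← sum_filter, sum_const, nsmul_eq_mul]
      _ ≤ (D : ℝ) ^ 2 * q := by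
          gcongr
          have := IsAddCyclic.card_nsmul_eq_zero_le (α := ZMod q) (n := D ^ 2) (by positivity)
          exact_mod_cast this
      _ = _ := by ring
  rw [← Real.sqrt_sq (norm_nonneg (gaussSq q c D))]
  calc √(‖gaussSq q c D‖ ^ 2) ≤ √(q * (D : ℝ) ^ 2) := Real.sqrt_le_sqrt hbound
    _ = √q * D := by rw [Real.sqrt_mul (by positivity), Real.sqrt_sq (by positivity)]

theorem sum_range_mul_zmod {m n : ℕ} [NeZero m] [NeZero n] (h : m.Coprime n) (f : ZMod m → ℂ)
    (g : ZMod n → ℂ) :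
    ∑ s ∈ range (m * n), f (s : ZMod m) * g (s : ZMod n) = (∑ s, f s) * ∑ s, g s := by
  have : NeZero (m * n) := ⟨mul_ne_zero (NeZero.ne m) (NeZero.ne n)⟩
  set φ := ZMod.chineseRemainder h
  have h1 : ∀ s : ℕ, f (s : ZMod m) * g (s : ZMod n) =
      (fun y : ZMod (m * n) => f (φ y).1 * g (φ y).2) (s : ZMod (m * n)) := by
    intro s; simp [map_natCast]
  rw [sum_congr rfl fun s _ => h1 s,
    sum_range_zmod (m * n) fun y => f (φ y).1 * g (φ y).2, sum_mul_sum, ← Fintype.sum_prod_type']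
  exact Equiv.sum_comp φ.toEquiv fun y : ZMod m × ZMod n => f y.1 * g y.2

theorem card_sqrt_zmod (W b : ℕ) [NeZero W] :
    (∑ s : ZMod W, if s ^ 2 = (b : ZMod W) then (1 : ℂ) else 0) = sigma W b := by
  rw [← sum_range_zmod W fun s => if s ^ 2 = (b : ZMod W) then (1 : ℂ) else 0, sigma, card_filter]
  push_cast
  have h : ∀ s : ℕ, (((s : ZMod W) ^ 2 = (b : ZMod W)) ↔ s ^ 2 ≡ b [MOD W]) := fun s => by
    rw [← ZMod.natCast_eq_natCast_iff]; push_cast; rfl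
  simp only [h]
  have h0 : (if 0 ^ 2 ≡ b [MOD W] then (1 : ℂ) else 0) = if W ^ 2 ≡ b [MOD W] then 1 else 0 := by
    congr 1
    rw [eq_iff_iff, ← h, ← h]; simp
  have h1 : Icc 1 W = Ico 1 (W + 1) := rfl
  have hW : 0 < W := Nat.pos_of_ne_zero (NeZero.ne W)
  rw [h1, sum_Ico_succ_top (by omega), range_eq_Ico, sum_eq_sum_Ico_succ_bot hW, h0, add_comm]

/-- For `q` coprime to `W` the local factor is `σ(b)` times a Gauss sum. -/
theorem localSum_of_coprime {W b q : ℕ} [NeZero W] [NeZero q] {a : ℤ} {D : ℕ} (hq : W.Coprime q)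
    (hDW : D.Coprime W) :
    localSum W b q a D = sigma W b *
      (ZMod.stdAddChar (-((a : ZMod q) * (W : ZMod q)⁻¹ * (b : ZMod q))) *
        gaussSq q ((a : ZMod q) * (W : ZMod q)⁻¹) D) := by
  have hWu : (W : ZMod q) * (W : ZMod q)⁻¹ = 1 := ZMod.coe_mul_inv_eq_one W hq
  have hDu : IsUnit (D : ZMod W) := (ZMod.isUnit_iff_coprime D W).mpr hDW
  set f : ZMod W → ℂ := fun s => if ((D : ZMod W) * s) ^ 2 = (b : ZMod W) then 1 else 0 with hf
  set g : ZMod q → ℂ := fun s =>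
    ZMod.stdAddChar ((a : ZMod q) * (W : ZMod q)⁻¹ * (((D : ZMod q) * s) ^ 2 - (b : ZMod q))) with hg
  have hterm : ∀ s : ℕ, localPhase W b q a (D * s) = f s * g s := by
    intro s
    have hiff : (((D : ZMod W) * (s : ZMod W)) ^ 2 = (b : ZMod W)) ↔ (D * s) ^ 2 ≡ b [MOD W] := by
      rw [← ZMod.natCast_eq_natCast_iff]; push_cast; rfl
    simp only [localPhase, hf, hg, hiff]
    split_ifs with h
    · rw [one_mul]
      have hdvd : (W : ℤ) ∣ ((D * s : ℕ) : ℤ) ^ 2 - b := by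
        have := (Nat.modEq_iff_dvd.mp h.symm)
        exact_mod_cast this
      obtain ⟨k, hk⟩ := hdvd
      have hkq : ((D : ZMod q) * s) ^ 2 - b = (W : ZMod q) * (k : ZMod q) := by
        have := congrArg (Int.cast : ℤ → ZMod q) hk
        push_cast at this; exact this
      rw [hkq, show (a : ZMod q) * (W : ZMod q)⁻¹ * ((W : ZMod q) * k) =
        (a * k) * ((W : ZMod q) * (W : ZMod q)⁻¹) by ring, hWu, mul_one,
        ← Int.cast_mul, stdAddChar_intCast_eq_ee]
      congr 1
      have hkr : ((D * s : ℕ) : ℝ) ^ 2 - b = W * k := by exact_mod_cast hk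
      rw [hkr]
      have : (W : ℝ) ≠ 0 := by exact_mod_cast NeZero.ne W
      push_cast; field_simp
    · simp
  rw [localSum, sum_congr rfl fun s _ => hterm s, sum_range_mul_zmod hq]
  congr 1
  · rw [← card_sqrt_zmod]
    refine Eq.trans (sum_congr rfl fun s _ => ?_) (Equiv.sum_comp (Units.mulLeft hDu.unit)
      fun s => if s ^ 2 = (b : ZMod W) then (1 : ℂ) else 0)
    simp [hf]
  · rw [gaussSq, mul_sum]
    refine sum_congr rfl fun s _ => ?_
    simp only [hg]
    rw [← AddChar.map_add_eq_mul]
    congr 1; ring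

/-! ### Arithmetic functions -/

theorem two_pow_card_primeFactors_le {n : ℕ} (hn : n ≠ 0) :
    2 ^ n.primeFactors.card ≤ n.divisors.card := by
  rw [Nat.card_divisors hn, ← prod_const]
  refine prod_le_prod' fun p hp => ?_
  have := (Nat.prime_of_mem_primeFactors hp).factorization_pos_of_dvd hn
    (Nat.dvd_of_mem_primeFactors hp)
  omega

theorem le_totient_mul_card_divisors {n : ℕ} (hn : n ≠ 0) :
    (n : ℝ) ≤ n.totient * n.divisors.card := by
  have h1 : (n : ℚ) ≤ n.totient * (2 : ℚ) ^ n.primeFactors.card := by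
    rw [Nat.totient_eq_mul_prod_factors, ← prod_const, mul_assoc, ← prod_mul_distrib]
    refine le_mul_of_one_le_right (by positivity) ?_
    refine (prod_const_one (s := n.primeFactors)).symm.le.trans
      (prod_le_prod (fun _ _ => zero_le_one) fun p hp => ?_)
    have hp2 : (2 : ℚ) ≤ p := by exact_mod_cast (Nat.prime_of_mem_primeFactors hp).two_le
    have : (p : ℚ)⁻¹ ≤ 2⁻¹ := inv_anti₀ (by norm_num) hp2
    linarith
  have h2 : ((2 ^ n.primeFactors.card : ℕ) : ℝ) ≤ n.divisors.card := by
    exact_mod_cast two_pow_card_primeFactors_le hn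
  have h3 : (n : ℝ) ≤ n.totient * (2 : ℝ) ^ n.primeFactors.card := by exact_mod_cast h1
  push_cast at h2
  exact h3.trans (by gcongr)

theorem div_totient_le_card_divisors {n : ℕ} (hn : n ≠ 0) :
    (n : ℝ) / n.totient ≤ n.divisors.card := by
  have : (0 : ℝ) < n.totient := by exact_mod_cast Nat.totient_pos.mpr (Nat.pos_of_ne_zero hn)
  rw [div_le_iff₀ this, mul_comm]
  exact le_totient_mul_card_divisors hn

theorem sum_divisors_moebius (n : ℕ) :
    ∑ e ∈ n.divisors, (ArithmeticFunction.moebius e : ℝ) = if n = 1 then 1 else 0 := by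
  have h : ∑ e ∈ n.divisors, ArithmeticFunction.moebius e = if n = 1 then 1 else 0 := by
    rw [← ArithmeticFunction.coe_mul_zeta_apply, ArithmeticFunction.moebius_mul_coe_zeta,
      ArithmeticFunction.one_apply]
  exact_mod_cast h

/-- The Möbius function summed over the divisors `a` of `n` that are coprime to `q` and
divisible by `m`. -/
theorem sum_moebius_coprime_dvd {n q m : ℕ} (hn : Squarefree n) (hm : m.Coprime q) :
    ∑ a ∈ n.divisors.filter (fun a => a.Coprime q ∧ m ∣ a), (ArithmeticFunction.moebius a : ℝ) =
      if m ∣ n ∧ n / m ∣ q then (ArithmeticFunction.moebius m : ℝ) else 0 := by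
  have hn0 : n ≠ 0 := hn.ne_zero
  by_cases hmn : m ∣ n
  swap
  · rw [if_neg (fun h => hmn h.1)]
    refine sum_eq_zero fun a ha => ?_
    simp only [mem_filter, Nat.mem_divisors] at ha
    exact absurd (ha.2.2.trans ha.1.1) hmn
  obtain ⟨k, rfl⟩ := hmn
  have hm0 : 0 < m := Nat.pos_of_ne_zero (left_ne_zero_of_mul hn0)
  have hk0 : k ≠ 0 := right_ne_zero_of_mul hn0
  have hmk := Nat.coprime_of_squarefree_mul hn
  rw [Nat.mul_div_cancel_left _ hm0]
  obtain ⟨k', hk'⟩ := Nat.gcd_dvd_left k q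
  set g := k.gcd q with hg
  have hksq : Squarefree (g * k') := hk' ▸ hn.squarefree_of_dvd (dvd_mul_left k m)
  have hk'0 : k' ≠ 0 := by rintro rfl; simp at hk'; exact hk0 hk'
  have hgk' := Nat.coprime_of_squarefree_mul hksq
  have hk'q : k'.Coprime q := by
    have h1 : (k'.gcd q) ∣ g := Nat.dvd_gcd ((Nat.gcd_dvd_left _ _).trans ⟨g, by rw [hk']; ring⟩)
      (Nat.gcd_dvd_right _ _)
    exact Nat.eq_one_of_dvd_coprimes hgk' h1 (Nat.gcd_dvd_left _ _)
  have hbij : ∑ a ∈ (m * k).divisors.filter (fun a => a.Coprime q ∧ m ∣ a),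
      (ArithmeticFunction.moebius a : ℝ) =
      ∑ e ∈ k'.divisors, (ArithmeticFunction.moebius (m * e) : ℝ) := by
    refine (sum_bij (fun e _ => m * e) (fun e he => ?_) (fun i _ j _ h => ?_) (fun a ha => ?_)
      (fun _ _ => rfl)).symm
    · simp only [mem_filter, Nat.mem_divisors] at he ⊢
      have hek : e ∣ k := he.1.trans ⟨g, by rw [hk']; ring⟩
      exact ⟨⟨Nat.mul_dvd_mul_left m hek, hn0⟩, hm.mul_left (hk'q.coprime_dvd_left he.1),
        dvd_mul_right _ _⟩
    · exact Nat.eq_of_mul_eq_mul_left hm0 h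
    · simp only [mem_filter, Nat.mem_divisors] at ha
      obtain ⟨⟨h1, _⟩, h2, e, rfl⟩ := ha
      have hek : e ∣ k := Nat.dvd_of_mul_dvd_mul_left hm0 h1
      have heq : e.Coprime q := h2.coprime_dvd_left (dvd_mul_left _ _)
      refine ⟨e, ?_, rfl⟩
      rw [Nat.mem_divisors]
      refine ⟨?_, hk'0⟩
      have : e.Coprime g := heq.coprime_dvd_right (Nat.gcd_dvd_right _ _)
      exact this.dvd_of_dvd_mul_left (hk' ▸ hek)
  have hmul : ∀ e ∈ k'.divisors, (ArithmeticFunction.moebius (m * e) : ℝ) =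
      ArithmeticFunction.moebius m * ArithmeticFunction.moebius e := by
    intro e he
    have hek : e ∣ k := (Nat.dvd_of_mem_divisors he).trans ⟨g, by rw [hk']; ring⟩
    rw [ArithmeticFunction.isMultiplicative_moebius.map_mul_of_coprime (hmk.coprime_dvd_right hek)]
    push_cast; ring
  rw [hbij, sum_congr rfl hmul, ← mul_sum, sum_divisors_moebius]
  have hiff : k' = 1 ↔ k ∣ q := by
    constructor
    · rintro rfl
      rw [hk', mul_one]; exact Nat.gcd_dvd_right _ _
    · intro h
      have h1 : k' ∣ q := (Dvd.intro_left g hk'.symm).trans h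
      exact Nat.eq_one_of_dvd_coprimes hk'q dvd_rfl h1
  by_cases h : k ∣ q
  · rw [if_pos (hiff.mpr h), if_pos ⟨dvd_mul_right _ _, h⟩, mul_one]
  · rw [if_neg (fun h' => h (hiff.mp h')), if_neg (fun h' => h h'.2), mul_zero]

theorem one_div_lcm {a b : ℕ} (ha : a ≠ 0) (hb : b ≠ 0) :
    (1 : ℝ) / (a.lcm b) = ∑ m ∈ (a.gcd b).divisors, (m.totient : ℝ) / (a * b) := by
  rw [← sum_div, ← Nat.cast_sum, Nat.sum_totient]
  have h := Nat.gcd_mul_lcm a b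
  have ha' : (a : ℝ) ≠ 0 := by exact_mod_cast ha
  have hb' : (b : ℝ) ≠ 0 := by exact_mod_cast hb
  have hl : (a.lcm b : ℝ) ≠ 0 := by exact_mod_cast Nat.lcm_ne_zero ha hb
  rw [div_eq_div_iff hl (mul_ne_zero ha' hb')]
  have h' : ((a.gcd b : ℕ) : ℝ) * (a.lcm b : ℕ) = a * b := by exact_mod_cast h
  rw [h', one_mul]

/-- Diagonalisation of the quadratic form with matrix `1/[a, b]`. -/
theorem sum_sum_div_lcm {P : ℕ} (hP : P ≠ 0) {S T : Finset ℕ} (hS : S ⊆ P.divisors)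
    (hT : T ⊆ P.divisors) (x y : ℕ → ℝ) :
    ∑ a ∈ S, ∑ b ∈ T, x a * y b / (a.lcm b) =
      ∑ m ∈ P.divisors, (m.totient : ℝ) * (∑ a ∈ S with m ∣ a, x a / a) *
        ∑ b ∈ T with m ∣ b, y b / b := by
  have h1 : ∀ a ∈ S, ∀ b ∈ T, x a * y b / (a.lcm b) =
      ∑ m ∈ P.divisors, if m ∣ a ∧ m ∣ b then (m.totient : ℝ) * (x a / a) * (y b / b) else 0 := by
    intro a ha b hb
    have ha0 : a ≠ 0 := Nat.ne_of_gt (Nat.pos_of_mem_divisors (hS ha))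
    have hb0 : b ≠ 0 := Nat.ne_of_gt (Nat.pos_of_mem_divisors (hT hb))
    rw [← mul_one_div, one_div_lcm ha0 hb0, mul_sum, ← sum_filter]
    have hset : P.divisors.filter (fun m => m ∣ a ∧ m ∣ b) = (a.gcd b).divisors := by
      ext m
      simp only [mem_filter, Nat.mem_divisors, Nat.dvd_gcd_iff]
      constructor
      · rintro ⟨_, h⟩; exact ⟨h, Nat.gcd_ne_zero_left ha0⟩
      · rintro ⟨h, _⟩; exact ⟨⟨h.1.trans (Nat.dvd_of_mem_divisors (hS ha)), hP⟩, h⟩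
    rw [hset]
    refine sum_congr rfl fun m _ => ?_
    have : (a : ℝ) ≠ 0 := by exact_mod_cast ha0
    have : (b : ℝ) ≠ 0 := by exact_mod_cast hb0
    field_simp
  rw [sum_congr rfl fun a ha => sum_congr rfl fun b hb => h1 a ha b hb]
  rw [sum_congr rfl fun a _ => sum_comm, sum_comm]
  refine sum_congr rfl fun m _ => ?_
  rw [mul_assoc, sum_mul_sum, mul_sum, sum_filter]
  refine sum_congr rfl fun a _ => ?_
  split_ifs with h
  · rw [mul_sum, sum_filter]
    refine sum_congr rfl fun b _ => ?_
    by_cases hb : m ∣ b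
    · rw [if_pos ⟨h, hb⟩, if_pos hb]; ring
    · rw [if_neg (fun h' => hb h'.2), if_neg hb]
  · exact sum_eq_zero fun b _ => by rw [if_neg (fun h' => h h'.1)]

theorem lcm_mul_mul {u v a b q : ℕ} (hu : u ∣ q) (hv : v ∣ q) (ha : a.Coprime q) (hb : b.Coprime q) :
    (u * a).lcm (v * b) = u.lcm v * a.lcm b := by
  apply Nat.dvd_antisymm
  · exact Nat.lcm_dvd (Nat.mul_dvd_mul (Nat.dvd_lcm_left _ _) (Nat.dvd_lcm_left _ _))
      (Nat.mul_dvd_mul (Nat.dvd_lcm_right _ _) (Nat.dvd_lcm_right _ _))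
  · apply Nat.Coprime.mul_dvd_of_dvd_of_dvd
    · have h1 : u.lcm v ∣ q := Nat.lcm_dvd hu hv
      have h2 : (a * b).Coprime q := ha.mul_left hb
      exact (h2.symm.coprime_dvd_left h1).coprime_dvd_right (Nat.lcm_dvd_mul a b)
    · exact Nat.lcm_dvd ((dvd_mul_right _ _).trans (Nat.dvd_lcm_left _ _))
        ((dvd_mul_right _ _).trans (Nat.dvd_lcm_right _ _))
    · exact Nat.lcm_dvd ((dvd_mul_left _ _).trans (Nat.dvd_lcm_left _ _))
        ((dvd_mul_left _ _).trans (Nat.dvd_lcm_right _ _))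

/-- Splitting the divisors of a squarefree number into parts dividing and coprime to `q`. -/
theorem sum_divisors_eq_sum_gcd_mul {M : Type*} [AddCommMonoid M] {P q : ℕ} (hP : Squarefree P)
    (f : ℕ → M) :
    ∑ d ∈ P.divisors, f d =
      ∑ u ∈ (P.gcd q).divisors, ∑ a ∈ P.divisors.filter (fun a => a.Coprime q), f (u * a) := by
  have hP0 : P ≠ 0 := hP.ne_zero
  rw [← sum_product']
  refine (sum_bij (fun p _ => p.1 * p.2) ?_ ?_ ?_ (fun _ _ => rfl)).symm
  · rintro ⟨u, a⟩ h
    simp only [mem_product, Nat.mem_divisors, mem_filter, Nat.dvd_gcd_iff] at h ⊢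
    obtain ⟨⟨⟨h1, h2⟩, _⟩, ⟨h3, _⟩, h4⟩ := h
    exact ⟨Nat.Coprime.mul_dvd_of_dvd_of_dvd (h4.symm.coprime_dvd_left h2) h1 h3, hP0⟩
  · rintro ⟨u, a⟩ h ⟨v, b⟩ h' he
    simp only [mem_product, Nat.mem_divisors, mem_filter, Nat.dvd_gcd_iff] at h h' he
    obtain ⟨⟨⟨_, h2⟩, _⟩, ⟨_, _⟩, h4⟩ := h
    obtain ⟨⟨⟨_, h2'⟩, _⟩, ⟨h3', _⟩, h4'⟩ := h'
    have e1 : (u * a).gcd q = u := by rw [h4.gcd_mul_right_cancel, Nat.gcd_eq_left h2]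
    have e2 : (v * b).gcd q = v := by rw [h4'.gcd_mul_right_cancel, Nat.gcd_eq_left h2']
    have huv : u = v := by rw [← e1, he, e2]
    subst huv
    have hu : 0 < u := Nat.pos_of_dvd_of_pos (by assumption : u ∣ P) (Nat.pos_of_ne_zero hP0)
    rw [Nat.eq_of_mul_eq_mul_left hu he]
  · intro d hd
    have hdP := Nat.dvd_of_mem_divisors hd
    obtain ⟨a, ha⟩ := Nat.gcd_dvd_left d q
    have hsq : Squarefree (d.gcd q * a) := ha ▸ hP.squarefree_of_dvd hdP
    have hcop := Nat.coprime_of_squarefree_mul hsq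
    have haq : a.Coprime q := by
      have h1 : (a.gcd q) ∣ d.gcd q := Nat.dvd_gcd ((Nat.gcd_dvd_left _ _).trans
        (Dvd.intro_left _ ha.symm)) (Nat.gcd_dvd_right _ _)
      exact Nat.eq_one_of_dvd_coprimes hcop h1 (Nat.gcd_dvd_left _ _)
    refine ⟨(d.gcd q, a), ?_, ha.symm⟩
    simp only [mem_product, Nat.mem_divisors, mem_filter, Nat.dvd_gcd_iff]
    exact ⟨⟨⟨(Nat.gcd_dvd_left _ _).trans hdP, Nat.gcd_dvd_right _ _⟩, Nat.gcd_ne_zero_left hP0⟩,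
      ⟨(Dvd.intro_left _ ha.symm).trans hdP, hP0⟩, haq⟩

/-! ### Selberg's weights -/

theorem squarefree_sieveProduct (W : ℕ) (z : ℝ) : Squarefree (sieveProduct W z) := by
  unfold sieveProduct
  refine squarefree_prod_of_pairwise_isCoprime (fun p hp q hq hpq => ?_) fun p hp => ?_
  · simp only [coe_filter, Set.mem_ofPred_eq] at hp hq
    simp only [Function.onFun, ← Nat.coprime_iff_isRelPrime]
    exact (Nat.coprime_primes hp.2.1 hq.2.1).mpr hpq
  · exact (mem_filter.mp hp).2.1.squarefree

theorem sieveProduct_ne_zero (W : ℕ) (z : ℝ) : sieveProduct W z ≠ 0 :=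
  (squarefree_sieveProduct W z).ne_zero

theorem coprime_sieveProduct (W : ℕ) (z : ℝ) : (sieveProduct W z).Coprime W :=
  Nat.Coprime.prod_left fun _ hp => (mem_filter.mp hp).2.2

theorem dvd_sieveProduct_iff {W d : ℕ} {z : ℝ} (hd : d ≠ 0) (hdz : (d : ℝ) < z) :
    d ∣ sieveProduct W z ↔ Squarefree d ∧ d.Coprime W := by
  constructor
  · exact fun h => ⟨(squarefree_sieveProduct W z).squarefree_of_dvd h,
      (coprime_sieveProduct W z).coprime_dvd_left h⟩
  · rintro ⟨h1, h2⟩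
    rw [← Nat.prod_primeFactors_of_squarefree h1]
    refine prod_dvd_prod_of_subset _ _ _ fun p hp => ?_
    have hpd := Nat.dvd_of_mem_primeFactors hp
    simp only [mem_filter, mem_range]
    refine ⟨?_, Nat.prime_of_mem_primeFactors hp, h2.coprime_dvd_left hpd⟩
    rw [Nat.lt_ceil]
    exact lt_of_le_of_lt (by exact_mod_cast Nat.le_of_dvd (Nat.pos_of_ne_zero hd) hpd) hdz

/-- The divisors of the sieving product below the level. -/
def sieveSupport (W : ℕ) (z : ℝ) : Finset ℕ :=
  (sieveProduct W z).divisors.filter fun d : ℕ => (d : ℝ) < z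

theorem mem_sieveSupport {W d : ℕ} {z : ℝ} :
    d ∈ sieveSupport W z ↔ d ∣ sieveProduct W z ∧ (d : ℝ) < z := by
  simp [sieveSupport, sieveProduct_ne_zero]

theorem mem_sieveSupport_of_dvd {W d m : ℕ} {z : ℝ} (h : d ∈ sieveSupport W z) (hm : m ∣ d) :
    m ∈ sieveSupport W z := by
  rw [mem_sieveSupport] at h ⊢
  have hd : 0 < d := Nat.pos_of_dvd_of_pos h.1 (Nat.pos_of_ne_zero (sieveProduct_ne_zero W z))
  exact ⟨hm.trans h.1, lt_of_le_of_lt (by exact_mod_cast Nat.le_of_dvd hd hm) h.2⟩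

theorem squarefree_of_mem_sieveSupport {W d : ℕ} {z : ℝ} (h : d ∈ sieveSupport W z) :
    Squarefree d := (squarefree_sieveProduct W z).squarefree_of_dvd (mem_sieveSupport.mp h).1

theorem sieveJ_eq (W : ℕ) (z : ℝ) : sieveJ W z = ∑ d ∈ sieveSupport W z, 1 / (d.totient : ℝ) := rfl

theorem sieveJ_pos (W : ℕ) {z : ℝ} (hz : 1 < z) : 0 < sieveJ W z := by
  rw [sieveJ_eq]
  have h1 : 1 ∈ sieveSupport W z := mem_sieveSupport.mpr ⟨one_dvd _, by simpa using hz⟩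
  refine lt_of_lt_of_le ?_ (single_le_sum (f := fun d : ℕ => 1 / (d.totient : ℝ))
    (fun d _ => by positivity) h1)
  simp

theorem selbergWeight_eq {W d : ℕ} {z : ℝ} (hd : d ∣ sieveProduct W z) :
    selbergWeight W z d = (ArithmeticFunction.moebius d : ℝ) * (d / sieveJ W z) *
      ∑ n ∈ sieveSupport W z with d ∣ n, 1 / (n.totient : ℝ) := by
  have hset : ((sieveProduct W z).divisors.filter fun m : ℕ => (m : ℝ) < z ∧ d ∣ m) =
      (sieveSupport W z).filter (d ∣ ·) := by rw [sieveSupport, filter_filter]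
  unfold selbergWeight
  rw [hset]
  by_cases h : (d : ℝ) < z
  · rw [if_pos ⟨hd, h⟩]
  · rw [if_neg (fun h' => h h'.2)]
    have : (sieveSupport W z).filter (d ∣ ·) = ∅ := by
      rw [filter_eq_empty_iff]
      intro n hn hdn
      exact h (mem_sieveSupport.mp (mem_sieveSupport_of_dvd hn hdn)).2
    rw [this]; simp

theorem selbergWeight_eq_zero {W d : ℕ} {z : ℝ} (h : d ∉ sieveSupport W z) :
    selbergWeight W z d = 0 := by
  unfold selbergWeight
  rw [if_neg]; rwa [mem_sieveSupport] at h

theorem totient_pos_real {n : ℕ} (h : n ≠ 0) : (0 : ℝ) < n.totient := by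
  exact_mod_cast Nat.totient_pos.mpr (Nat.pos_of_ne_zero h)

theorem sum_multiples_one_div_totient_le {W d : ℕ} {z : ℝ} :
    ∑ n ∈ sieveSupport W z with d ∣ n, 1 / (n.totient : ℝ) ≤ 1 / d.totient * sieveJ W z := by
  have h1 : ∀ n ∈ (sieveSupport W z).filter (d ∣ ·), 1 / (n.totient : ℝ) =
      1 / d.totient * (1 / ((n / d).totient : ℝ)) := by
    intro n hn
    obtain ⟨hn1, k, rfl⟩ := mem_filter.mp hn
    have hsq := squarefree_of_mem_sieveSupport hn1
    have hd : 0 < d := Nat.pos_of_ne_zero (left_ne_zero_of_mul hsq.ne_zero)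
    rw [Nat.mul_div_cancel_left _ hd, Nat.totient_mul (Nat.coprime_of_squarefree_mul hsq)]
    push_cast; rw [one_div_mul_one_div]
  rw [sum_congr rfl h1, ← mul_sum]
  gcongr
  rw [← sum_image (f := fun m : ℕ => 1 / (m.totient : ℝ)) (g := fun n => n / d)]
  · rw [sieveJ_eq]
    refine sum_le_sum_of_subset_of_nonneg (fun m hm => ?_) (fun _ _ _ => by positivity)
    obtain ⟨n, hn, rfl⟩ := mem_image.mp hm
    obtain ⟨hn1, hn2⟩ := mem_filter.mp hn
    exact mem_sieveSupport_of_dvd hn1 (Nat.div_dvd_of_dvd hn2)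
  · intro n hn n' hn' h
    simp only [coe_filter, Set.mem_ofPred_eq] at hn hn'
    exact Nat.div_left_inj hn.2 hn'.2 |>.mp h

theorem abs_selbergWeight_le {W : ℕ} {z : ℝ} (hz : 1 < z) (d : ℕ) :
    |selbergWeight W z d| ≤ d.divisors.card := by
  by_cases h : d ∈ sieveSupport W z
  swap
  · rw [selbergWeight_eq_zero h]; simp
  have hJ := sieveJ_pos W hz
  have hd0 : d ≠ 0 := (squarefree_of_mem_sieveSupport h).ne_zero
  have hφ := totient_pos_real hd0
  rw [selbergWeight_eq (mem_sieveSupport.mp h).1, abs_mul, abs_mul]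
  have hμ : |(ArithmeticFunction.moebius d : ℝ)| ≤ 1 := by
    exact_mod_cast ArithmeticFunction.abs_moebius_le_one
  have hs0 : 0 ≤ ∑ n ∈ sieveSupport W z with d ∣ n, 1 / (n.totient : ℝ) :=
    sum_nonneg fun _ _ => by positivity
  rw [abs_of_nonneg hs0, abs_of_nonneg (a := (d : ℝ) / sieveJ W z) (by positivity)]
  calc |(ArithmeticFunction.moebius d : ℝ)| * (d / sieveJ W z) *
        ∑ n ∈ sieveSupport W z with d ∣ n, 1 / (n.totient : ℝ)
      ≤ 1 * (d / sieveJ W z) * (1 / d.totient * sieveJ W z) := by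
        gcongr
        exact sum_multiples_one_div_totient_le
    _ = d / d.totient := by field_simp
    _ ≤ _ := div_totient_le_card_divisors hd0

theorem sum_selbergWeight_div {W q u m : ℕ} {z : ℝ} (hu : u ∣ (sieveProduct W z).gcd q) :
    ∑ a ∈ (sieveProduct W z).divisors.filter (fun a => a.Coprime q) with m ∣ a,
        selbergWeight W z (u * a) / a =
      u / sieveJ W z * ∑ n ∈ sieveSupport W z,
        (if u ∣ n ∧ m.Coprime q ∧ m ∣ n ∧ n / m ∣ q then
          (ArithmeticFunction.moebius u : ℝ) * ArithmeticFunction.moebius m else 0) *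
          (1 / (n.totient : ℝ)) := by
  set P := sieveProduct W z with hP
  have hP0 : P ≠ 0 := sieveProduct_ne_zero W z
  obtain ⟨huP, huq⟩ := Nat.dvd_gcd_iff.mp hu
  have hterm : ∀ a ∈ (P.divisors.filter (fun a => a.Coprime q)).filter (m ∣ ·),
      selbergWeight W z (u * a) / a = u / sieveJ W z * ∑ n ∈ sieveSupport W z,
        (if u ∣ n ∧ a ∣ n then (ArithmeticFunction.moebius u : ℝ) * ArithmeticFunction.moebius a
          else 0) * (1 / (n.totient : ℝ)) := by
    intro a ha
    simp only [mem_filter, Nat.mem_divisors] at ha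
    obtain ⟨⟨⟨haP, _⟩, haq⟩, _⟩ := ha
    have hcop : u.Coprime a := (haq.symm.coprime_dvd_left huq)
    have ha0 : (a : ℝ) ≠ 0 := by
      exact_mod_cast (Nat.pos_of_dvd_of_pos haP (Nat.pos_of_ne_zero hP0)).ne'
    rw [selbergWeight_eq (hcop.mul_dvd_of_dvd_of_dvd huP haP),
      ArithmeticFunction.isMultiplicative_moebius.map_mul_of_coprime hcop, sum_filter, mul_sum,
      mul_sum, sum_div]
    refine sum_congr rfl fun n _ => ?_
    have hiff : u * a ∣ n ↔ u ∣ n ∧ a ∣ n :=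
      ⟨fun h => ⟨(dvd_mul_right _ _).trans h, (dvd_mul_left _ _).trans h⟩,
        fun h => hcop.mul_dvd_of_dvd_of_dvd h.1 h.2⟩
    by_cases h : u * a ∣ n
    · rw [if_pos h, if_pos (hiff.mp h)]; push_cast; field_simp
    · rw [if_neg h, if_neg (fun h' => h (hiff.mpr h'))]; simp
  rw [sum_congr rfl hterm, ← mul_sum, sum_comm]
  congr 1
  refine sum_congr rfl fun n hn => ?_
  rw [← sum_mul]
  congr 1
  have hnP := (mem_sieveSupport.mp hn).1
  have hnsq := squarefree_of_mem_sieveSupport hn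
  by_cases hun : u ∣ n
  swap
  · rw [if_neg (fun h => hun h.1)]
    exact sum_eq_zero fun a _ => by rw [if_neg (fun h => hun h.1)]
  by_cases hm : m.Coprime q
  swap
  · rw [if_neg (fun h => hm h.2.1)]
    refine sum_eq_zero fun a ha => absurd ?_ hm
    simp only [mem_filter] at ha
    exact ha.1.2.coprime_dvd_left ha.2
  have h1 := sum_moebius_coprime_dvd (n := n) hnsq hm
  have h2 : ∑ a ∈ (P.divisors.filter (fun a => a.Coprime q)).filter (m ∣ ·),
      (if u ∣ n ∧ a ∣ n then (ArithmeticFunction.moebius u : ℝ) * ArithmeticFunction.moebius a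
          else 0) = ArithmeticFunction.moebius u *
      ∑ a ∈ n.divisors.filter (fun a => a.Coprime q ∧ m ∣ a), (ArithmeticFunction.moebius a : ℝ) := by
    rw [← sum_filter, ← mul_sum]
    congr 1
    refine sum_congr ?_ fun _ _ => rfl
    ext a
    simp only [mem_filter, Nat.mem_divisors]
    constructor
    · rintro ⟨⟨⟨_, h2⟩, h3⟩, _, h4⟩; exact ⟨⟨h4, hnsq.ne_zero⟩, h2, h3⟩
    · rintro ⟨⟨h1, _⟩, h2, h3⟩; exact ⟨⟨⟨⟨h1.trans hnP, hP0⟩, h2⟩, h3⟩, hun, h1⟩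
  rw [h2, h1]
  by_cases h : m ∣ n ∧ n / m ∣ q
  · rw [if_pos h, if_pos ⟨hun, hm, h⟩]
  · rw [if_neg h, if_neg (fun h' => h h'.2.2), mul_zero]

theorem abs_sum_selbergWeight_div_le {W q u m : ℕ} {z : ℝ} (hz : 1 < z) (hq : q ≠ 0)
    (hu : u ∣ (sieveProduct W z).gcd q) :
    |∑ a ∈ (sieveProduct W z).divisors.filter (fun a => a.Coprime q) with m ∣ a,
        selbergWeight W z (u * a) / a| ≤
      if m ∈ sieveSupport W z then (q.divisors.card : ℝ) ^ 2 / (sieveJ W z * m.totient) else 0 := by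
  classical
  rw [sum_selbergWeight_div hu]
  have hJ := sieveJ_pos W hz
  obtain ⟨huP, huq⟩ := Nat.dvd_gcd_iff.mp hu
  have hu0 : u ≠ 0 := fun h => hq (Nat.eq_zero_of_zero_dvd (h ▸ huq))
  set cond : ℕ → Prop := fun n => u ∣ n ∧ m.Coprime q ∧ m ∣ n ∧ n / m ∣ q with hcond
  split_ifs with hm
  swap
  · have : ∀ n ∈ sieveSupport W z, (if cond n then
          (ArithmeticFunction.moebius u : ℝ) * ArithmeticFunction.moebius m else 0) *
          (1 / (n.totient : ℝ)) = 0 := by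
      intro n hn
      rw [if_neg, zero_mul]
      exact fun h => hm (mem_sieveSupport_of_dvd hn h.2.2.1)
    rw [sum_congr rfl this]; simp
  have hm0 : m ≠ 0 := (squarefree_of_mem_sieveSupport hm).ne_zero
  have hφm := totient_pos_real hm0
  have hφu := totient_pos_real hu0
  rw [abs_mul, abs_of_nonneg (a := (u : ℝ) / sieveJ W z) (by positivity)]
  have hμ : ∀ k : ℕ, |(ArithmeticFunction.moebius k : ℝ)| ≤ 1 := fun k => by
    exact_mod_cast ArithmeticFunction.abs_moebius_le_one
  have hsum : |∑ n ∈ sieveSupport W z, (if cond n then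
          (ArithmeticFunction.moebius u : ℝ) * ArithmeticFunction.moebius m else 0) *
          (1 / (n.totient : ℝ))| ≤ q.divisors.card * (1 / (u.totient * m.totient)) := by
    calc _ ≤ ∑ n ∈ (sieveSupport W z).filter cond, 1 / (n.totient : ℝ) := by
          refine (abs_sum_le_sum_abs _ _).trans ?_
          rw [sum_filter]
          refine sum_le_sum fun n _ => ?_
          split_ifs with h
          · rw [abs_mul, abs_mul, abs_of_nonneg (a := 1 / (n.totient : ℝ)) (by positivity)]
            refine mul_le_of_le_one_left (by positivity) ?_
            exact mul_le_one₀ (hμ u) (abs_nonneg _) (hμ m)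
          · simp
      _ ≤ ∑ n ∈ (sieveSupport W z).filter cond, 1 / ((u.totient : ℝ) * m.totient) := by
          refine sum_le_sum fun n hn => ?_
          obtain ⟨hn1, hun, hmq, hmn, _⟩ := mem_filter.mp hn
          have hcop : u.Coprime m := (hmq.symm.coprime_dvd_left huq)
          have hdvd : u * m ∣ n := hcop.mul_dvd_of_dvd_of_dvd hun hmn
          have hn0 := (squarefree_of_mem_sieveSupport hn1).ne_zero
          have hle : (u * m).totient ≤ n.totient := Nat.le_of_dvd
            (Nat.totient_pos.mpr (Nat.pos_of_ne_zero hn0)) (Nat.totient_dvd_of_dvd hdvd)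
          rw [Nat.totient_mul hcop] at hle
          apply one_div_le_one_div_of_le (by positivity)
          exact_mod_cast hle
      _ = ((sieveSupport W z).filter cond).card * (1 / ((u.totient : ℝ) * m.totient)) := by
          rw [sum_const, nsmul_eq_mul]
      _ ≤ _ := by
          refine mul_le_mul_of_nonneg_right (Nat.cast_le.mpr ?_) (by positivity)
          refine card_le_card_of_injOn (fun n => n / m) (fun n hn => ?_) (fun n hn n' hn' h => ?_)
          · obtain ⟨_, _, _, _, h4⟩ := mem_filter.mp hn
            exact Nat.mem_divisors.mpr ⟨h4, hq⟩
          · obtain ⟨_, _, _, h3, _⟩ := mem_filter.mp hn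
            obtain ⟨_, _, _, h3', _⟩ := mem_filter.mp hn'
            exact Nat.div_left_inj h3 h3' |>.mp h
  have hut : (u : ℝ) / u.totient ≤ q.divisors.card :=
    (div_totient_le_card_divisors hu0).trans (by
      exact_mod_cast card_le_card (Nat.divisors_subset_of_dvd hq huq))
  calc (u : ℝ) / sieveJ W z * |∑ n ∈ sieveSupport W z, (if cond n then
          (ArithmeticFunction.moebius u : ℝ) * ArithmeticFunction.moebius m else 0) *
          (1 / (n.totient : ℝ))|
      ≤ (u : ℝ) / sieveJ W z * (q.divisors.card * (1 / (u.totient * m.totient))) := by gcongr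
    _ = (u : ℝ) / u.totient * (q.divisors.card / (sieveJ W z * m.totient)) := by field_simp
    _ ≤ q.divisors.card * (q.divisors.card / (sieveJ W z * m.totient)) := by gcongr
    _ = _ := by ring

/-- The quadratic form of Selberg's sieve twisted by a function of `[d₁, d₂]`. -/
def selbergForm (W : ℕ) (z : ℝ) (Φ : ℕ → ℂ) : ℂ :=
  ∑ d₁ ∈ (sieveProduct W z).divisors, ∑ d₂ ∈ (sieveProduct W z).divisors,
    ((selbergWeight W z d₁ * selbergWeight W z d₂ / (d₁.lcm d₂) : ℝ) : ℂ) * Φ (d₁.lcm d₂)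

theorem norm_selbergForm_le {W q : ℕ} {z : ℝ} (hz : 1 < z) (hq : q ≠ 0) {Φ : ℕ → ℂ} {B : ℝ}
    (hΦ : ∀ D D' : ℕ, D'.Coprime q → Φ (D * D') = Φ D) (hB : ∀ D : ℕ, 0 < D → ‖Φ D‖ ≤ B * D) :
    ‖selbergForm W z Φ‖ ≤ B * (q.divisors.card : ℝ) ^ 6 / sieveJ W z := by
  set P := sieveProduct W z with hP
  have hPsq : Squarefree P := squarefree_sieveProduct W z
  have hJ := sieveJ_pos W hz
  have hB0 : 0 ≤ B := by simpa using (norm_nonneg _).trans (hB 1 one_pos)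
  set A := P.divisors.filter (fun a => a.Coprime q)
  set ρ := selbergWeight W z
  have hAq : ∀ a ∈ A, a.Coprime q := fun a ha => (mem_filter.mp ha).2
  have hform : selbergForm W z Φ = ∑ u ∈ (P.gcd q).divisors, ∑ v ∈ (P.gcd q).divisors,
      (Φ (u.lcm v) / (u.lcm v : ℂ)) *
        ((∑ a ∈ A, ∑ b ∈ A, ρ (u * a) * ρ (v * b) / (a.lcm b) : ℝ) : ℂ) := by
    rw [selbergForm, ← hP, sum_divisors_eq_sum_gcd_mul (q := q) hPsq]
    refine sum_congr rfl fun u hu => ?_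
    simp only [sum_divisors_eq_sum_gcd_mul (q := q) hPsq]
    rw [sum_comm]
    refine sum_congr rfl fun v hv => ?_
    have huq := (Nat.dvd_gcd_iff.mp (Nat.dvd_of_mem_divisors hu)).2
    have hvq := (Nat.dvd_gcd_iff.mp (Nat.dvd_of_mem_divisors hv)).2
    push_cast
    rw [mul_sum]
    refine sum_congr rfl fun a ha => ?_
    rw [mul_sum]
    refine sum_congr rfl fun b hb => ?_
    have haq := hAq a ha
    have hbq := hAq b hb
    have hab : (a.lcm b).Coprime q :=
      (Nat.Coprime.mul_left haq hbq).coprime_dvd_left (Nat.lcm_dvd_mul a b)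
    rw [lcm_mul_mul huq hvq haq hbq, hΦ _ _ hab]
    push_cast
    rw [div_mul_div_comm, mul_comm (Φ _), div_mul_eq_mul_div]
  have hinner : ∀ u ∈ (P.gcd q).divisors, ∀ v ∈ (P.gcd q).divisors,
      |∑ a ∈ A, ∑ b ∈ A, ρ (u * a) * ρ (v * b) / (a.lcm b)| ≤
        (q.divisors.card : ℝ) ^ 4 / sieveJ W z := by
    intro u hu v hv
    rw [sum_sum_div_lcm hPsq.ne_zero (filter_subset _ _) (filter_subset _ _)
      (fun a => ρ (u * a)) (fun b => ρ (v * b))]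
    refine (abs_sum_le_sum_abs _ _).trans ?_
    calc _ ≤ ∑ m ∈ P.divisors, if (m : ℝ) < z then
          (q.divisors.card : ℝ) ^ 4 / sieveJ W z ^ 2 * (1 / (m.totient : ℝ)) else 0 := by
          refine sum_le_sum fun m hm => ?_
          have h1 := abs_sum_selbergWeight_div_le (m := m) hz hq (Nat.dvd_of_mem_divisors hu)
          have h2 := abs_sum_selbergWeight_div_le (m := m) hz hq (Nat.dvd_of_mem_divisors hv)
          rw [abs_mul, abs_mul, Nat.abs_cast]
          by_cases hmz : (m : ℝ) < z
          · have hmS : m ∈ sieveSupport W z := mem_filter.mpr ⟨hm, hmz⟩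
            rw [if_pos hmS] at h1 h2
            rw [if_pos hmz]
            have hφ := totient_pos_real (Nat.pos_of_mem_divisors hm).ne'
            calc _ ≤ (m.totient : ℝ) * ((q.divisors.card : ℝ) ^ 2 / (sieveJ W z * m.totient)) *
                  ((q.divisors.card : ℝ) ^ 2 / (sieveJ W z * m.totient)) := by gcongr
              _ = _ := by field_simp
          · have hmS : m ∉ sieveSupport W z := fun h => hmz (mem_sieveSupport.mp h).2
            rw [if_neg hmS] at h1
            rw [if_neg hmz, le_antisymm h1 (abs_nonneg _)]; simp
      _ = (q.divisors.card : ℝ) ^ 4 / sieveJ W z ^ 2 * sieveJ W z := by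
          rw [← sum_filter, ← mul_sum, sieveJ]
      _ = _ := by field_simp
  rw [hform]
  have hcard : ((P.gcd q).divisors.card : ℝ) ≤ q.divisors.card := by
    exact_mod_cast card_le_card (Nat.divisors_subset_of_dvd hq (Nat.gcd_dvd_right P q))
  calc _ ≤ ∑ u ∈ (P.gcd q).divisors, ∑ v ∈ (P.gcd q).divisors,
        B * ((q.divisors.card : ℝ) ^ 4 / sieveJ W z) := by
        refine (norm_sum_le _ _).trans (sum_le_sum fun u hu => (norm_sum_le _ _).trans
          (sum_le_sum fun v hv => ?_))
        rw [norm_mul, Complex.norm_real, Real.norm_eq_abs, norm_div, Complex.norm_natCast]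
        have hl : 0 < u.lcm v :=
          Nat.lcm_pos (Nat.pos_of_mem_divisors hu) (Nat.pos_of_mem_divisors hv)
        have hl' : (0 : ℝ) < u.lcm v := by exact_mod_cast hl
        have h1 : ‖Φ (u.lcm v)‖ / (u.lcm v) ≤ B := by
          rw [div_le_iff₀ hl']; exact hB _ hl
        exact mul_le_mul h1 (hinner u hu v hv) (abs_nonneg _) hB0
    _ = ((P.gcd q).divisors.card : ℝ) ^ 2 * (B * ((q.divisors.card : ℝ) ^ 4 / sieveJ W z)) := by
        rw [sum_const, sum_const, nsmul_eq_mul, nsmul_eq_mul]; ring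
    _ ≤ (q.divisors.card : ℝ) ^ 2 * (B * ((q.divisors.card : ℝ) ^ 4 / sieveJ W z)) := by gcongr
    _ = _ := by ring

theorem selbergForm_one {W : ℕ} {z : ℝ} (hz : 1 < z) :
    selbergForm W z (fun _ => 1) = ((1 / sieveJ W z : ℝ) : ℂ) := by
  set P := sieveProduct W z with hP
  have hPsq : Squarefree P := squarefree_sieveProduct W z
  have hJ := sieveJ_pos W hz
  have hA : ∀ m ∈ P.divisors, ∑ a ∈ P.divisors with m ∣ a, selbergWeight W z a / a =
      if (m : ℝ) < z then (ArithmeticFunction.moebius m : ℝ) / (sieveJ W z * m.totient) else 0 := by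
    intro m hm
    have h := sum_selbergWeight_div (W := W) (q := 1) (u := 1) (m := m) (z := z) (one_dvd _)
    simp only [Nat.coprime_one_right_eq_true, one_mul, filter_true, one_dvd, true_and,
      Nat.cast_one] at h
    rw [h]
    have hterm : ∀ n ∈ sieveSupport W z, (if m ∣ n ∧ n / m ∣ 1 then
        ((ArithmeticFunction.moebius 1 : ℤ) : ℝ) * (ArithmeticFunction.moebius m : ℝ) else 0) *
          (1 / (n.totient : ℝ)) = if m = n then (ArithmeticFunction.moebius m : ℝ) / m.totient else 0 := by
      intro n hn
      have hn0 := (squarefree_of_mem_sieveSupport hn).ne_zero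
      by_cases hmn : m = n
      · subst hmn
        rw [if_pos ⟨dvd_rfl, by rw [Nat.div_self (Nat.pos_of_ne_zero hn0)]⟩, if_pos rfl]
        simp [div_eq_mul_inv]
      · rw [if_neg, if_neg hmn, zero_mul]
        rintro ⟨⟨k, rfl⟩, h2⟩
        rw [Nat.mul_div_cancel_left _ (Nat.pos_of_ne_zero (left_ne_zero_of_mul hn0)),
          Nat.dvd_one] at h2
        exact hmn (by rw [h2, mul_one])
    rw [sum_congr rfl hterm, sum_ite_eq]
    by_cases hmz : (m : ℝ) < z
    · have hmS : m ∈ sieveSupport W z := mem_filter.mpr ⟨hm, hmz⟩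
      rw [if_pos hmS, if_pos hmz, one_div_mul_eq_div, div_div, mul_comm]
    · rw [if_neg (fun h => hmz (mem_sieveSupport.mp h).2), if_neg hmz, mul_zero]
  have hreal : ∑ a ∈ P.divisors, ∑ b ∈ P.divisors,
      selbergWeight W z a * selbergWeight W z b / (a.lcm b) = 1 / sieveJ W z := by
    rw [sum_sum_div_lcm hPsq.ne_zero subset_rfl subset_rfl]
    calc _ = ∑ m ∈ P.divisors, if (m : ℝ) < z then
          1 / sieveJ W z ^ 2 * (1 / (m.totient : ℝ)) else 0 := by
          refine sum_congr rfl fun m hm => ?_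
          rw [hA m hm]
          split_ifs
          · have hφ := totient_pos_real (Nat.pos_of_mem_divisors hm).ne'
            have hμ : (ArithmeticFunction.moebius m : ℝ) ^ 2 = 1 := by
              exact_mod_cast ArithmeticFunction.moebius_sq_eq_one_of_squarefree
                (hPsq.squarefree_of_dvd (Nat.dvd_of_mem_divisors hm))
            field_simp
            exact hμ
          · simp
      _ = 1 / sieveJ W z ^ 2 * sieveJ W z := by rw [← sum_filter, ← mul_sum, sieveJ]
      _ = _ := by field_simp
  simp only [selbergForm, mul_one, ← hP]
  rw [← hreal]; push_cast; rfl

/-! ### The size of `J` -/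

/-- The positive integers below `z` coprime to `W`. -/
def coprimesBelow (W : ℕ) (z : ℝ) : Finset ℕ :=
  (range ⌈z⌉₊).filter fun n => n ≠ 0 ∧ n.Coprime W

theorem mem_coprimesBelow {W n : ℕ} {z : ℝ} :
    n ∈ coprimesBelow W z ↔ (n : ℝ) < z ∧ n ≠ 0 ∧ n.Coprime W := by
  simp [coprimesBelow, Nat.lt_ceil]

theorem one_div_totient_eq {d : ℕ} (hd : Squarefree d) :
    1 / (d.totient : ℝ) = ∑ k ∈ d.divisors, 1 / (k * k.totient : ℝ) * (1 / ((d / k : ℕ) : ℝ)) := by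
  have hd0 : d ≠ 0 := hd.ne_zero
  have hdr : (d : ℝ) ≠ 0 := by exact_mod_cast hd0
  have hφ := totient_pos_real hd0
  have h1 : (d : ℝ) = ∑ k ∈ d.divisors, ((d / k).totient : ℝ) := by
    have := Nat.sum_totient d
    rw [← Nat.sum_div_divisors d Nat.totient] at this
    exact_mod_cast this.symm
  have h2 : ∀ k ∈ d.divisors, 1 / (k * k.totient : ℝ) * (1 / ((d / k : ℕ) : ℝ)) =
      1 / (d * d.totient : ℝ) * (d / k).totient := by
    intro k hk
    obtain ⟨e, rfl⟩ := Nat.dvd_of_mem_divisors hk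
    have hk0 : k ≠ 0 := left_ne_zero_of_mul hd0
    have he0 : e ≠ 0 := right_ne_zero_of_mul hd0
    rw [Nat.mul_div_cancel_left _ (Nat.pos_of_ne_zero hk0),
      Nat.totient_mul (Nat.coprime_of_squarefree_mul hd)]
    have := totient_pos_real hk0
    have := totient_pos_real he0
    have : (k : ℝ) ≠ 0 := by exact_mod_cast hk0
    have : (e : ℝ) ≠ 0 := by exact_mod_cast he0
    push_cast; field_simp
  rw [sum_congr rfl h2, ← mul_sum, ← h1]
  field_simp

theorem sieveJ_le (W : ℕ) (z : ℝ) :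
    sieveJ W z ≤ (∑ k ∈ coprimesBelow W z, 1 / (k * k.totient : ℝ)) *
      ∑ n ∈ coprimesBelow W z, 1 / (n : ℝ) := by
  rw [sieveJ_eq, sum_mul_sum, ← sum_product',
    sum_congr rfl fun d hd => one_div_totient_eq (squarefree_of_mem_sieveSupport hd), sum_sigma']
  rw [← sum_image (f := fun p : ℕ × ℕ => 1 / (p.1 * p.1.totient : ℝ) * (1 / (p.2 : ℝ)))
    (g := fun p : (_ : ℕ) × ℕ => (p.2, p.1 / p.2))]
  · refine sum_le_sum_of_subset_of_nonneg ?_ (fun _ _ _ => by positivity)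
    intro p hp
    obtain ⟨⟨d, k⟩, hdk, rfl⟩ := mem_image.mp hp
    simp only [mem_sigma] at hdk
    have hkd := Nat.dvd_of_mem_divisors hdk.2
    have key : ∀ m, m ∣ d → m ∈ coprimesBelow W z := fun m hm => by
      have h := mem_sieveSupport_of_dvd hdk.1 hm
      have h' := mem_sieveSupport.mp h
      exact mem_coprimesBelow.mpr ⟨h'.2, (squarefree_of_mem_sieveSupport h).ne_zero,
        (coprime_sieveProduct W z).coprime_dvd_left h'.1⟩
    exact mem_product.mpr ⟨key k hkd, key (d / k) (Nat.div_dvd_of_dvd hkd)⟩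
  · rintro ⟨d, k⟩ h ⟨d', k'⟩ h' he
    simp only [coe_sigma, Set.mem_sigma_iff, mem_coe, Prod.mk.injEq] at h h' he
    obtain ⟨rfl, he⟩ := he
    have := Nat.div_left_inj (Nat.dvd_of_mem_divisors h.2) (Nat.dvd_of_mem_divisors h'.2) |>.mp he
    subst this; rfl

theorem le_sieveJ (W : ℕ) (z : ℝ) :
    ∑ n ∈ coprimesBelow W z, 1 / (n : ℝ) ≤
      (∑ k ∈ coprimesBelow W z, 1 / (k : ℝ) ^ 2) * sieveJ W z := by
  have h1 : ∑ n ∈ coprimesBelow W z, 1 / (n : ℝ) ≤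
      ∑ p ∈ coprimesBelow W z ×ˢ sieveSupport W z, 1 / (p.1 : ℝ) ^ 2 * (1 / (p.2 : ℝ)) := by
    choose f g hfg hsq using Nat.sq_mul_squarefree
    have hterm : ∀ n ∈ coprimesBelow W z, 1 / (n : ℝ) =
        (fun p : ℕ × ℕ => 1 / (p.1 : ℝ) ^ 2 * (1 / (p.2 : ℝ))) (g n, f n) := by
      intro n _
      have : (n : ℝ) = (g n : ℝ) ^ 2 * f n := by exact_mod_cast (hfg n).symm
      simp only [this]
      rw [one_div_mul_one_div]
    rw [sum_congr rfl hterm, ← sum_image (f := fun p : ℕ × ℕ => 1 / (p.1 : ℝ) ^ 2 * (1 / (p.2 : ℝ)))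
      (g := fun n => (g n, f n))]
    · refine sum_le_sum_of_subset_of_nonneg ?_ (fun _ _ _ => by positivity)
      intro p hp
      obtain ⟨n, hn, rfl⟩ := mem_image.mp hp
      obtain ⟨hnz, hn0, hnW⟩ := mem_coprimesBelow.mp hn
      have hle : ∀ m, m ∣ n → (m : ℝ) < z ∧ m ≠ 0 ∧ m.Coprime W := fun m hm =>
        ⟨lt_of_le_of_lt (by exact_mod_cast Nat.le_of_dvd (Nat.pos_of_ne_zero hn0) hm) hnz,
          fun h => hn0 (Nat.eq_zero_of_zero_dvd (h ▸ hm)), hnW.coprime_dvd_left hm⟩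
      have hg := hle (g n) ⟨g n * f n, by rw [← mul_assoc, ← sq, hfg]⟩
      have hf := hle (f n) ⟨g n ^ 2, by rw [mul_comm, hfg]⟩
      exact mem_product.mpr ⟨mem_coprimesBelow.mpr hg, mem_sieveSupport.mpr
        ⟨(dvd_sieveProduct_iff hf.2.1 hf.1).mpr ⟨hsq n, hf.2.2⟩, hf.1⟩⟩
    · intro n _ n' _ h
      simp only [Prod.mk.injEq] at h
      rw [← hfg n, ← hfg n', h.1, h.2]
  refine h1.trans ?_
  rw [sum_product, sieveJ_eq, sum_mul_sum]
  refine sum_le_sum fun k _ => sum_le_sum fun d hd => ?_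
  gcongr
  · exact totient_pos_real (squarefree_of_mem_sieveSupport hd).ne_zero
  · exact Nat.totient_le d

theorem coprime_bigW_gt {w : ℝ} {p : ℕ} (hp : p.Prime) (h : p.Coprime (bigW w)) : w < p := by
  by_contra hle
  rw [not_lt] at hle
  have hdvd : p ∣ bigW w := by
    unfold bigW
    rcases hp.eq_two_or_odd' with rfl | hodd
    · exact Dvd.dvd.mul_right (by norm_num) _
    · refine Dvd.dvd.mul_left (dvd_prod_of_mem _ ?_) _
      simp only [mem_filter, mem_Icc]
      have h2 := hp.two_le
      have h3 : p ≠ 2 := by rintro rfl; exact absurd hodd (by decide)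
      exact ⟨⟨by omega, Nat.le_floor hle⟩, hp⟩
  exact hp.one_lt.ne' (Nat.eq_one_of_dvd_coprimes h dvd_rfl hdvd)

theorem lt_of_coprime_bigW {w : ℝ} {n : ℕ} (hn : n ≠ 0) (hn1 : n ≠ 1) (h : n.Coprime (bigW w)) :
    w < n := by
  obtain ⟨p, hp, hpn⟩ := Nat.exists_prime_and_dvd hn1
  refine lt_of_lt_of_le (coprime_bigW_gt hp (h.coprime_dvd_left hpn)) ?_
  exact_mod_cast Nat.le_of_dvd (Nat.pos_of_ne_zero hn) hpn

theorem bigW_pos (w : ℝ) : 0 < bigW w := by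
  unfold bigW
  refine Nat.mul_pos (by norm_num) (Nat.pos_of_ne_zero (prod_ne_zero_iff.mpr fun p hp => ?_))
  exact (mem_filter.mp hp).2.ne_zero

theorem eight_le_bigW (w : ℝ) : 8 ≤ bigW w :=
  Nat.le_of_dvd (bigW_pos w) (dvd_mul_right _ _)

theorem four_mul_dvd_bigW {w : ℝ} {p : ℕ} (hp : p.Prime) (h : p ∣ bigW w) : 4 * p ∣ bigW w := by
  unfold bigW at *
  rcases hp.eq_two_or_odd' with rfl | hodd
  · exact Dvd.dvd.mul_right (by norm_num) _
  · rcases (Nat.Prime.dvd_mul hp).mp h with h8 | h8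
    · have : p ∣ 2 := hp.dvd_of_dvd_pow (show p ∣ 2 ^ 3 by simpa using h8)
      have := (Nat.prime_dvd_prime_iff_eq hp Nat.prime_two).mp this
      subst this; exact absurd hodd (by decide)
    · exact Nat.mul_dvd_mul (by norm_num) h8

/-- Tails over integers coprime to `W` are small. -/
theorem exists_sum_coprimesBelow_le (f : ℕ → ℝ) (hf1 : f 1 = 1) {A : ℝ}
    (hf : ∀ n : ℕ, n ≠ 0 → f n ≤ A * (n : ℝ) ^ (-(7 / 4) : ℝ)) :
    ∃ C : ℝ, 0 ≤ C ∧ ∀ w : ℝ, 1 ≤ w → ∀ z : ℝ,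
      ∑ n ∈ coprimesBelow (bigW w) z, f n ≤ 1 + C * w ^ (-(1 / 2) : ℝ) := by
  have hA : 0 ≤ A := by
    have := hf 1 one_ne_zero
    rw [hf1] at this; simp at this; linarith
  have hsum : Summable fun n : ℕ => (n : ℝ) ^ (-(5 / 4) : ℝ) :=
    Real.summable_nat_rpow.mpr (by norm_num)
  refine ⟨A * ∑' n : ℕ, (n : ℝ) ^ (-(5 / 4) : ℝ), by positivity, fun w hw z => ?_⟩
  have hbound : ∀ n ∈ coprimesBelow (bigW w) z, f n ≤
      (if n = 1 then 1 else 0) + A * w ^ (-(1 / 2) : ℝ) * (n : ℝ) ^ (-(5 / 4) : ℝ) := by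
    intro n hn
    obtain ⟨_, hn0, hnW⟩ := mem_coprimesBelow.mp hn
    split_ifs with h1
    · subst h1
      rw [hf1]
      have : 0 ≤ A * w ^ (-(1 / 2) : ℝ) * ((1 : ℕ) : ℝ) ^ (-(5 / 4) : ℝ) := by positivity
      linarith
    · have hwn := lt_of_coprime_bigW hn0 h1 hnW
      have hn' : (0 : ℝ) < n := by positivity
      rw [zero_add]
      refine (hf n hn0).trans ?_
      rw [mul_assoc]
      refine mul_le_mul_of_nonneg_left ?_ hA
      rw [show (-(7 / 4) : ℝ) = -(1 / 2) + -(5 / 4) by norm_num, Real.rpow_add hn']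
      refine mul_le_mul_of_nonneg_right ?_ (by positivity)
      exact Real.rpow_le_rpow_of_nonpos (by linarith : (0 : ℝ) < w) hwn.le (by norm_num)
  refine (sum_le_sum hbound).trans ?_
  rw [sum_add_distrib, ← mul_sum, sum_ite_eq']
  have h1 : (if 1 ∈ coprimesBelow (bigW w) z then (1 : ℝ) else 0) ≤ 1 := by split_ifs <;> norm_num
  have h2 : ∑ n ∈ coprimesBelow (bigW w) z, (n : ℝ) ^ (-(5 / 4) : ℝ) ≤
      ∑' n : ℕ, (n : ℝ) ^ (-(5 / 4) : ℝ) := hsum.sum_le_tsum _ fun _ _ => by positivity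
  have h3 : A * w ^ (-(1 / 2) : ℝ) * ∑ n ∈ coprimesBelow (bigW w) z, (n : ℝ) ^ (-(5 / 4) : ℝ) ≤
      A * w ^ (-(1 / 2) : ℝ) * ∑' n : ℕ, (n : ℝ) ^ (-(5 / 4) : ℝ) := by gcongr
  linarith

theorem card_coprime_block (W m : ℕ) :
    ((Ico (m * W) ((m + 1) * W)).filter fun n => n.Coprime W).card = W.totient := by
  have := Nat.filter_coprime_Ico_eq_totient W (m * W)
  rw [← this, add_mul, one_mul]
  congr 1
  ext n; simp [Nat.coprime_comm]

theorem sum_block_le {W m : ℕ} (hW : 0 < W) (hm : m ≠ 0) :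
    ∑ n ∈ (Ico (m * W) ((m + 1) * W)).filter (fun n => n.Coprime W), 1 / (n : ℝ) ≤
      (W.totient / W : ℝ) * (1 / m) := by
  have hm' : 0 < m := Nat.pos_of_ne_zero hm
  calc _ ≤ ∑ n ∈ (Ico (m * W) ((m + 1) * W)).filter (fun n => n.Coprime W), 1 / ((m : ℝ) * W) := by
        refine sum_le_sum fun n hn => ?_
        have := (mem_Ico.mp (mem_filter.mp hn).1).1
        apply one_div_le_one_div_of_le (by positivity)
        exact_mod_cast this
    _ = _ := by rw [sum_const, card_coprime_block, nsmul_eq_mul]; field_simp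

theorem le_sum_block {W m : ℕ} (hW : 1 < W) :
    (W.totient / W : ℝ) * (1 / (m + 1)) ≤
      ∑ n ∈ (Ico (m * W) ((m + 1) * W)).filter (fun n => n.Coprime W), 1 / (n : ℝ) := by
  have hW0 : 0 < W := by omega
  calc _ = ∑ n ∈ (Ico (m * W) ((m + 1) * W)).filter (fun n => n.Coprime W), 1 / ((m + 1 : ℝ) * W) := by
        rw [sum_const, card_coprime_block, nsmul_eq_mul]; field_simp
    _ ≤ _ := by
        refine sum_le_sum fun n hn => ?_
        obtain ⟨h1, h2⟩ := mem_filter.mp hn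
        have h3 := (mem_Ico.mp h1).2
        have hn0 : 0 < n := by
          rcases Nat.eq_zero_or_pos n with rfl | h
          · rw [Nat.coprime_zero_left] at h2; omega
          · exact h
        apply one_div_le_one_div_of_le (by positivity)
        exact_mod_cast h3.le

theorem sum_range_mul_coprime (W M : ℕ) :
    ∑ n ∈ (range (M * W)).filter (fun n => n.Coprime W), 1 / (n : ℝ) =
      ∑ m ∈ range M, ∑ n ∈ (Ico (m * W) ((m + 1) * W)).filter (fun n => n.Coprime W), 1 / (n : ℝ) := by
  induction M with
  | zero => simp
  | succ M ih =>
    rw [sum_range_succ, ← ih, sum_filter, sum_filter, sum_filter, range_eq_Ico, range_eq_Ico,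
      sum_Ico_consecutive]
    · omega
    · exact Nat.mul_le_mul_right _ (by omega)

theorem log_le_sum_coprimesBelow {W : ℕ} (hW : 1 < W) {z : ℝ} (hz : 0 < z) :
    (W.totient / W : ℝ) * (Real.log z - Real.log W) ≤ ∑ n ∈ coprimesBelow W z, 1 / (n : ℝ) := by
  have hW0 : (0 : ℝ) < W := by positivity
  set M := ⌊z / W⌋₊
  have hMz : (M : ℝ) * W ≤ z := by
    rw [← le_div_iff₀ hW0]; exact Nat.floor_le (by positivity)
  have hlog : Real.log z - Real.log W ≤ harmonic M := by
    refine le_trans ?_ (log_add_one_le_harmonic M)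
    rw [← Real.log_div hz.ne' hW0.ne']
    apply Real.log_le_log (by positivity)
    push_cast
    exact (Nat.lt_floor_add_one _).le
  calc _ ≤ (W.totient / W : ℝ) * harmonic M := by gcongr
    _ = ∑ m ∈ range M, (W.totient / W : ℝ) * (1 / (m + 1)) := by
        rw [harmonic, ← mul_sum]; push_cast; simp
    _ ≤ ∑ n ∈ (range (M * W)).filter (fun n => n.Coprime W), 1 / (n : ℝ) := by
        rw [sum_range_mul_coprime]
        exact sum_le_sum fun m _ => le_sum_block hW
    _ ≤ _ := by
        refine sum_le_sum_of_subset_of_nonneg (fun n hn => ?_) (fun _ _ _ => by positivity)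
        obtain ⟨h1, h2⟩ := mem_filter.mp hn
        refine mem_coprimesBelow.mpr ⟨?_, ?_, h2⟩
        · have : (n : ℝ) < M * W := by exact_mod_cast mem_range.mp h1
          linarith
        · rintro rfl
          rw [Nat.coprime_zero_left] at h2; omega

theorem sum_coprimesBelow_le_log {W : ℕ} (hW : 1 < W) {z : ℝ} (hz : 2 ≤ z) :
    ∑ n ∈ coprimesBelow W z, 1 / (n : ℝ) ≤ (W.totient / W : ℝ) * (1 + Real.log z) + W := by
  have hW0 : (0 : ℝ) < W := by positivity
  have hW2 : (2 : ℝ) ≤ W := by exact_mod_cast hW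
  set M := ⌊z / W⌋₊
  have hMz : z < (M + 1 : ℕ) * W := by
    push_cast
    rw [← div_lt_iff₀ hW0]; exact Nat.lt_floor_add_one _
  have hMz' : (M : ℝ) ≤ z := (Nat.floor_le (by positivity)).trans
    (div_le_self (by linarith) (by linarith))
  calc _ ≤ ∑ n ∈ (range ((M + 1) * W)).filter (fun n => n.Coprime W), 1 / (n : ℝ) := by
        refine sum_le_sum_of_subset_of_nonneg (fun n hn => ?_) (fun _ _ _ => by positivity)
        obtain ⟨h1, _, h2⟩ := mem_coprimesBelow.mp hn
        refine mem_filter.mpr ⟨mem_range.mpr ?_, h2⟩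
        have := h1.trans hMz
        exact_mod_cast this
    _ = ∑ m ∈ range M, ∑ n ∈ (Ico ((m + 1) * W) ((m + 1 + 1) * W)).filter (fun n => n.Coprime W),
          1 / (n : ℝ) + ∑ n ∈ (Ico (0 * W) ((0 + 1) * W)).filter (fun n => n.Coprime W), 1 / (n : ℝ) := by
        rw [sum_range_mul_coprime, sum_range_succ']
    _ ≤ ∑ m ∈ range M, (W.totient / W : ℝ) * (1 / ((m + 1 : ℕ) : ℝ)) + W := by
        refine add_le_add (sum_le_sum fun m _ => sum_block_le (by omega) (by omega)) ?_
        calc _ ≤ ∑ n ∈ (Ico (0 * W) ((0 + 1) * W)).filter (fun n => n.Coprime W), (1 : ℝ) := by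
              refine sum_le_sum fun n hn => ?_
              rcases Nat.eq_zero_or_pos n with rfl | h
              · simp
              · rw [div_le_one (by positivity)]; exact_mod_cast h
          _ = W.totient := by rw [sum_const, card_coprime_block]; simp
          _ ≤ W := by exact_mod_cast Nat.totient_le W
    _ = (W.totient / W : ℝ) * harmonic M + W := by
        rw [harmonic, ← mul_sum]; push_cast; simp
    _ ≤ _ := by
        gcongr
        refine (harmonic_le_one_add_log M).trans ?_
        rcases Nat.eq_zero_or_pos M with h | h
        · rw [h]; simp; exact Real.log_nonneg (by linarith)
        · gcongr

theorem abs_div_sub_one_le {X J D t η : ℝ} (hX : 0 < X) (hJ : 0 < J) (ht : 0 ≤ t) (hη : 0 ≤ η)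
    (hη4 : η ≤ 1 / 4) (hD1 : X * (1 - η) ≤ D) (hD2 : D ≤ X * (1 + η)) (hJ1 : J ≤ (1 + t) * D)
    (hJ2 : D ≤ (1 + t) * J) : |X / J - 1| ≤ 2 * (t + η) := by
  rw [abs_le]
  constructor
  · rw [le_sub_iff_add_le, le_div_iff₀ hJ]
    rcases le_or_gt (1 - t - η) 0 with h | h
    · nlinarith
    · have h3 : J ≤ (1 + t) * (X * (1 + η)) := hJ1.trans (by gcongr)
      have h4 : (1 - t - η) * ((1 + t) * (1 + η)) ≤ 1 := by
        calc _ ≤ ((1 - t) * (1 - η)) * ((1 + t) * (1 + η)) := by gcongr; nlinarith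
          _ = (1 - t ^ 2) * (1 - η ^ 2) := by ring
          _ ≤ 1 * 1 := by
              gcongr
              · nlinarith
              · nlinarith
              · nlinarith
          _ = 1 := one_mul 1
      calc (-(2 * (t + η)) + 1) * J ≤ (1 - t - η) * J := by gcongr; linarith
        _ ≤ (1 - t - η) * ((1 + t) * (X * (1 + η))) := by gcongr
        _ = ((1 - t - η) * ((1 + t) * (1 + η))) * X := by ring
        _ ≤ 1 * X := by gcongr
        _ = X := one_mul X
  · rw [sub_le_iff_le_add, div_le_iff₀ hJ]
    have h3 : X * (1 - η) ≤ (1 + t) * J := hD1.trans hJ2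
    have h4 : 1 + t ≤ (1 - η) * (2 * (t + η) + 1) := by nlinarith
    have h5 : X * (1 - η) ≤ (2 * (t + η) + 1) * J * (1 - η) := by
      refine h3.trans ?_
      calc (1 + t) * J ≤ (1 - η) * (2 * (t + η) + 1) * J := by gcongr
        _ = _ := by ring
    exact le_of_mul_le_mul_right h5 (by linarith)

/-- The density `φ(W) log z / W` is asymptotically `J` up to a factor `1 + O(w^{-1/2})`. -/
theorem exists_abs_totient_mul_log_div_sieveJ_sub_one_le :
    ∃ C : ℝ, 0 ≤ C ∧ ∀ w : ℝ, 1 ≤ w → ∃ z₀ : ℝ, 1 < z₀ ∧ ∀ z : ℝ, z₀ ≤ z →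
      |((bigW w).totient : ℝ) * Real.log z / (bigW w * sieveJ (bigW w) z) - 1| ≤
        C * w ^ (-(1 / 2) : ℝ) := by
  obtain ⟨A, hA, hdiv⟩ := exists_card_divisors_le (1 / 4) (by norm_num)
  obtain ⟨C₁, hC₁, h₁⟩ := exists_sum_coprimesBelow_le (fun k => 1 / (k * k.totient : ℝ)) (by simp)
    (A := A) (fun n hn => by
      have hn' : (0 : ℝ) < n := by positivity
      have hφ := totient_pos_real hn
      have h1 := div_totient_le_card_divisors hn
      have h2 := hdiv n hn
      have h3 : 1 / (n * n.totient : ℝ) = (n / n.totient : ℝ) * (n : ℝ) ^ (-2 : ℝ) := by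
        rw [Real.rpow_neg hn'.le, Real.rpow_two]; field_simp
      rw [h3]
      calc (n / n.totient : ℝ) * (n : ℝ) ^ (-2 : ℝ) ≤ (A * (n : ℝ) ^ (1 / 4 : ℝ)) * (n : ℝ) ^ (-2 : ℝ) := by
            gcongr; exact h1.trans h2
        _ = _ := by rw [mul_assoc, ← Real.rpow_add hn']; norm_num)
  obtain ⟨C₂, hC₂, h₂⟩ := exists_sum_coprimesBelow_le (fun k => 1 / (k : ℝ) ^ 2) (by simp)
    (A := 1) (fun n hn => by
      have hn1 : (1 : ℝ) ≤ n := by exact_mod_cast Nat.one_le_iff_ne_zero.mpr hn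
      rw [one_mul, ← Real.rpow_two, one_div, ← Real.rpow_neg (by linarith)]
      exact Real.rpow_le_rpow_of_exponent_le hn1 (by norm_num))
  set C₀ := C₁ + C₂ with hC₀
  refine ⟨2 * (C₀ + 1 / 4), by positivity, fun w hw => ?_⟩
  set W := bigW w with hW
  have hW8 : 8 ≤ W := eight_le_bigW w
  have hW1 : 1 < W := by omega
  have hW0 : (0 : ℝ) < W := by positivity
  have hWr : (8 : ℝ) ≤ W := by exact_mod_cast hW8
  set s := w ^ (-(1 / 2) : ℝ) with hs
  have hs0 : 0 < s := Real.rpow_pos_of_pos (by linarith) _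
  have hs1 : s ≤ 1 := Real.rpow_le_one_of_one_le_of_nonpos hw (by norm_num)
  set η := s / 4 with hη
  set L := (Real.log W + 1 + (W : ℝ) ^ 2) / η with hL
  have hlogW : 0 ≤ Real.log W := Real.log_nonneg (by linarith)
  have hL1 : 1 ≤ L := by
    rw [hL, le_div_iff₀ (by positivity)]; nlinarith
  refine ⟨Real.exp L, Real.one_lt_exp_iff.mpr (by linarith), fun z hz => ?_⟩
  have hz2 : 2 ≤ z := by have := Real.add_one_le_exp L; linarith
  have hlogz : L ≤ Real.log z := (Real.le_log_iff_exp_le (by linarith)).mpr hz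
  set ℓ := Real.log z
  have hℓ : 0 < ℓ := by linarith
  have hLη : Real.log W + 1 + (W : ℝ) ^ 2 ≤ η * ℓ := by
    have : L * η ≤ ℓ * η := by gcongr
    rw [hL, div_mul_cancel₀ _ (by positivity)] at this
    linarith
  set F : ℝ := (W.totient : ℝ) / W with hF
  have hφ1 : (1 : ℝ) ≤ W.totient := by exact_mod_cast Nat.totient_pos.mpr (by omega)
  have hF0 : 0 < F := by positivity
  have hFW : (W : ℝ) ≤ F * (W : ℝ) ^ 2 := by
    rw [hF]; field_simp; exact hφ1
  set J := sieveJ W z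
  have hJ : 0 < J := sieveJ_pos W (by linarith)
  set D := ∑ n ∈ coprimesBelow W z, 1 / (n : ℝ)
  have hD1 : F * ℓ * (1 - η) ≤ D := by
    refine le_trans ?_ (log_le_sum_coprimesBelow hW1 (by linarith : 0 < z))
    rw [mul_assoc]
    gcongr
    nlinarith
  have hD2 : D ≤ F * ℓ * (1 + η) := by
    refine (sum_coprimesBelow_le_log hW1 hz2).trans ?_
    have : F * (1 + (W : ℝ) ^ 2) ≤ F * (η * ℓ) := by gcongr; linarith
    have e : F * ℓ * (1 + η) = F * ℓ + F * (η * ℓ) := by ring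
    rw [e]
    linarith
  have hD0 : 0 ≤ D := sum_nonneg fun _ _ => by positivity
  set t := C₀ * s with ht
  have ht0 : 0 ≤ t := by positivity
  have hJ1 : J ≤ (1 + t) * D := by
    refine (sieveJ_le W z).trans ?_
    gcongr
    refine (h₁ w hw z).trans ?_
    rw [ht, hC₀]; nlinarith
  have hJ2 : D ≤ (1 + t) * J := by
    refine (le_sieveJ W z).trans ?_
    gcongr
    refine (h₂ w hw z).trans ?_
    rw [ht, hC₀]; nlinarith
  set X := F * ℓ with hX
  have hX0 : 0 < X := by positivity
  have e : (W.totient : ℝ) * ℓ / (W * J) = X / J := by rw [hX, hF]; field_simp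
  rw [e]
  refine (abs_div_sub_one_le hX0 hJ ht0 (by positivity) (by rw [hη]; linarith) hD1 hD2 hJ1
    hJ2).trans (le_of_eq ?_)
  rw [ht, hη]; ring

/-! ### The exponential sum attached to the majorant -/

/-- The square of Selberg's divisor sum. -/
def sieveSq (W : ℕ) (z : ℝ) (x : ℕ) : ℝ :=
  (∑ d ∈ (Nat.gcd x (sieveProduct W z)).divisors, selbergWeight W z d) ^ 2

/-- The sum `∑_{x ≤ Y, x² ≡ b (W)} x g(x) e(θ(x² - b)/W)` with `g` the squared divisor sum. -/
def twistedSum (W b : ℕ) (z Y θ : ℝ) : ℂ :=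
  ∑ x ∈ Icc 1 ⌊Y⌋₊, (x : ℂ) * (sieveSq W z x : ℂ) *
    (if x ^ 2 ≡ b [MOD W] then ee (θ * ((x : ℝ) ^ 2 - b) / W) else 0)

theorem sieveSq_nonneg (W : ℕ) (z : ℝ) (x : ℕ) : 0 ≤ sieveSq W z x := sq_nonneg _

theorem sieveSq_eq (W : ℕ) (z : ℝ) (x : ℕ) :
    sieveSq W z x = ∑ d₁ ∈ (sieveProduct W z).divisors, ∑ d₂ ∈ (sieveProduct W z).divisors,
      if d₁.lcm d₂ ∣ x then selbergWeight W z d₁ * selbergWeight W z d₂ else 0 := by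
  have hP0 := sieveProduct_ne_zero W z
  have h1 : ∑ d ∈ (Nat.gcd x (sieveProduct W z)).divisors, selbergWeight W z d =
      ∑ d ∈ (sieveProduct W z).divisors, if d ∣ x then selbergWeight W z d else 0 := by
    rw [← sum_filter]
    refine sum_congr ?_ fun _ _ => rfl
    ext d
    simp only [Nat.mem_divisors, mem_filter, Nat.dvd_gcd_iff]
    constructor
    · rintro ⟨⟨h1, h2⟩, _⟩; exact ⟨⟨h2, hP0⟩, h1⟩
    · rintro ⟨⟨h1, _⟩, h2⟩; exact ⟨⟨h2, h1⟩, Nat.gcd_ne_zero_right hP0⟩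
  rw [sieveSq, h1, sq, sum_mul_sum]
  refine sum_congr rfl fun d₁ _ => sum_congr rfl fun d₂ _ => ?_
  simp only [Nat.lcm_dvd_iff]
  by_cases ha : d₁ ∣ x <;> by_cases hb : d₂ ∣ x <;> simp [ha, hb]

theorem sieveSq_le {W : ℕ} {z : ℝ} (hz : 1 < z) {x : ℕ} (hx : x ≠ 0) :
    sieveSq W z x ≤ (x : ℝ) ^ 4 := by
  have hg : Nat.gcd x (sieveProduct W z) ≤ x := Nat.gcd_le_left _ (Nat.pos_of_ne_zero hx)
  have h1 : |∑ d ∈ (Nat.gcd x (sieveProduct W z)).divisors, selbergWeight W z d| ≤ (x : ℝ) ^ 2 := by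
    calc _ ≤ ∑ d ∈ (Nat.gcd x (sieveProduct W z)).divisors, (x : ℝ) := by
          refine (abs_sum_le_sum_abs _ _).trans (sum_le_sum fun d hd => ?_)
          refine (abs_selbergWeight_le hz d).trans ?_
          exact_mod_cast (Nat.card_divisors_le_self d).trans ((Nat.divisor_le hd).trans hg)
      _ ≤ x * x := by
          rw [sum_const, nsmul_eq_mul]
          gcongr
          exact (Nat.card_divisors_le_self _).trans hg
      _ = _ := by ring
  calc sieveSq W z x = |∑ d ∈ (Nat.gcd x (sieveProduct W z)).divisors, selbergWeight W z d| ^ 2 := by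
        rw [sq_abs, sieveSq]
    _ ≤ ((x : ℝ) ^ 2) ^ 2 := by gcongr
    _ = _ := by ring

/-- The normalising factor of the majorant. -/
def majorantFactor (W b : ℕ) (z : ℝ) : ℝ :=
  2 * (W.totient : ℝ) * Real.log z / ((W : ℝ) * sigma W b)

theorem majorant_eq_zero {W b N : ℕ} {z : ℝ} {n : ℤ} (hW : 0 < W)
    (h : ∀ x ∈ (Icc 1 ⌊√((W : ℝ) * N + b)⌋₊).filter
      (fun x => x ^ 2 ≡ b [MOD W] ∧ W + b ≤ x ^ 2), ((x : ℤ) ^ 2 - b) / W ≠ n) :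
    majorant W b N z n = 0 := by
  unfold majorant
  rw [if_neg]
  rintro ⟨hn, x, hx, hxY⟩
  have hWn : (W : ℤ) ≤ W * n := le_mul_of_one_le_right (by positivity) hn
  have hx1 : ((W + b : ℕ) : ℤ) ≤ (x : ℤ) ^ 2 := by rw [← hx]; push_cast; linarith
  have hx1' : W + b ≤ x ^ 2 := by exact_mod_cast hx1
  refine h x ?_ ?_
  · simp only [mem_filter, mem_Icc]
    refine ⟨⟨?_, Nat.le_floor hxY⟩, ?_, hx1'⟩
    · rcases Nat.eq_zero_or_pos x with rfl | h0
      · simp at hx1'; omega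
      · exact h0
    · refine (Nat.modEq_iff_dvd.mpr ⟨n, ?_⟩).symm
      push_cast; linarith
  · rw [← hx, add_sub_cancel_right]
    exact Int.mul_ediv_cancel_left _ (by exact_mod_cast hW.ne')

theorem majorant_eq {W b N x : ℕ} {z : ℝ} (hW : 0 < W)
    (hx : x ∈ (Icc 1 ⌊√((W : ℝ) * N + b)⌋₊).filter
      (fun x => x ^ 2 ≡ b [MOD W] ∧ W + b ≤ x ^ 2)) :
    majorant W b N z (((x : ℤ) ^ 2 - b) / W) = majorantFactor W b z * (x * sieveSq W z x) := by
  simp only [mem_filter, mem_Icc] at hx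
  obtain ⟨⟨hx1, hxY⟩, hmod, hxW⟩ := hx
  obtain ⟨n, hn⟩ := Nat.modEq_iff_dvd.mp hmod.symm
  push_cast at hn
  have hW' : (W : ℤ) ≠ 0 := by exact_mod_cast hW.ne'
  have hdiv : ((x : ℤ) ^ 2 - b) / W = n := by rw [hn]; exact Int.mul_ediv_cancel_left _ hW'
  have heq : (W : ℤ) * n + b = (x : ℤ) ^ 2 := by rw [← hn]; ring
  rw [hdiv]
  have hn1 : 1 ≤ n := by
    have h1 : ((W + b : ℕ) : ℤ) ≤ (x : ℤ) ^ 2 := by exact_mod_cast hxW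
    rw [← heq] at h1
    push_cast at h1
    have h2 : (W : ℤ) * 1 ≤ W * n := by linarith
    exact le_of_mul_le_mul_left h2 (by exact_mod_cast hW)
  unfold majorant
  rw [if_pos ⟨hn1, x, heq, (Nat.le_floor_iff (Real.sqrt_nonneg _)).mp hxY⟩]
  have hreal : (W : ℝ) * n + b = (x : ℝ) ^ 2 := by exact_mod_cast heq
  have hnat : ((W : ℤ) * n + b).toNat = x ^ 2 := by rw [heq]; norm_cast
  rw [hreal, hnat, Real.sqrt_sq (by positivity), Nat.sqrt_eq', majorantFactor, sieveSq]
  ring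

theorem norm_sum_small_le {W b X : ℕ} {z θ : ℝ} (hz : 1 < z) (hb : b ≤ W) (hW : 0 < W) :
    ‖∑ x ∈ (Icc 1 X).filter (fun x => ¬ W + b ≤ x ^ 2), (x : ℂ) * (sieveSq W z x : ℂ) *
      (if x ^ 2 ≡ b [MOD W] then ee (θ * ((x : ℝ) ^ 2 - b) / W) else 0)‖ ≤ (2 * W : ℝ) ^ 6 := by
  have hsub : (Icc 1 X).filter (fun x => ¬ W + b ≤ x ^ 2) ⊆ Icc 1 (2 * W) := by
    intro x hx
    simp only [mem_filter, mem_Icc] at hx ⊢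
    exact ⟨hx.1.1, by nlinarith⟩
  have hterm : ∀ x ∈ (Icc 1 X).filter (fun x => ¬ W + b ≤ x ^ 2),
      ‖(x : ℂ) * (sieveSq W z x : ℂ) *
        (if x ^ 2 ≡ b [MOD W] then ee (θ * ((x : ℝ) ^ 2 - b) / W) else 0)‖ ≤ (2 * W : ℝ) ^ 5 := by
    intro x hx
    have hx' := mem_Icc.mp (hsub hx)
    have hxr : (x : ℝ) ≤ 2 * W := by exact_mod_cast hx'.2
    have h1 := sieveSq_le (W := W) hz (x := x) (by omega)
    have h2 : ‖(if x ^ 2 ≡ b [MOD W] then ee (θ * ((x : ℝ) ^ 2 - b) / W) else 0 : ℂ)‖ ≤ 1 := by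
      split_ifs <;> simp
    rw [norm_mul, norm_mul, Complex.norm_natCast, Complex.norm_real,
      Real.norm_of_nonneg (sieveSq_nonneg _ _ _)]
    calc _ ≤ (x : ℝ) * (x : ℝ) ^ 4 * 1 := by
          gcongr
      _ = (x : ℝ) ^ 5 := by ring
      _ ≤ _ := by gcongr
  refine (norm_sum_le _ _).trans ((sum_le_card_nsmul _ _ _ hterm).trans ?_)
  rw [nsmul_eq_mul]
  have hcard : (((Icc 1 X).filter (fun x => ¬ W + b ≤ x ^ 2)).card : ℝ) ≤ 2 * W := by
    have := card_le_card hsub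
    rw [Nat.card_Icc, Nat.add_sub_cancel] at this
    exact_mod_cast this
  calc _ ≤ (2 * W : ℝ) * (2 * W) ^ 5 := by gcongr
    _ = _ := by ring

theorem norm_fourierHat_majorant_sub_le {W b N : ℕ} {z θ : ℝ} (hz : 1 < z) (hb : b ≤ W)
    (hW : 0 < W) :
    ‖fourierHat (majorant W b N z) θ -
        majorantFactor W b z * twistedSum W b z (√((W : ℝ) * N + b)) θ‖ ≤
      majorantFactor W b z * (2 * W : ℝ) ^ 6 := by
  have hfac : 0 ≤ majorantFactor W b z := by
    have := Real.log_pos hz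
    unfold majorantFactor; positivity
  set X := ⌊√((W : ℝ) * N + b)⌋₊
  set S := (Icc 1 X).filter (fun x => x ^ 2 ≡ b [MOD W] ∧ W + b ≤ x ^ 2) with hS
  set φ : ℕ → ℤ := fun x => ((x : ℤ) ^ 2 - b) / W with hφ
  have hdvd : ∀ x ∈ S, (W : ℤ) * φ x = (x : ℤ) ^ 2 - b := by
    intro x hx
    have := (mem_filter.mp hx).2.1
    have h := Nat.modEq_iff_dvd.mp this.symm
    push_cast at h
    exact Int.mul_ediv_cancel' h
  have hinj : Set.InjOn φ S := by
    intro x hx y hy h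
    have h1 := hdvd x hx
    have h2 := hdvd y hy
    rw [h, h2] at h1
    have : (x : ℤ) ^ 2 = (y : ℤ) ^ 2 := by linarith
    have : x ^ 2 = y ^ 2 := by exact_mod_cast this
    exact Nat.pow_left_injective (by norm_num) this
  have hhat : fourierHat (majorant W b N z) θ = majorantFactor W b z *
      ∑ x ∈ S, (x : ℂ) * (sieveSq W z x : ℂ) * ee (θ * ((x : ℝ) ^ 2 - b) / W) := by
    unfold fourierHat
    rw [tsum_eq_sum (s := S.image φ), sum_image hinj, mul_sum]
    · refine sum_congr rfl fun x hx => ?_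
      rw [majorant_eq hW hx]
      have hWr : (W : ℝ) ≠ 0 := by exact_mod_cast hW.ne'
      have h1 : (W : ℝ) * φ x = (x : ℝ) ^ 2 - b := by exact_mod_cast hdvd x hx
      have h2 : Complex.exp (2 * Real.pi * Complex.I * (φ x : ℤ) * θ) =
          ee (θ * ((x : ℝ) ^ 2 - b) / W) := by
        rw [← h1, ee]
        congr 1
        have : (W : ℂ) ≠ 0 := by exact_mod_cast hW.ne'
        push_cast; field_simp
      rw [h2]; push_cast; ring
    · intro n hn
      rw [majorant_eq_zero hW]
      · simp
      · intro x hx h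
        exact hn (mem_image.mpr ⟨x, hx, h⟩)
  have htw : twistedSum W b z (√((W : ℝ) * N + b)) θ =
      ∑ x ∈ S, (x : ℂ) * (sieveSq W z x : ℂ) * ee (θ * ((x : ℝ) ^ 2 - b) / W) +
      ∑ x ∈ (Icc 1 X).filter (fun x => ¬ W + b ≤ x ^ 2), (x : ℂ) * (sieveSq W z x : ℂ) *
        (if x ^ 2 ≡ b [MOD W] then ee (θ * ((x : ℝ) ^ 2 - b) / W) else 0) := by
    rw [twistedSum, ← sum_filter_add_sum_filter_not _ (fun x => W + b ≤ x ^ 2)]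
    congr 1
    rw [hS, sum_filter, sum_filter]
    refine sum_congr rfl fun x _ => ?_
    by_cases h1 : W + b ≤ x ^ 2 <;> by_cases h2 : x ^ 2 ≡ b [MOD W] <;> simp [h1, h2]
  have hsmall := norm_sum_small_le (W := W) (b := b) (X := X) (θ := θ) hz hb hW
  rw [hhat, htw, mul_add, sub_add_cancel_left, norm_neg, norm_mul, Complex.norm_real,
    Real.norm_of_nonneg hfac]
  gcongr

/-! ### Major arcs -/

theorem norm_twistedSum_sub_le {W b q : ℕ} (hW : 0 < W) (hq : 0 < q) (a : ℤ) {z Y β : ℝ}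
    (hY : 0 ≤ Y) :
    ‖twistedSum W b z Y (a / q + β) -
        selbergForm W z (fun D => localSum W b q a D / (W * q)) *
          ∫ t in (0 : ℝ)..Y, archWeight W b β t‖ ≤
      3 * W * q * (∑ d ∈ (sieveProduct W z).divisors, |selbergWeight W z d|) ^ 2 *
        (Y + Y * (1 + 4 * Real.pi * |β| * Y ^ 2 / W)) := by
  have hWr : (0 : ℝ) < W := by exact_mod_cast hW
  have hqr : (0 : ℝ) < q := by exact_mod_cast hq
  have hWc : (W : ℂ) ≠ 0 := by exact_mod_cast hW.ne'
  have hqc : (q : ℂ) ≠ 0 := by exact_mod_cast hq.ne'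
  have : NeZero (W * q) := ⟨(Nat.mul_pos hW hq).ne'⟩
  set c : ℕ → ℂ := fun x => (sieveSq W z x : ℂ) * localPhase W b q a x with hc
  have htw : twistedSum W b z Y (a / q + β) = ∑ k ∈ Icc 0 ⌊Y⌋₊, archWeight W b β k * c k := by
    have h0 : Icc 0 ⌊Y⌋₊ = insert 0 (Icc 1 ⌊Y⌋₊) := by ext; simp; omega
    rw [h0, sum_insert (by simp), twistedSum]
    have hz : archWeight W b β ((0 : ℕ) : ℝ) * c 0 = 0 := by simp [archWeight]
    rw [hz, zero_add]
    refine sum_congr rfl fun x _ => ?_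
    simp only [hc, archWeight, localPhase]
    split_ifs with h
    · have : ((a / q + β : ℝ)) * ((x : ℝ) ^ 2 - b) / W =
          β * ((x : ℝ) ^ 2 - b) / W + a * ((x : ℝ) ^ 2 - b) / (W * q) := by field_simp; ring
      rw [this, ee_add]; push_cast; ring
    · simp
  have hcs : ∀ x, c x = ∑ d₁ ∈ (sieveProduct W z).divisors, ∑ d₂ ∈ (sieveProduct W z).divisors,
      ((selbergWeight W z d₁ * selbergWeight W z d₂ : ℝ) : ℂ) * (if d₁.lcm d₂ ∣ x then localPhase W b q a x else 0) := by
    intro x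
    simp only [hc, sieveSq_eq]
    push_cast
    rw [sum_mul]
    refine sum_congr rfl fun d₁ _ => ?_
    rw [sum_mul]
    refine sum_congr rfl fun d₂ _ => ?_
    split_ifs <;> simp
  set E := 3 * W * q * (∑ d ∈ (sieveProduct W z).divisors, |selbergWeight W z d|) ^ 2 with hE
  rw [htw]
  refine norm_sum_mul_sub_integral_le c _ hY (E := E) (A := Y)
    (B := 1 + 4 * Real.pi * |β| * Y ^ 2 / W) ?_ (contDiff_archWeight _ _ _)
    (norm_archWeight _ _ _ hY).le (fun t ht => norm_deriv_archWeight_le hWr ht)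
  intro t ht
  have hsum : ∑ k ∈ Icc 0 ⌊t⌋₊, c k - (t : ℂ) * selbergForm W z
        (fun D => localSum W b q a D / (W * q)) =
      ∑ d₁ ∈ (sieveProduct W z).divisors, ∑ d₂ ∈ (sieveProduct W z).divisors, ((selbergWeight W z d₁ * selbergWeight W z d₂ : ℝ) : ℂ) *
        (∑ x ∈ Icc 0 ⌊t⌋₊, (if d₁.lcm d₂ ∣ x then localPhase W b q a x else 0) -
          (t : ℂ) * (localSum W b q a (d₁.lcm d₂) / ((d₁.lcm d₂ : ℕ) * (W * q : ℕ) : ℂ))) := by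
    simp only [hcs]
    rw [sum_comm]
    rw [selbergForm, mul_sum, ← sum_sub_distrib]
    refine sum_congr rfl fun d₁ hd₁ => ?_
    rw [sum_comm, mul_sum, ← sum_sub_distrib]
    refine sum_congr rfl fun d₂ hd₂ => ?_
    rw [mul_sub, mul_sum]
    congr 1
    have hl : (d₁.lcm d₂ : ℂ) ≠ 0 := by
      exact_mod_cast Nat.lcm_ne_zero (Nat.pos_of_mem_divisors hd₁).ne' (Nat.pos_of_mem_divisors hd₂).ne'
    push_cast
    field_simp
  rw [hsum]
  calc _ ≤ ∑ d₁ ∈ (sieveProduct W z).divisors, ∑ d₂ ∈ (sieveProduct W z).divisors, |selbergWeight W z d₁| * |selbergWeight W z d₂| * (3 * W * q) := by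
        refine (norm_sum_le _ _).trans (sum_le_sum fun d₁ hd₁ => (norm_sum_le _ _).trans
          (sum_le_sum fun d₂ hd₂ => ?_))
        rw [norm_mul, Complex.norm_real, Real.norm_eq_abs, abs_mul]
        refine mul_le_mul_of_nonneg_left ?_ (by positivity)
        have hl : 0 < d₁.lcm d₂ :=
          Nat.lcm_pos (Nat.pos_of_mem_divisors hd₁) (Nat.pos_of_mem_divisors hd₂)
        have := norm_sum_multiples_sub_le (norm_localPhase_le W b q a) hl (Nat.mul_pos hW hq)
          (fun x => localPhase_add_mul W b q a (d₁.lcm d₂) x) ht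
        refine this.trans (le_of_eq ?_)
        push_cast; ring
    _ = _ := by
        rw [hE, sq, sum_mul_sum, mul_sum]
        refine sum_congr rfl fun d₁ _ => ?_
        rw [mul_sum]
        exact sum_congr rfl fun d₂ _ => by ring

/-- The local density vanishes when `q` and `W` have a common factor. -/
theorem selbergForm_localSum_eq_zero {w : ℝ} {b q : ℕ} (hq : 0 < q) {a : ℤ} {z : ℝ}
    (haq : IsCoprime a (q : ℤ)) (hb : b.Coprime (bigW w)) (hWq : ¬ (bigW w).Coprime q) :
    selbergForm (bigW w) z (fun D => localSum (bigW w) b q a D / (bigW w * q)) = 0 := by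
  have : NeZero (bigW w * q) := ⟨(Nat.mul_pos (bigW_pos w) hq).ne'⟩
  obtain ⟨p, hp, hpW, hpq⟩ := Nat.Prime.not_coprime_iff_dvd.mp hWq
  refine sum_eq_zero fun d₁ hd₁ => sum_eq_zero fun d₂ hd₂ => ?_
  have hD : (d₁.lcm d₂).Coprime (bigW w) :=
    (coprime_sieveProduct (bigW w) z).coprime_dvd_left
      (Nat.lcm_dvd (Nat.dvd_of_mem_divisors hd₁) (Nat.dvd_of_mem_divisors hd₂))
  beta_reduce
  rw [localSum_eq_zero hp (four_mul_dvd_bigW hp hpW) hpq haq hb hD]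
  simp

/-- For `q` coprime to `W` the local density is governed by Gauss sums. -/
theorem selbergForm_localSum_eq {W b q : ℕ} [NeZero W] [NeZero q] {a : ℤ} {z : ℝ}
    (hWq : W.Coprime q) :
    selbergForm W z (fun D => localSum W b q a D / (W * q)) =
      (sigma W b / W : ℂ) * (ZMod.stdAddChar (-((a : ZMod q) * (W : ZMod q)⁻¹ * (b : ZMod q))) *
        selbergForm W z (fun D => gaussSq q ((a : ZMod q) * (W : ZMod q)⁻¹) D / q)) := by
  unfold selbergForm
  rw [mul_sum, mul_sum]
  refine sum_congr rfl fun d₁ hd₁ => ?_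
  rw [mul_sum, mul_sum]
  refine sum_congr rfl fun d₂ hd₂ => ?_
  have hD : (d₁.lcm d₂).Coprime W :=
    (coprime_sieveProduct W z).coprime_dvd_left
      (Nat.lcm_dvd (Nat.dvd_of_mem_divisors hd₁) (Nat.dvd_of_mem_divisors hd₂))
  beta_reduce
  rw [localSum_of_coprime hWq hD]
  ring

theorem norm_selbergForm_localSum_le {W b q : ℕ} (hW : 0 < W) (hW2 : 2 ∣ W) (hq : 0 < q) {a : ℤ}
    {z : ℝ} (hz : 1 < z) (haq : IsCoprime a (q : ℤ)) (hWq : W.Coprime q) :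
    ‖selbergForm W z (fun D => localSum W b q a D / (W * q))‖ ≤
      sigma W b / W * ((q.divisors.card : ℝ) ^ 6 / √q / sieveJ W z) := by
  have : NeZero W := ⟨hW.ne'⟩
  have : NeZero q := ⟨hq.ne'⟩
  have hqr : (0 : ℝ) < q := by exact_mod_cast hq
  rw [selbergForm_localSum_eq hWq, norm_mul, norm_mul, norm_div, Complex.norm_natCast,
    Complex.norm_natCast, AddChar.norm_apply, one_mul]
  gcongr
  have hodd : Odd q := Nat.coprime_two_left.mp (hWq.coprime_dvd_left hW2)
  have hunit : IsUnit ((a : ZMod q) * (W : ZMod q)⁻¹) := by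
    have h1 : IsUnit (a : ZMod q) := by
      obtain ⟨u, v, huv⟩ := haq
      have := congrArg (Int.cast : ℤ → ZMod q) huv
      push_cast at this
      rw [ZMod.natCast_self, mul_zero, add_zero] at this
      exact IsUnit.of_mul_eq_one _ (by rw [mul_comm]; exact this)
    have h2 : IsUnit ((W : ZMod q)⁻¹) :=
      IsUnit.of_mul_eq_one _ (by rw [mul_comm]; exact ZMod.coe_mul_inv_eq_one W hWq)
    exact h1.mul h2
  have := norm_selbergForm_le (W := W) (q := q) hz hq.ne'
    (Φ := fun D => gaussSq q ((a : ZMod q) * (W : ZMod q)⁻¹) D / q) (B := 1 / √q)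
    (fun D D' h => by simp only [gaussSq_mul_coprime q _ D h])
    (fun D hD => by
      rw [norm_div, Complex.norm_natCast, div_le_iff₀ hqr]
      refine (norm_gaussSq_le q hunit hodd hD).trans (le_of_eq ?_)
      have h3 : √(q : ℝ) * √q = q := Real.mul_self_sqrt hqr.le
      have h4 : √(q : ℝ) ≠ 0 := (Real.sqrt_pos.mpr hqr).ne'
      field_simp
      nlinarith)
  refine this.trans (le_of_eq ?_)
  ring

theorem selbergForm_localSum_one {W b : ℕ} (hW : 0 < W) {a : ℤ} {z : ℝ} (hz : 1 < z) :
    selbergForm W z (fun D => localSum W b 1 a D / (W * (1 : ℕ))) =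
      ((sigma W b / W * (1 / sieveJ W z) : ℝ) : ℂ) := by
  have : NeZero W := ⟨hW.ne'⟩
  rw [selbergForm_localSum_eq (Nat.coprime_one_right W)]
  have h1 : ∀ D, gaussSq 1 ((a : ZMod 1) * (W : ZMod 1)⁻¹) D / ((1 : ℕ) : ℂ) = 1 := by
    intro D
    simp [gaussSq, Subsingleton.elim _ (0 : ZMod 1)]
  simp only [h1, selbergForm_one hz]
  rw [Subsingleton.elim (-((a : ZMod 1) * (W : ZMod 1)⁻¹ * (b : ZMod 1))) 0, AddChar.map_zero_eq_one]
  push_cast; ring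

/-! ### Minor arcs for the majorant -/

/-- The coefficients of the squared divisor sum as a divisor sum. -/
def sieveCoeff (W : ℕ) (z : ℝ) (D : ℕ) : ℝ :=
  ∑ d ∈ (sieveProduct W z).divisors ×ˢ (sieveProduct W z).divisors,
    if d.1.lcm d.2 = D then selbergWeight W z d.1 * selbergWeight W z d.2 else 0

theorem sieveSq_eq_sum_sieveCoeff (W : ℕ) (z : ℝ) {x : ℕ} (hx : x ≠ 0) :
    sieveSq W z x = ∑ D ∈ x.divisors, sieveCoeff W z D := by
  unfold sieveCoeff
  rw [sieveSq_eq, eq_comm, sum_comm, sum_product]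
  refine sum_congr rfl fun d₁ _ => sum_congr rfl fun d₂ _ => ?_
  rw [sum_ite_eq]
  simp [Nat.mem_divisors, hx]

theorem lcm_lt_sq {d₁ d₂ : ℕ} {z : ℝ} (h₁ : (d₁ : ℝ) < z) (h₂ : (d₂ : ℝ) < z) :
    ((d₁.lcm d₂ : ℕ) : ℝ) < z ^ 2 ∨ z ≤ 0 := by
  by_cases hz : z ≤ 0
  · exact Or.inr hz
  left
  push Not at hz
  have h3 : d₁.lcm d₂ ≤ d₁ * d₂ := by
    rw [← Nat.gcd_mul_lcm d₁ d₂]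
    rcases Nat.eq_zero_or_pos (d₁.gcd d₂) with h | h
    · have := Nat.eq_zero_of_gcd_eq_zero_left h
      simp [this]
    · exact Nat.le_mul_of_pos_left _ h
  have h4 : ((d₁.lcm d₂ : ℕ) : ℝ) ≤ d₁ * d₂ := by exact_mod_cast h3
  have h5 : (0 : ℝ) ≤ d₁ := Nat.cast_nonneg _
  have h6 : (0 : ℝ) ≤ d₂ := Nat.cast_nonneg _
  nlinarith

theorem sieveCoeff_eq_zero {W : ℕ} {z : ℝ} {D : ℕ} (hz : 0 < z) (hD : z ^ 2 ≤ D) :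
    sieveCoeff W z D = 0 := by
  refine sum_eq_zero fun d _ => ?_
  split_ifs with h
  · by_contra hne
    have h1 : d.1 ∈ sieveSupport W z := by
      by_contra h'; exact hne (by rw [selbergWeight_eq_zero h', zero_mul])
    have h2 : d.2 ∈ sieveSupport W z := by
      by_contra h'; exact hne (by rw [selbergWeight_eq_zero h', mul_zero])
    rcases lcm_lt_sq (mem_sieveSupport.mp h1).2 (mem_sieveSupport.mp h2).2 with h3 | h3
    · rw [h] at h3; linarith
    · linarith
  · rfl

theorem abs_sieveCoeff_le {W : ℕ} {z : ℝ} (hz : 1 < z) (D : ℕ) :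
    |sieveCoeff W z D| ≤ (D.divisors.card : ℝ) ^ 4 := by
  set P := sieveProduct W z
  have hP0 : P ≠ 0 := sieveProduct_ne_zero W z
  unfold sieveCoeff
  rw [← sum_filter]
  refine (abs_sum_le_sum_abs _ _).trans ?_
  have hmem : ∀ d ∈ (P.divisors ×ˢ P.divisors).filter (fun d : ℕ × ℕ => d.1.lcm d.2 = D),
      d.1 ∈ D.divisors ∧ d.2 ∈ D.divisors := by
    intro d hd
    simp only [mem_filter, mem_product] at hd
    obtain ⟨⟨h1, h2⟩, rfl⟩ := hd
    have h0 := Nat.lcm_ne_zero (Nat.pos_of_mem_divisors h1).ne' (Nat.pos_of_mem_divisors h2).ne'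
    exact ⟨Nat.mem_divisors.mpr ⟨Nat.dvd_lcm_left _ _, h0⟩,
      Nat.mem_divisors.mpr ⟨Nat.dvd_lcm_right _ _, h0⟩⟩
  have hsub : (P.divisors ×ˢ P.divisors).filter (fun d : ℕ × ℕ => d.1.lcm d.2 = D) ⊆
      D.divisors ×ˢ D.divisors := fun d hd => mem_product.mpr (hmem d hd)
  have hτ : ∀ d ∈ D.divisors, |selbergWeight W z d| ≤ D.divisors.card := by
    intro d hd
    refine (abs_selbergWeight_le hz d).trans ?_
    exact_mod_cast card_le_card
      (Nat.divisors_subset_of_dvd (Nat.ne_zero_of_mem_divisors hd) (Nat.dvd_of_mem_divisors hd))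
  calc _ ≤ ∑ d ∈ (P.divisors ×ˢ P.divisors).filter (fun d : ℕ × ℕ => d.1.lcm d.2 = D),
        (D.divisors.card : ℝ) ^ 2 := by
        refine sum_le_sum fun d hd => ?_
        rw [abs_mul, sq]
        exact mul_le_mul (hτ _ (hmem d hd).1) (hτ _ (hmem d hd).2) (abs_nonneg _) (by positivity)
    _ ≤ ((D.divisors.card : ℝ) * D.divisors.card) * (D.divisors.card : ℝ) ^ 2 := by
        rw [sum_const, nsmul_eq_mul]
        gcongr
        have := card_le_card hsub
        rw [card_product] at this
        exact_mod_cast this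
    _ = _ := by ring

/-- Partial summation against the weight `x`. -/
theorem norm_sum_natCast_mul_le {h : ℕ → ℂ} {X : ℕ} {B : ℝ}
    (hB : ∀ t ≤ X, ‖∑ x ∈ Icc 1 t, h x‖ ≤ B) :
    ‖∑ x ∈ Icc 1 X, (x : ℂ) * h x‖ ≤ 2 * X * B := by
  have key : ∀ X : ℕ, ∑ x ∈ Icc 1 X, (x : ℂ) * h x =
      X * ∑ x ∈ Icc 1 X, h x - ∑ t ∈ range X, ∑ x ∈ Icc 1 t, h x := by
    intro X
    induction X with
    | zero => simp
    | succ n ih =>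
      rw [sum_Icc_succ_top (by omega), ih, sum_range_succ, sum_Icc_succ_top (by omega)]
      push_cast; ring
  rw [key]
  refine (norm_sub_le _ _).trans ?_
  have h1 : ‖∑ t ∈ range X, ∑ x ∈ Icc 1 t, h x‖ ≤ X * B := by
    refine (norm_sum_le _ _).trans ?_
    refine (sum_le_card_nsmul _ _ B fun t ht => hB t (mem_range.mp ht).le).trans ?_
    simp
  have h2 : ‖(X : ℂ) * ∑ x ∈ Icc 1 X, h x‖ ≤ X * B := by
    rw [norm_mul, Complex.norm_natCast]
    have := hB X le_rfl
    gcongr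
  linarith

/-- Orthogonality of the additive characters modulo `W`. -/
theorem sum_range_ee_mul_div {W : ℕ} (hW : 0 < W) (m : ℤ) :
    ∑ k ∈ range W, ee (k * ((m : ℝ) / W)) = if (W : ℤ) ∣ m then (W : ℂ) else 0 := by
  have hWr : (W : ℝ) ≠ 0 := by exact_mod_cast hW.ne'
  have hpow : ∀ k : ℕ, ee (k * ((m : ℝ) / W)) = ee ((m : ℝ) / W) ^ k := fun k =>
    ee_natCast_mul k _
  simp only [hpow]
  split_ifs with h
  · obtain ⟨j, rfl⟩ := h
    have : ee (((W * j : ℤ) : ℝ) / W) = 1 := by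
      rw [show (((W * j : ℤ) : ℝ) / W) = (j : ℝ) by push_cast; field_simp]
      exact ee_intCast j
    simp only [this, one_pow]
    simp
  · have hne : ee ((m : ℝ) / W) ≠ 1 := by
      intro h1
      obtain ⟨j, hj⟩ := Complex.exp_eq_one_iff.mp (by simpa only [ee] using h1)
      apply h
      refine ⟨j, ?_⟩
      have h2 : (2 * Real.pi * Complex.I : ℂ) ≠ 0 := Complex.two_pi_I_ne_zero
      have h3 : (((m : ℝ) / W : ℝ) : ℂ) = j := by
        apply mul_left_cancel₀ h2
        linear_combination hj
      have h4 : (m : ℝ) / W = j := by exact_mod_cast h3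
      field_simp at h4
      exact_mod_cast h4
    rw [geom_sum_eq hne, ← hpow W]
    have : ee (W * ((m : ℝ) / W)) = 1 := by
      rw [show (W * ((m : ℝ) / W)) = (m : ℝ) by field_simp]
      exact ee_intCast m
    simp [this]

theorem twistedSum_eq_sum_range {W b : ℕ} (hW : 0 < W) (z Y θ : ℝ) :
    twistedSum W b z Y θ = (W : ℂ)⁻¹ * ∑ k ∈ range W, ee (-((θ + k) / W * b)) *
      ∑ x ∈ Icc 1 ⌊Y⌋₊, (x : ℂ) *
        (((∑ D ∈ x.divisors, sieveCoeff W z D : ℝ) : ℂ) * ee ((θ + k) / W * (x : ℝ) ^ 2)) := by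
  have hWc : (W : ℂ) ≠ 0 := by exact_mod_cast hW.ne'
  have hWr : (W : ℝ) ≠ 0 := by exact_mod_cast hW.ne'
  simp only [mul_sum]
  rw [sum_comm, twistedSum]
  refine sum_congr rfl fun x hx => ?_
  have hx0 : x ≠ 0 := by have := (mem_Icc.mp hx).1; omega
  rw [← sieveSq_eq_sum_sieveCoeff W z hx0]
  have hk : ∀ k : ℕ, (W : ℂ)⁻¹ * (ee (-((θ + k) / W * b)) * ((x : ℂ) * ((sieveSq W z x : ℂ) *
      ee ((θ + k) / W * (x : ℝ) ^ 2)))) =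
      (W : ℂ)⁻¹ * (x : ℂ) * (sieveSq W z x : ℂ) * ee (θ * ((x : ℝ) ^ 2 - b) / W) *
        ee (k * ((((x : ℤ) ^ 2 - b : ℤ) : ℝ) / W)) := by
    intro k
    have h1 : ee (-((θ + k) / W * b)) * ee ((θ + k) / W * (x : ℝ) ^ 2) =
        ee (θ * ((x : ℝ) ^ 2 - b) / W) * ee (k * ((((x : ℤ) ^ 2 - b : ℤ) : ℝ) / W)) := by
      rw [← ee_add, ← ee_add]
      congr 1
      push_cast; field_simp; ring
    linear_combination (W : ℂ)⁻¹ * x * (sieveSq W z x : ℂ) * h1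
  simp only [hk]
  rw [← mul_sum, sum_range_ee_mul_div hW]
  have hiff : (W : ℤ) ∣ (x : ℤ) ^ 2 - b ↔ x ^ 2 ≡ b [MOD W] := by
    rw [Nat.ModEq.comm, Nat.modEq_iff_dvd]; push_cast; rfl
  simp only [hiff]
  split_ifs
  · field_simp
  · simp

theorem norm_twistedSum_le_of_minorData {W b : ℕ} {z Y θ a c x R : ℝ} (hW : 0 < W) (hz : 1 < z)
    (hY : 0 ≤ Y) (hYR : Y ≤ a * R) (ha : 1 ≤ a) (hc : 1 ≤ c) (hx : 1 ≤ x) (hR : 1 ≤ R)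
    (hzR : z ^ 2 ≤ R / x ^ 16)
    (hτ : ∀ m : ℕ, m ≠ 0 → (m : ℝ) ≤ 8 * a * R ^ 2 → (m.divisors.card : ℝ) ^ 4 ≤ c * x)
    (hα : ∀ k : ℕ, ∃ q : ℕ, ∀ t ≤ ⌊Y⌋₊, MinorData ((θ + k) / W) t q a c x R) :
    ‖twistedSum W b z Y θ‖ ≤ 484 * a ^ 2 * c ^ 3 * (R ^ 2 / x) := by
  have hz0 : 0 < z := by linarith
  have hx0 : 0 < x := by linarith
  have hR0 : 0 < R := by linarith
  have hcx : 0 ≤ c * x := by positivity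
  have hWr : (0 : ℝ) < W := by exact_mod_cast hW
  have hRR : R ≤ 8 * a * R ^ 2 := by nlinarith
  have hone : ∀ m : ℕ, m ≠ 0 → (1 : ℝ) ≤ m.divisors.card := fun m hm => by
    exact_mod_cast Nat.one_le_iff_ne_zero.mpr (card_ne_zero.mpr ⟨1, by simp [hm]⟩)
  have hτ1 : ∀ m : ℕ, m ≠ 0 → (m : ℝ) ≤ 8 * a * R ^ 2 → (m.divisors.card : ℝ) ≤ c * x :=
    fun m hm h => (le_self_pow₀ (hone m hm) (by norm_num)).trans (hτ m hm h)
  have hsupp : ∀ D : ℕ, R / x ^ 16 < D → sieveCoeff W z D = 0 := fun D hD =>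
    sieveCoeff_eq_zero hz0 (hzR.trans hD.le)
  have hlam : ∀ D, |sieveCoeff W z D| ≤ c * x := by
    intro D
    rcases Nat.eq_zero_or_pos D with rfl | hD
    · exact (abs_sieveCoeff_le hz 0).trans (by simpa using hcx)
    by_cases h : R / x ^ 16 < D
    · rw [hsupp D h, abs_zero]; exact hcx
    · refine (abs_sieveCoeff_le hz D).trans (hτ D hD.ne' ?_)
      push Not at h
      exact h.trans ((div_le_self hR0.le (one_le_pow₀ hx)).trans hRR)
  have hinner : ∀ k : ℕ, ‖∑ x ∈ Icc 1 ⌊Y⌋₊, (x : ℂ) *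
      (((∑ D ∈ x.divisors, sieveCoeff W z D : ℝ) : ℂ) * ee ((θ + k) / W * (x : ℝ) ^ 2))‖ ≤
      484 * a ^ 2 * c ^ 3 * (R ^ 2 / x) := by
    intro k
    obtain ⟨q, hq⟩ := hα k
    have hXY : ((⌊Y⌋₊ : ℕ) : ℝ) ≤ a * R := (Nat.floor_le hY).trans hYR
    refine (norm_sum_natCast_mul_le (B := c * x * (242 * a * c ^ 2 * (R / x ^ 2)))
      fun t ht => ?_).trans ?_
    · refine ((hq t ht).norm_sum_le _ hlam hsupp hτ1).trans ?_
      gcongr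
      rcases Nat.eq_zero_or_pos t with rfl | ht0
      · have := hτ1 1 one_ne_zero (by push_cast; linarith)
        simpa using this
      have h2 : ((2 ^ Nat.log 2 t : ℕ) : ℝ) ≤ 8 * a * R ^ 2 := by
        have h3 : ((2 ^ Nat.log 2 t : ℕ) : ℝ) ≤ t := by
          exact_mod_cast Nat.pow_log_le_self 2 ht0.ne'
        have h4 : (t : ℝ) ≤ a * R := (by exact_mod_cast ht : (t : ℝ) ≤ (⌊Y⌋₊ : ℕ)).trans hXY
        have h5 : a * R ≤ 8 * a * R ^ 2 := by
          have : R ≤ R ^ 2 := le_self_pow₀ hR (by norm_num)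
          calc a * R ≤ a * R ^ 2 := by gcongr
            _ ≤ _ := by nlinarith [mul_nonneg (by linarith : (0:ℝ) ≤ a) (sq_nonneg R)]
        linarith
      have h6 := hτ1 _ (by positivity) h2
      rw [Nat.divisors_prime_pow Nat.prime_two, card_map, card_range] at h6
      exact_mod_cast h6
    · calc _ ≤ 2 * (a * R) * (c * x * (242 * a * c ^ 2 * (R / x ^ 2))) := by gcongr
        _ = _ := by field_simp; ring
  rw [twistedSum_eq_sum_range hW, norm_mul, norm_inv, Complex.norm_natCast]
  have hsum : ‖∑ k ∈ range W, ee (-((θ + k) / W * b)) *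
      ∑ x ∈ Icc 1 ⌊Y⌋₊, (x : ℂ) *
        (((∑ D ∈ x.divisors, sieveCoeff W z D : ℝ) : ℂ) * ee ((θ + k) / W * (x : ℝ) ^ 2))‖ ≤
      W * (484 * a ^ 2 * c ^ 3 * (R ^ 2 / x)) := by
    refine (norm_sum_le _ _).trans ((sum_le_card_nsmul _ _ (484 * a ^ 2 * c ^ 3 * (R ^ 2 / x))
      fun k _ => ?_).trans (by simp))
    rw [norm_mul, norm_ee, one_mul]
    exact hinner k
  rw [inv_mul_le_iff₀ hWr]
  exact hsum

theorem sum_abs_selbergWeight_le {W : ℕ} {z A : ℝ} (hz : 1 < z)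
    (hA : ∀ d : ℕ, d ≠ 0 → (d : ℝ) ≤ z → (d.divisors.card : ℝ) ≤ A) :
    ∑ d ∈ (sieveProduct W z).divisors, |selbergWeight W z d| ≤ A * z := by
  have hA0 : 0 ≤ A := (Nat.cast_nonneg _).trans (hA 1 one_ne_zero (by simpa using hz.le))
  have hsub : ∀ d ∈ sieveSupport W z, d ∈ Icc 1 ⌊z⌋₊ ∧ d ∈ (sieveProduct W z).divisors := by
    intro d hd
    obtain ⟨h1, h2⟩ := mem_sieveSupport.mp hd
    have hd0 : d ≠ 0 := by rintro rfl; exact sieveProduct_ne_zero W z (by simpa using h1)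
    exact ⟨mem_Icc.mpr ⟨Nat.pos_of_ne_zero hd0, Nat.le_floor h2.le⟩,
      Nat.mem_divisors.mpr ⟨h1, sieveProduct_ne_zero W z⟩⟩
  rw [← sum_subset (s₁ := sieveSupport W z) (fun d hd => (hsub d hd).2)
    (fun d _ hd => by rw [selbergWeight_eq_zero hd, abs_zero])]
  calc _ ≤ ∑ d ∈ sieveSupport W z, A := by
        refine sum_le_sum fun d hd => (abs_selbergWeight_le hz d).trans (hA d ?_ ?_)
        · have := (mem_Icc.mp (hsub d hd).1).1; omega
        · exact (mem_sieveSupport.mp hd).2.le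
    _ ≤ ∑ d ∈ Icc 1 ⌊z⌋₊, A :=
        sum_le_sum_of_subset_of_nonneg (fun d hd => (hsub d hd).1) fun _ _ _ => hA0
    _ = A * ⌊z⌋₊ := by simp [mul_comm]
    _ ≤ A * z := by gcongr; exact Nat.floor_le (by linarith)

/-- Dirichlet approximation of the shifts `(θ + k)/W`: either all of them have a denominator at
least `X`, or `θ` itself is close to a fraction with denominator at most `X`. -/
theorem forall_exists_approx_or_exists_close {W : ℕ} (hW : 0 < W) (θ : ℝ) {Q X : ℝ} (hQ : 1 ≤ Q) :
    (∀ k : ℕ, ∃ q : ℕ, X ≤ q ∧ (q : ℝ) ≤ Q ∧ ∃ a : ℤ, IsCoprime a (q : ℤ) ∧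
      |(θ + k) / W - a / q| ≤ 1 / (q : ℝ) ^ 2) ∨
    ∃ (a : ℤ) (q : ℕ), 0 < q ∧ (q : ℝ) ≤ X ∧ IsCoprime a (q : ℤ) ∧ |θ - a / q| ≤ W / Q := by
  by_contra! hcon
  obtain ⟨⟨k, hk⟩, hfar⟩ := hcon
  have hWr : (0 : ℝ) < W := by exact_mod_cast hW
  have hn : 0 < ⌊Q⌋₊ := Nat.floor_pos.mpr hQ
  obtain ⟨s, hs, hden⟩ := Real.exists_rat_abs_sub_le_and_den_le ((θ + k) / W) hn
  have hdenQ : (s.den : ℝ) ≤ Q := (by exact_mod_cast hden : (s.den : ℝ) ≤ ⌊Q⌋₊).trans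
    (Nat.floor_le (by linarith))
  have hsd : (1 : ℝ) ≤ s.den := by exact_mod_cast s.den_pos
  have hfl : Q < (⌊Q⌋₊ : ℝ) + 1 := Nat.lt_floor_add_one Q
  have hscast : (s : ℝ) = (s.num : ℝ) / (s.den : ℝ) := by exact_mod_cast (Rat.num_div_den s).symm
  have hcop : ∀ r : ℚ, IsCoprime r.num (r.den : ℤ) := fun r =>
    Int.isCoprime_iff_gcd_eq_one.mpr (by simpa [Int.gcd] using r.reduced)
  by_cases hX : X ≤ s.den
  · refine absurd ?_ (not_le.mpr (hk s.den hX hdenQ s.num (hcop s)))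
    rw [← hscast]
    refine hs.trans ?_
    rw [sq]
    gcongr
    linarith
  · push Not at hX
    set u : ℚ := W * s - k with hu
    have hdvd : u.den ∣ s.den := by
      have h1 : u.den ∣ (W * s : ℚ).den * (k : ℚ).den := Rat.sub_den_dvd _ _
      have h2 : (W * s : ℚ).den ∣ (W : ℚ).den * s.den := Rat.mul_den_dvd _ _
      simp only [Rat.den_natCast, mul_one, one_mul] at h1 h2
      exact h1.trans h2
    have hule : (u.den : ℝ) ≤ s.den := by exact_mod_cast Nat.le_of_dvd s.den_pos hdvd
    refine absurd ?_ (not_le.mpr (hfar u.num u.den u.den_pos (hule.trans hX.le) (hcop u)))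
    have hucast : (u : ℝ) = (u.num : ℝ) / (u.den : ℝ) := by exact_mod_cast (Rat.num_div_den u).symm
    rw [← hucast]
    have h3 : θ - (u : ℝ) = W * ((θ + k) / W - s) := by
      rw [hu]; push_cast; field_simp; ring
    rw [h3, abs_mul, abs_of_pos hWr, div_eq_mul_one_div (W : ℝ)]
    gcongr
    refine hs.trans ?_
    gcongr
    nlinarith

/-! ### Assembly -/

/-- The size parameters of the circle method: `R = √N`, `x` a small power of `N`, and `c` a bound
for the divisor function and the logarithm on the scale of `x`. -/
structure Scale (W N : ℕ) (c x R z : ℝ) : Prop where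
  W_pos : 0 < W
  one_le_c : 1 ≤ c
  one_le_x : 1 ≤ x
  sq_R : R ^ 2 = N
  le_R : x ^ 256 ≤ R
  one_lt_z : 1 < z
  sq_z_le : z ^ 2 ≤ R / x ^ 256
  card_divisors_le : ∀ m : ℕ, m ≠ 0 → (m : ℝ) ≤ 16 * W * R ^ 2 → (m.divisors.card : ℝ) ^ 4 ≤ c * x
  log_le : ∀ q : ℕ, 1 ≤ q → (q : ℝ) ≤ R ^ 2 → 1 + Real.log q ≤ c * x

namespace Scale

variable {W N b : ℕ} {c x R z θ : ℝ}

theorem one_le_R (h : Scale W N c x R z) : 1 ≤ R := (one_le_pow₀ h.one_le_x).trans h.le_R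

theorem sqrt_le (h : Scale W N c x R z) (hb : b ≤ W) : √((W : ℝ) * N + b) ≤ 2 * W * R := by
  have hR := h.one_le_R
  have hW : (1 : ℝ) ≤ W := by exact_mod_cast h.W_pos
  have hb' : (b : ℝ) ≤ W := by exact_mod_cast hb
  refine Real.sqrt_le_iff.mpr ⟨by positivity, ?_⟩
  rw [← h.sq_R]
  have h1 : (1 : ℝ) ≤ R ^ 2 := one_le_pow₀ hR
  calc (W : ℝ) * R ^ 2 + b ≤ W * R ^ 2 + W * R ^ 2 := by nlinarith
    _ ≤ (2 * W * R) ^ 2 := by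
        have : (W : ℝ) ≤ W ^ 2 := le_self_pow₀ hW (by norm_num)
        nlinarith

theorem mul_error_le {W q S L c x R z u v : ℝ} (hW : 0 ≤ W) (hc : 1 ≤ c) (hx : 0 < x)
    (hR : 0 ≤ R) (hq : 0 ≤ q) (hqu : q ≤ u) (hS0 : 0 ≤ S) (hS : S ≤ c * x * z) (hz : z ^ 2 ≤ R / v)
    (hL0 : 0 ≤ L) (hL : L ≤ 2 * W * R * (54 * W ^ 2 * u)) (hv : 0 < v)
    (huv : u ^ 2 * x ^ 2 / v ≤ 1 / x) :
    3 * W * q * S ^ 2 * L ≤ 2000 * W ^ 4 * c ^ 3 * (R ^ 2 / x) := by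
  have hu : 0 ≤ u := hq.trans hqu
  have hcc : c ^ 2 ≤ c ^ 3 := pow_le_pow_right₀ hc (by norm_num)
  calc 3 * W * q * S ^ 2 * L ≤ 3 * W * u * (c * x * z) ^ 2 * (2 * W * R * (54 * W ^ 2 * u)) := by
        gcongr
    _ = 324 * W ^ 4 * c ^ 2 * R * (u ^ 2 * x ^ 2) * z ^ 2 := by ring
    _ ≤ 324 * W ^ 4 * c ^ 2 * R * (u ^ 2 * x ^ 2) * (R / v) := by gcongr
    _ = 324 * W ^ 4 * c ^ 2 * R ^ 2 * (u ^ 2 * x ^ 2 / v) := by ring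
    _ ≤ 2000 * W ^ 4 * c ^ 3 * R ^ 2 * (1 / x) := by
        gcongr
        norm_num
    _ = _ := by ring

theorem major (h : Scale W N c x R z) (hb : b ≤ W) {a : ℤ} {q : ℕ} (hq : 0 < q)
    (hqx : (q : ℝ) ≤ x ^ 64) (hβ : |θ - a / q| ≤ W * x ^ 64 / R ^ 2) :
    ‖twistedSum W b z (√((W : ℝ) * N + b)) θ -
        selbergForm W z (fun D => localSum W b q a D / (W * q)) *
          ∫ t in (0 : ℝ)..√((W : ℝ) * N + b), archWeight W b (θ - a / q) t‖ ≤
      2000 * W ^ 4 * c ^ 3 * (R ^ 2 / x) := by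
  have hR := h.one_le_R
  have hx := h.one_le_x
  have hc := h.one_le_c
  have hz := h.one_lt_z
  have hx0 : 0 < x := by linarith
  have hR0 : 0 < R := by linarith
  have hz0 : 0 < z := by linarith
  have hc0 : 0 < c := by linarith
  have hW : (1 : ℝ) ≤ W := by exact_mod_cast h.W_pos
  have hW0 : (0 : ℝ) < W := by linarith
  set Y := √((W : ℝ) * N + b) with hYdef
  have hY0 : 0 ≤ Y := Real.sqrt_nonneg _
  have hYR : Y ≤ 2 * W * R := h.sqrt_le hb
  have key := norm_twistedSum_sub_le (b := b) (z := z) (β := θ - a / q) h.W_pos hq a hY0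
  rw [show (a / q + (θ - a / q) : ℝ) = θ by ring] at key
  refine key.trans ?_
  have hS : ∑ d ∈ (sieveProduct W z).divisors, |selbergWeight W z d| ≤ c * x * z := by
    refine sum_abs_selbergWeight_le hz fun d hd hdz => ?_
    have h1 : (1 : ℝ) ≤ d.divisors.card := by
      exact_mod_cast Nat.one_le_iff_ne_zero.mpr (card_ne_zero.mpr ⟨1, by simp [hd]⟩)
    refine (le_self_pow₀ h1 (by norm_num : (4 : ℕ) ≠ 0)).trans (h.card_divisors_le d hd ?_)
    have h2 : z ≤ z ^ 2 := le_self_pow₀ hz.le (by norm_num)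
    have h3 : R / x ^ 256 ≤ R := div_le_self hR0.le (one_le_pow₀ hx)
    have h4 : R ≤ 16 * W * R ^ 2 := by nlinarith
    linarith [h.sq_z_le]
  have hS0 : 0 ≤ ∑ d ∈ (sieveProduct W z).divisors, |selbergWeight W z d| :=
    sum_nonneg fun _ _ => abs_nonneg _
  have hx64 : (1 : ℝ) ≤ x ^ 64 := one_le_pow₀ hx
  have hlast : Y + Y * (1 + 4 * Real.pi * |θ - a / q| * Y ^ 2 / W) ≤
      2 * W * R * (54 * W ^ 2 * x ^ 64) := by
    have h1 : 4 * Real.pi * |θ - a / q| * Y ^ 2 / W ≤ 52 * W ^ 2 * x ^ 64 := by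
      calc _ ≤ 4 * Real.pi * (W * x ^ 64 / R ^ 2) * (2 * W * R) ^ 2 / W := by gcongr
        _ = 16 * Real.pi * (W ^ 2 * x ^ 64) := by field_simp; ring
        _ ≤ 16 * 3.15 * (W ^ 2 * x ^ 64) := by gcongr; exact Real.pi_lt_d2.le
        _ ≤ _ := by nlinarith [mul_nonneg (sq_nonneg (W : ℝ)) (by positivity : (0 : ℝ) ≤ x ^ 64)]
    have h2 : (1 : ℝ) ≤ W ^ 2 * x ^ 64 := one_le_mul_of_one_le_of_one_le (one_le_pow₀ hW) hx64
    calc _ = Y * (2 + 4 * Real.pi * |θ - a / q| * Y ^ 2 / W) := by ring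
      _ ≤ Y * (54 * W ^ 2 * x ^ 64) := by gcongr; linarith
      _ ≤ _ := by gcongr
  have hnn : 0 ≤ Y + Y * (1 + 4 * Real.pi * |θ - a / q| * Y ^ 2 / W) := by positivity
  have hxx : (x ^ 64) ^ 2 * x ^ 2 / x ^ 256 ≤ 1 / x := by
    rw [div_le_div_iff₀ (by positivity) hx0, one_mul, ← pow_mul, ← pow_add, ← pow_succ]
    exact pow_le_pow_right₀ hx (by norm_num)
  exact mul_error_le hW0.le hc hx0 hR0.le (Nat.cast_nonneg _) hqx hS0 hS h.sq_z_le hnn hlast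
    (by positivity) hxx

theorem minor_or_major (h : Scale W N c x R z) (hb : b ≤ W) (θ : ℝ) :
    ‖twistedSum W b z (√((W : ℝ) * N + b)) θ‖ ≤ 2000 * W ^ 4 * c ^ 3 * (R ^ 2 / x) ∨
    ∃ (a : ℤ) (q : ℕ), 0 < q ∧ IsCoprime a (q : ℤ) ∧
      ‖twistedSum W b z (√((W : ℝ) * N + b)) θ -
        selbergForm W z (fun D => localSum W b q a D / (W * q)) *
          ∫ t in (0 : ℝ)..√((W : ℝ) * N + b), archWeight W b (θ - a / q) t‖ ≤
      2000 * W ^ 4 * c ^ 3 * (R ^ 2 / x) := by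
  have hR := h.one_le_R
  have hx := h.one_le_x
  have hc := h.one_le_c
  have hx0 : 0 < x := by linarith
  have hR0 : 0 < R := by linarith
  have hc0 : 0 < c := by linarith
  have hW : (1 : ℝ) ≤ W := by exact_mod_cast h.W_pos
  have hx64 : (1 : ℝ) ≤ x ^ 64 := one_le_pow₀ hx
  have hQ : 1 ≤ R ^ 2 / x ^ 64 := by
    rw [one_le_div (by positivity)]
    calc x ^ 64 ≤ x ^ 256 := pow_le_pow_right₀ hx (by norm_num)
      _ ≤ R := h.le_R
      _ ≤ R ^ 2 := le_self_pow₀ hR (by norm_num)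
  rcases forall_exists_approx_or_exists_close (X := x ^ 64) h.W_pos θ hQ with hk | ⟨a, q, hq, hqx, hco, hβ⟩
  · left
    have hYR := h.sqrt_le hb
    refine (norm_twistedSum_le_of_minorData (a := 2 * W) (c := c) (x := x) (R := R) h.W_pos
      h.one_lt_z (Real.sqrt_nonneg _) hYR (by linarith) hc hx hR ?_ ?_ ?_).trans ?_
    · refine h.sq_z_le.trans ?_
      exact div_le_div_of_nonneg_left hR0.le (by positivity)
        (pow_le_pow_right₀ hx (by norm_num))
    · intro m hm hmR
      exact h.card_divisors_le m hm (hmR.trans_eq (by ring))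
    · intro k
      obtain ⟨q, hq1, hq2, hq3⟩ := hk k
      refine ⟨q, fun t ht => ⟨by linarith, hc, hx, ?_, h.le_R, hq1, hq2, ?_, hq3⟩⟩
      · exact ((Nat.le_floor_iff (Real.sqrt_nonneg _)).mp ht).trans hYR
      · refine h.log_le q (by exact_mod_cast hx64.trans hq1) (hq2.trans ?_)
        exact div_le_self (by positivity) hx64
    · have : (W : ℝ) ^ 2 ≤ W ^ 4 := pow_le_pow_right₀ hW (by norm_num)
      calc 484 * (2 * (W : ℝ)) ^ 2 * c ^ 3 * (R ^ 2 / x) = 1936 * W ^ 2 * c ^ 3 * (R ^ 2 / x) := by ring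
        _ ≤ _ := by gcongr; norm_num
  · right
    exact ⟨a, q, hq, hco, h.major hb hq hqx (hβ.trans_eq (by field_simp))⟩

end Scale

theorem sigma_pos {W b : ℕ} (hW : 0 < W) (h : ∃ h : ℕ, h ^ 2 ≡ b [MOD W]) : 0 < sigma W b := by
  obtain ⟨y, hy⟩ := h
  refine card_pos.mpr ?_
  rcases Nat.eq_zero_or_pos (y % W) with h0 | h0
  · refine ⟨W, mem_filter.mpr ⟨mem_Icc.mpr ⟨hW, le_rfl⟩, ?_⟩⟩
    refine Nat.ModEq.trans (Nat.ModEq.pow 2 ?_) hy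
    simp [Nat.ModEq, h0]
  · refine ⟨y % W, mem_filter.mpr ⟨mem_Icc.mpr ⟨h0, (Nat.mod_lt _ hW).le⟩, ?_⟩⟩
    exact Nat.ModEq.trans (Nat.ModEq.pow 2 (Nat.mod_modEq y W)) hy

theorem majorantFactor_nonneg (W b : ℕ) {z : ℝ} (hz : 1 < z) : 0 ≤ majorantFactor W b z := by
  have := Real.log_pos hz
  unfold majorantFactor; positivity

theorem majorantFactor_le {W b : ℕ} {z : ℝ} (hW : 0 < W) (hσ : 0 < sigma W b) (hz : 1 < z) :
    majorantFactor W b z ≤ 2 * Real.log z := by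
  have hlog := Real.log_pos hz
  have hW' : (0 : ℝ) < W := by exact_mod_cast hW
  have hσ' : (1 : ℝ) ≤ sigma W b := by exact_mod_cast hσ
  have hφ : (W.totient : ℝ) ≤ W := by exact_mod_cast Nat.totient_le W
  unfold majorantFactor
  rw [div_le_iff₀ (by positivity)]
  calc 2 * (W.totient : ℝ) * Real.log z ≤ 2 * (W * 1) * Real.log z := by gcongr; linarith
    _ ≤ 2 * (W * sigma W b) * Real.log z := by gcongr
    _ = _ := by ring

theorem majorantFactor_mul {W b : ℕ} {z : ℝ} (hW : 0 < W) (hσ : 0 < sigma W b) (u : ℝ) :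
    majorantFactor W b z * (sigma W b / W * (u / sieveJ W z)) =
      W.totient * Real.log z / (W * sieveJ W z) * (2 / W * u) := by
  have hW' : (W : ℝ) ≠ 0 := by exact_mod_cast hW.ne'
  have hσ' : (sigma W b : ℝ) ≠ 0 := by exact_mod_cast hσ.ne'
  unfold majorantFactor
  by_cases hJ : sieveJ W z = 0
  · simp [hJ]
  field_simp

theorem card_divisors_pow_div_sqrt_le {w ε B : ℝ} {q : ℕ} (hw : 0 < w) (hwq : w < q)
    (hε : ε ≤ 1 / 2) (hB0 : 0 ≤ B) (hB : (q.divisors.card : ℝ) ^ 6 ≤ B * (q : ℝ) ^ ε) :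
    (q.divisors.card : ℝ) ^ 6 / √q ≤ B * w ^ (-(1 / 2) + ε : ℝ) := by
  have hq0 : (0 : ℝ) < q := by linarith
  calc (q.divisors.card : ℝ) ^ 6 / √q ≤ B * (q : ℝ) ^ ε / √q :=
        div_le_div_of_nonneg_right hB (Real.sqrt_nonneg _)
    _ = B * (q : ℝ) ^ (-(1 / 2) + ε : ℝ) := by
        rw [Real.rpow_add hq0, Real.rpow_neg hq0.le, ← Real.sqrt_eq_rpow]
        ring
    _ ≤ B * w ^ (-(1 / 2) + ε : ℝ) :=
        mul_le_mul_of_nonneg_left (Real.rpow_le_rpow_of_nonpos hw hwq.le (by linarith)) hB0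

/-- The main term on a major arc whose denominator is coprime to `W`. -/
theorem norm_coprime_main_le {W b N q : ℕ} {a : ℤ} {z A : ℝ} (hN : 0 < N) (hz : 1 < z)
    (hW : 0 < W) (h2W : 2 ∣ W) (hb : b ≤ W) (hσ : 0 < sigma W b) (hq : 0 < q)
    (haq : IsCoprime a (q : ℤ)) (hco : W.Coprime q)
    (hJ : W.totient * Real.log z / (W * sieveJ W z) ≤ A) (β : ℝ) :
    ‖(majorantFactor W b z : ℂ) *
      (selbergForm W z (fun D => localSum W b q a D / (W * q)) *
        ∫ t in (0 : ℝ)..√((W : ℝ) * N + b), archWeight W b β t)‖ ≤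
      4 * A * ((q.divisors.card : ℝ) ^ 6 / √q) * N := by
  have hW' : (0 : ℝ) < W := by exact_mod_cast hW
  have hN' : (1 : ℝ) ≤ N := by exact_mod_cast hN
  have hb' : (b : ℝ) ≤ W := by exact_mod_cast hb
  have hfac := majorantFactor_nonneg W b hz
  have hJpos := sieveJ_pos (W := W) hz
  have hform := norm_selbergForm_localSum_le (b := b) hW h2W hq hz haq hco
  have hint := norm_integral_archWeight_le (W : ℝ) (b : ℝ) β
    (Real.sqrt_nonneg ((W : ℝ) * N + b))
  rw [Real.sq_sqrt (by positivity)] at hint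
  have hYle : (W : ℝ) * N + b ≤ 2 * W * N := by
    have : (W : ℝ) ≤ W * N := le_mul_of_one_le_right hW'.le hN'
    linarith
  set T := (q.divisors.card : ℝ) ^ 6 / √q
  have hT : 0 ≤ T := by positivity
  rw [← mul_assoc, norm_mul, norm_mul, Complex.norm_real, Real.norm_of_nonneg hfac]
  calc _ ≤ majorantFactor W b z * (sigma W b / W * (T / sieveJ W z)) * (2 * W * N) :=
        mul_le_mul (mul_le_mul_of_nonneg_left hform hfac) (hint.trans hYle)
          (norm_nonneg _) (by positivity)
    _ = W.totient * Real.log z / (W * sieveJ W z) * (2 / W * T) * (2 * W * N) := by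
        rw [majorantFactor_mul hW hσ]
    _ ≤ A * (2 / W * T) * (2 * W * N) := by gcongr
    _ = 4 * A * T * N := by field_simp; ring

/-- The main term on a major arc is small unless it comes from the frequency zero. -/
theorem norm_major_main_le {w : ℝ} (hw : 1 ≤ w) {b N q : ℕ} {a : ℤ} {z ε A B : ℝ} (hN : 0 < N)
    (hz : 1 < z) (hb : b ≤ bigW w) (hbW : b.Coprime (bigW w)) (hσ : 0 < sigma (bigW w) b)
    (hq : 0 < q) (haq : IsCoprime a (q : ℤ)) (hA : 0 ≤ A)
    (hJ : (bigW w).totient * Real.log z / (bigW w * sieveJ (bigW w) z) ≤ A)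
    (hε : ε ≤ 1 / 2) (hB : ∀ n : ℕ, n ≠ 0 → (n.divisors.card : ℝ) ^ 6 ≤ B * (n : ℝ) ^ ε)
    (hAN : A ≤ w ^ (-(1 / 2) : ℝ) * N) {r : ℕ} (hr0 : 0 < r) (hrN : r < N) (hε0 : 0 ≤ ε) :
    ‖(majorantFactor (bigW w) b z : ℂ) *
      (selbergForm (bigW w) z (fun D => localSum (bigW w) b q a D / (bigW w * q)) *
        ∫ t in (0 : ℝ)..√((bigW w : ℝ) * N + b), archWeight (bigW w) b ((r : ℝ) / N - a / q) t)‖ ≤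
      (1 + 4 * A * B) * w ^ (-(1 / 2) + ε : ℝ) * N := by
  have hW := bigW_pos w
  have hB1 : 1 ≤ B := by simpa using hB 1 one_ne_zero
  have hW' : (0 : ℝ) < bigW w := by exact_mod_cast hW
  have hN' : (1 : ℝ) ≤ N := by exact_mod_cast hN
  have hw0 : 0 < w := by linarith
  have hb' : (b : ℝ) ≤ bigW w := by exact_mod_cast hb
  have hfac := majorantFactor_nonneg (bigW w) b hz
  have hJpos := sieveJ_pos (W := bigW w) hz
  have hlog := Real.log_pos hz
  have hM0 : 0 ≤ (bigW w).totient * Real.log z / (bigW w * sieveJ (bigW w) z) := by positivity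
  have hY2 : √((bigW w : ℝ) * N + b) ^ 2 = (bigW w : ℝ) * N + b := Real.sq_sqrt (by positivity)
  by_cases hco : (bigW w).Coprime q
  swap
  · rw [selbergForm_localSum_eq_zero hq haq hbW hco]
    simp only [zero_mul, mul_zero, norm_zero]
    positivity
  rcases eq_or_ne q 1 with rfl | hq1
  · rw [selbergForm_localSum_one hW hz, ← mul_assoc, ← Complex.ofReal_mul,
      majorantFactor_mul hW hσ, norm_mul, Complex.norm_real, mul_one,
      Real.norm_of_nonneg (by positivity)]
    have hβ : (r : ℝ) / N - a / (1 : ℕ) ≠ 0 := by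
      intro h
      have h1 : (r : ℝ) = a * N := by
        have : (N : ℝ) ≠ 0 := by linarith
        field_simp at h
        push_cast at h
        linarith
      have h2 : (r : ℤ) = a * N := by exact_mod_cast h1
      have h3 : (0 : ℤ) < a * N := by rw [← h2]; exact_mod_cast hr0
      have h4 : a * (N : ℤ) < N := by rw [← h2]; exact_mod_cast hrN
      have h5 : (0 : ℤ) < N := by exact_mod_cast hN
      have h6 : 0 < a := pos_of_mul_pos_left h3 h5.le
      nlinarith
    have hint := norm_integral_archWeight_le_of_int (W := bigW w) (b := b)
      (Y := √((bigW w : ℝ) * N + b)) (N := (N : ℤ)) (m := (r : ℤ) - a * N) hW' (by positivity)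
      (by rw [hY2]; push_cast; ring) hβ (by
        have : (N : ℝ) ≠ 0 := by linarith
        push_cast; field_simp)
    have hwε : w ^ (-(1 / 2) : ℝ) ≤ w ^ (-(1 / 2) + ε : ℝ) :=
      Real.rpow_le_rpow_of_exponent_le hw (by linarith)
    calc _ ≤ A * (2 / bigW w) * (b / 2) := by gcongr
      _ ≤ A * (2 / bigW w) * (bigW w / 2) := by gcongr
      _ = A := by field_simp
      _ ≤ w ^ (-(1 / 2) : ℝ) * N := hAN
      _ ≤ w ^ (-(1 / 2) + ε : ℝ) * N := by gcongr
      _ ≤ _ := by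
          rw [mul_assoc]
          exact le_mul_of_one_le_left (by positivity)
            (le_add_of_nonneg_right (by positivity))
  · have hwq : w < q := lt_of_coprime_bigW hq.ne' hq1 hco.symm
    have h2W : 2 ∣ bigW w := ⟨4 * ∏ p ∈ (Finset.Icc 3 ⌊w⌋₊).filter Nat.Prime, p, by
      rw [bigW]; ring⟩
    refine (norm_coprime_main_le hN hz hW h2W hb hσ hq haq hco hJ _).trans ?_
    have hdiv := card_divisors_pow_div_sqrt_le hw0 hwq hε (B := B) (by linarith) (hB q hq.ne')
    calc 4 * A * ((q.divisors.card : ℝ) ^ 6 / √q) * N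
        ≤ 4 * A * (B * w ^ (-(1 / 2) + ε : ℝ)) * N := by gcongr
      _ = 4 * A * B * w ^ (-(1 / 2) + ε : ℝ) * N := by ring
      _ ≤ _ := by gcongr; linarith

/-- The main term at the frequency zero. -/
theorem norm_zero_main_sub_le {w : ℝ} (hw : 1 ≤ w) {b N : ℕ} {z C : ℝ}
    (hz : 1 < z) (hb : b ≤ bigW w) (hσ : 0 < sigma (bigW w) b) (hC : 0 ≤ C)
    (hJ : |(bigW w).totient * Real.log z / (bigW w * sieveJ (bigW w) z) - 1| ≤
      C * w ^ (-(1 / 2) : ℝ))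
    (hCN : 1 + C ≤ w ^ (-(1 / 2) : ℝ) * N) :
    ‖(majorantFactor (bigW w) b z : ℂ) *
      (selbergForm (bigW w) z (fun D => localSum (bigW w) b (1 : ℕ) 0 D / (bigW w * (1 : ℕ))) *
        ∫ t in (0 : ℝ)..√((bigW w : ℝ) * N + b),
          archWeight (bigW w) b 0 t) - N‖ ≤
      (1 + C) * w ^ (-(1 / 2) : ℝ) * N := by
  have hW := bigW_pos w
  have hW' : (0 : ℝ) < bigW w := by exact_mod_cast hW
  have hb' : (b : ℝ) ≤ bigW w := by exact_mod_cast hb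
  have hY2 : √((bigW w : ℝ) * N + b) ^ 2 = (bigW w : ℝ) * N + b := Real.sq_sqrt (by positivity)
  have hw1 : w ^ (-(1 / 2) : ℝ) ≤ 1 := Real.rpow_le_one_of_one_le_of_nonpos hw (by norm_num)
  set M := (bigW w).totient * Real.log z / (bigW w * sieveJ (bigW w) z) with hM
  have hM1 : |M| ≤ 1 + C := by
    have h1 : |M| ≤ |M - 1| + 1 := by simpa using abs_add_le (M - 1) 1
    have h2 : C * w ^ (-(1 / 2) : ℝ) ≤ C * 1 := by gcongr
    linarith
  rw [selbergForm_localSum_one hW hz, integral_archWeight_zero, ← mul_assoc, ← Complex.ofReal_mul,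
    majorantFactor_mul hW hσ, ← hM]
  have heq : ((M * (2 / bigW w * 1) : ℝ) : ℂ) * ((√((bigW w : ℝ) * N + b) : ℂ) ^ 2 / 2) - N =
      (((M - 1) * N + M * (b / bigW w) : ℝ) : ℂ) := by
    have h1 : (√((bigW w : ℝ) * N + b) : ℂ) ^ 2 = (((bigW w : ℝ) * N + b : ℝ) : ℂ) := by
      rw [← Complex.ofReal_pow, hY2]
    have hWc : (bigW w : ℂ) ≠ 0 := by exact_mod_cast hW.ne'
    rw [h1]; push_cast; field_simp; ring
  have hbW : (b : ℝ) / bigW w ≤ 1 := (div_le_one hW').mpr hb'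
  rw [heq, Complex.norm_real, Real.norm_eq_abs]
  calc _ ≤ |(M - 1) * N| + |M * (b / bigW w)| := abs_add_le _ _
    _ = |M - 1| * N + |M| * (b / bigW w) := by
        rw [abs_mul, abs_mul, Nat.abs_cast, abs_of_nonneg (by positivity : 0 ≤ (b : ℝ) / bigW w)]
    _ ≤ C * w ^ (-(1 / 2) : ℝ) * N + (1 + C) * 1 := by gcongr
    _ ≤ _ := by linarith

/-- The bound for the Fourier transform of the majorant once all parameters are fixed. -/
theorem Scale.norm_fourierHat_sub_le {w : ℝ} (hw : 1 ≤ w) {b N : ℕ} {c x R z ε C B : ℝ}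
    (h : Scale (bigW w) N c x R z) (hb : b ≤ bigW w) (hbW : b.Coprime (bigW w))
    (hsq : ∃ h : ℕ, h ^ 2 ≡ b [MOD bigW w]) (hC : 0 ≤ C)
    (hJ : |(bigW w).totient * Real.log z / (bigW w * sieveJ (bigW w) z) - 1| ≤
      C * w ^ (-(1 / 2) : ℝ))
    (hCN : 1 + C ≤ w ^ (-(1 / 2) : ℝ) * N) (hε0 : 0 ≤ ε) (hε : ε ≤ 1 / 2)
    (hB : ∀ n : ℕ, n ≠ 0 → (n.divisors.card : ℝ) ^ 6 ≤ B * (n : ℝ) ^ ε)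
    (hsmall : 2 * Real.log z * (2000 * bigW w ^ 4 * c ^ 3 * (R ^ 2 / x) + (2 * bigW w) ^ 6) ≤
      w ^ (-(1 / 2) : ℝ) * N) (r : ZMod N) :
    ‖fourierHat (majorant (bigW w) b N z) ((r.val : ℝ) / (N : ℝ))
        - (if r = 0 then 1 else 0) * (N : ℂ)‖ ≤
      (2 + C + 4 * (1 + C) * B) * w ^ (-(1 / 2) + ε : ℝ) * N := by
  have hW := bigW_pos w
  have hz := h.one_lt_z
  have hB1 : 1 ≤ B := by simpa using hB 1 one_ne_zero
  have hσ := sigma_pos hW hsq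
  have hR1 := h.one_le_R
  have hN : 0 < N := by
    have : (0 : ℝ) < N := by rw [← h.sq_R]; positivity
    exact_mod_cast this
  have : NeZero N := ⟨hN.ne'⟩
  set Y := √((bigW w : ℝ) * N + b)
  set θ := (r.val : ℝ) / (N : ℝ) with hθ
  set E := 2000 * (bigW w : ℝ) ^ 4 * c ^ 3 * (R ^ 2 / x) with hE
  set f := majorantFactor (bigW w) b z with hf
  have hf0 : 0 ≤ f := majorantFactor_nonneg (bigW w) b hz
  have hwε : w ^ (-(1 / 2) : ℝ) ≤ w ^ (-(1 / 2) + ε : ℝ) :=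
    Real.rpow_le_rpow_of_exponent_le hw (by linarith)
  have hw1 : w ^ (-(1 / 2) : ℝ) ≤ 1 := Real.rpow_le_one_of_one_le_of_nonpos hw (by norm_num)
  have hc := h.one_le_c
  have hx := h.one_le_x
  have hE0 : 0 ≤ E := by positivity
  obtain ⟨main, h1, h2⟩ : ∃ main : ℂ, ‖twistedSum (bigW w) b z Y θ - main‖ ≤ E ∧
      ‖f * main - (if r = 0 then 1 else 0) * (N : ℂ)‖ ≤
        (1 + C + 4 * (1 + C) * B) * w ^ (-(1 / 2) + ε : ℝ) * N := by
    by_cases hr : r = 0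
    · have hmaj := h.major (b := b) (θ := θ) hb (a := 0) (q := 1) one_pos
        (by simpa using one_le_pow₀ hx) (by
          have : |θ - ((0 : ℤ) : ℝ) / ((1 : ℕ) : ℝ)| = 0 := by simp [hθ, hr]
          rw [this]; positivity)
      have hθ0 : θ - ((0 : ℤ) : ℝ) / ((1 : ℕ) : ℝ) = 0 := by simp [hθ, hr]
      rw [hθ0] at hmaj
      refine ⟨_, hmaj, ?_⟩
      rw [if_pos hr, one_mul]
      refine (norm_zero_main_sub_le hw hz hb hσ hC hJ hCN).trans ?_
      have : 0 ≤ 4 * (1 + C) * B := by positivity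
      exact mul_le_mul_of_nonneg_right (mul_le_mul (by linarith) hwε (by positivity)
        (by positivity)) (Nat.cast_nonneg _)
    · rw [if_neg hr]
      simp only [zero_mul, sub_zero]
      rcases h.minor_or_major hb θ with hmin | ⟨a, q, hq, haq, hmaj⟩
      · refine ⟨0, by simpa using hmin, ?_⟩
        simp only [mul_zero, norm_zero]
        positivity
      · refine ⟨_, hmaj, ?_⟩
        have hA : (bigW w).totient * Real.log z / (bigW w * sieveJ (bigW w) z) ≤ 1 + C := by
          have h3 := (abs_le.mp hJ).2
          have h4 : C * w ^ (-(1 / 2) : ℝ) ≤ C * 1 := by gcongr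
          linarith
        refine (norm_major_main_le hw hN hz hb hbW hσ hq haq (A := 1 + C) (by linarith) hA hε hB hCN
          (r := r.val) ?_ (ZMod.val_lt r) hε0).trans ?_
        · exact Nat.pos_of_ne_zero fun h0 => hr ((ZMod.val_eq_zero r).mp h0)
        · gcongr
          linarith
  have h0 := norm_fourierHat_majorant_sub_le (N := N) (θ := θ) hz hb hW
  have hfle : f ≤ 2 * Real.log z := majorantFactor_le hW hσ hz
  have hsplit : fourierHat (majorant (bigW w) b N z) θ - (if r = 0 then 1 else 0) * (N : ℂ) =
      (fourierHat (majorant (bigW w) b N z) θ - f * twistedSum (bigW w) b z Y θ) +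
      f * (twistedSum (bigW w) b z Y θ - main) +
      (f * main - (if r = 0 then 1 else 0) * (N : ℂ)) := by ring
  have h3 : ‖(f : ℂ) * (twistedSum (bigW w) b z Y θ - main)‖ ≤ f * E := by
    rw [norm_mul, Complex.norm_real, Real.norm_of_nonneg hf0]
    gcongr
  have h4 : f * E + f * (2 * bigW w : ℝ) ^ 6 ≤ w ^ (-(1 / 2) : ℝ) * N := by
    refine le_trans ?_ hsmall
    rw [← mul_add]
    gcongr
  have h5 : w ^ (-(1 / 2) : ℝ) * N ≤ w ^ (-(1 / 2) + ε : ℝ) * N := by gcongr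
  rw [hsplit]
  refine (norm_add₃_le).trans ?_
  linarith

theorem exists_card_divisors_pow_le (k : ℕ) (hk : k ≠ 0) {ε : ℝ} (hε : 0 < ε) :
    ∃ C : ℝ, 1 ≤ C ∧ ∀ n : ℕ, n ≠ 0 → (n.divisors.card : ℝ) ^ k ≤ C * (n : ℝ) ^ ε := by
  have hk' : (0 : ℝ) < k := by exact_mod_cast Nat.pos_of_ne_zero hk
  obtain ⟨C, hC, h⟩ := exists_card_divisors_le (ε / k) (by positivity)
  refine ⟨C ^ k, one_le_pow₀ hC, fun n hn => ?_⟩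
  calc (n.divisors.card : ℝ) ^ k ≤ (C * (n : ℝ) ^ (ε / k)) ^ k := by gcongr; exact h n hn
    _ = C ^ k * (n : ℝ) ^ ε := by
        rw [mul_pow, ← Real.rpow_natCast ((n : ℝ) ^ (ε / k)), ← Real.rpow_mul (Nat.cast_nonneg _),
          div_mul_cancel₀ _ hk'.ne']

theorem exists_scale {δ : ℝ} (hδ0 : 0 < δ) (hδ : δ < 1 / 8) {W : ℕ} (hW : 0 < W) :
    ∃ c : ℝ, 1 ≤ c ∧ ∀ N : ℕ, 2 ≤ N →
      Scale W N c ((N : ℝ) ^ (δ / 64)) ((N : ℝ) ^ (1 / 2 : ℝ)) (level δ N) := by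
  obtain ⟨C, hC, hdiv⟩ := exists_card_divisors_pow_le 4 (by norm_num) (ε := δ / 64) (by positivity)
  have hW' : (1 : ℝ) ≤ W := by exact_mod_cast hW
  have hη : 0 < δ / 64 := by positivity
  refine ⟨C * (16 * W) + (1 + 1 / (δ / 64)), ?_, fun N hN => ?_⟩
  · have : 0 ≤ C * (16 * W) := by positivity
    have : 0 < 1 / (δ / 64) := by positivity
    linarith
  have hN1 : (1 : ℝ) < N := by exact_mod_cast hN
  have hN0 : (0 : ℝ) < N := by linarith
  have hR2 : ((N : ℝ) ^ (1 / 2 : ℝ)) ^ 2 = N := by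
    rw [← Real.rpow_natCast, ← Real.rpow_mul hN0.le]; norm_num
  have hx : 1 ≤ (N : ℝ) ^ (δ / 64) := Real.one_le_rpow hN1.le hη.le
  have hx256 : ((N : ℝ) ^ (δ / 64)) ^ 256 = (N : ℝ) ^ (4 * δ) := by
    rw [← Real.rpow_natCast, ← Real.rpow_mul hN0.le]; norm_num; ring_nf
  refine ⟨hW, ?_, hx, hR2, ?_, Real.one_lt_rpow hN1 (by linarith), ?_, ?_, ?_⟩
  · have : 0 ≤ C * (16 * W) := by positivity
    have : 0 < 1 / (δ / 64) := by positivity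
    linarith
  · rw [hx256]
    exact Real.rpow_le_rpow_of_exponent_le hN1.le (by linarith)
  · rw [hx256, ← Real.rpow_sub hN0, level, ← Real.rpow_natCast, ← Real.rpow_mul hN0.le]
    exact Real.rpow_le_rpow_of_exponent_le hN1.le (by push_cast; linarith)
  · intro m hm hmN
    rw [hR2] at hmN
    have h16 : (1 : ℝ) ≤ 16 * W := by linarith
    calc (m.divisors.card : ℝ) ^ 4 ≤ C * (m : ℝ) ^ (δ / 64) := hdiv m hm
      _ ≤ C * (16 * W * N) ^ (δ / 64) := by gcongr
      _ = C * ((16 * W) ^ (δ / 64) * (N : ℝ) ^ (δ / 64)) := by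
          rw [Real.mul_rpow (by positivity) hN0.le]
      _ ≤ C * ((16 * W) ^ (1 : ℝ) * (N : ℝ) ^ (δ / 64)) := by
          gcongr
          linarith
      _ = C * (16 * W) * (N : ℝ) ^ (δ / 64) := by rw [Real.rpow_one]; ring
      _ ≤ _ := by
          gcongr
          have : 0 < 1 / (δ / 64) := by positivity
          linarith
  · intro q hq hqN
    rw [hR2] at hqN
    have h1 : Real.log q ≤ (N : ℝ) ^ (δ / 64) / (δ / 64) := by
      refine (Real.log_le_rpow_div (Nat.cast_nonneg q) hη).trans ?_
      gcongr
    calc 1 + Real.log q ≤ 1 * (N : ℝ) ^ (δ / 64) + (N : ℝ) ^ (δ / 64) / (δ / 64) := by linarith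
      _ = (1 + 1 / (δ / 64)) * (N : ℝ) ^ (δ / 64) := by ring
      _ ≤ _ := by
          refine mul_le_mul_of_nonneg_right ?_ (by positivity)
          exact le_add_of_nonneg_left (by positivity)

/-- The error terms are eventually smaller than any multiple of `N`. -/
theorem eventually_error_le {δ : ℝ} (hδ0 : 0 < δ) (hδ : δ < 1 / 8) {A B κ : ℝ} (hA : 0 ≤ A)
    (hB : 0 ≤ B) (hκ : 0 < κ) :
    ∀ᶠ N : ℕ in Filter.atTop, 2 * Real.log (level δ N) *
      (A * (((N : ℝ) ^ (1 / 2 : ℝ)) ^ 2 / (N : ℝ) ^ (δ / 64)) + B) ≤ κ * N := by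
  have hη : 0 < δ / 64 := by positivity
  have h1 : ∀ᶠ y : ℝ in Filter.atTop, ‖Real.log y‖ ≤ κ / (2 * (A + B) + 1) * ‖y ^ (δ / 64)‖ :=
    (isLittleO_log_rpow_atTop hη).bound (by positivity)
  filter_upwards [tendsto_natCast_atTop_atTop.eventually h1, Filter.eventually_ge_atTop 2]
    with N hN hN2
  have hN1 : (1 : ℝ) < N := by exact_mod_cast hN2
  have hN0 : (0 : ℝ) < N := by linarith
  have hx0 : 0 < (N : ℝ) ^ (δ / 64) := by positivity
  have hlog : 0 < Real.log N := Real.log_pos hN1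
  rw [Real.norm_of_nonneg hlog.le, Real.norm_of_nonneg hx0.le] at hN
  have hR2 : ((N : ℝ) ^ (1 / 2 : ℝ)) ^ 2 = N := by
    rw [← Real.rpow_natCast, ← Real.rpow_mul hN0.le]; norm_num
  have hlz : Real.log (level δ N) ≤ Real.log N := by
    rw [level, Real.log_rpow hN0]
    nlinarith
  have hxN : (N : ℝ) ^ (δ / 64) ≤ N := by
    calc (N : ℝ) ^ (δ / 64) ≤ (N : ℝ) ^ (1 : ℝ) :=
          Real.rpow_le_rpow_of_exponent_le hN1.le (by linarith)
      _ = N := Real.rpow_one _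
  have hone : 1 ≤ (N : ℝ) / (N : ℝ) ^ (δ / 64) := (one_le_div hx0).mpr hxN
  rw [hR2]
  set x := (N : ℝ) ^ (δ / 64)
  have hAB : (2 * (A + B)) / (2 * (A + B) + 1) ≤ 1 := (div_le_one (by positivity)).mpr (by linarith)
  calc 2 * Real.log (level δ N) * (A * (N / x) + B)
      ≤ 2 * Real.log N * (A * (N / x) + B * (N / x)) := by
        gcongr
        exact le_mul_of_one_le_right hB hone
    _ ≤ 2 * (κ / (2 * (A + B) + 1) * x) * (A * (N / x) + B * (N / x)) := by gcongr
    _ = (2 * (A + B)) / (2 * (A + B) + 1) * (κ * N) := by field_simp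
    _ ≤ 1 * (κ * N) := by gcongr
    _ = κ * N := one_mul _

theorem tendsto_level {δ : ℝ} (hδ : δ < 1 / 8) :
    Filter.Tendsto (fun N : ℕ => level δ N) Filter.atTop Filter.atTop :=
  (tendsto_rpow_atTop (by linarith)).comp tendsto_natCast_atTop_atTop

end PrimeSquares

end

theorem mainTheorem4 :
    ∃ C : ℝ → ℝ, ∀ δ : ℝ, 0 < δ → δ < 1 / 8 → ∀ w : ℝ, 1 ≤ w →
      ∃ N₀ : ℕ, ∀ N : ℕ, N₀ ≤ N →
        ∀ b : ℕ, 1 ≤ b → b ≤ PrimeSquares.bigW w → b.Coprime (PrimeSquares.bigW w) →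
          (∃ h : ℕ, h ^ 2 ≡ b [MOD PrimeSquares.bigW w]) →
            ∀ r : ZMod N, ∀ ε : ℝ, 0 < ε →
              ‖PrimeSquares.fourierHat
                    (PrimeSquares.majorant (PrimeSquares.bigW w) b N (PrimeSquares.level δ N))
                    ((r.val : ℝ) / (N : ℝ))
                  - (if r = 0 then 1 else 0) * (N : ℂ)‖
                ≤ C ε * w ^ (-(1 / 2 : ℝ) + ε) * (N : ℝ) := by
  obtain ⟨C₁, hC₁, hJ⟩ := PrimeSquares.exists_abs_totient_mul_log_div_sieveJ_sub_one_le
  have hB : ∀ ε : ℝ, ∃ B : ℝ, 0 < ε → 1 ≤ B ∧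
      ∀ n : ℕ, n ≠ 0 → (n.divisors.card : ℝ) ^ 6 ≤ B * (n : ℝ) ^ min ε (1 / 2) := by
    intro ε
    by_cases hε : 0 < ε
    · obtain ⟨B, hB⟩ := PrimeSquares.exists_card_divisors_pow_le 6 (by norm_num)
        (lt_min hε (by norm_num : (0 : ℝ) < 1 / 2))
      exact ⟨B, fun _ => hB⟩
    · exact ⟨0, fun h => absurd h hε⟩
  choose B hB using hB
  refine ⟨fun ε => 2 + C₁ + 4 * (1 + C₁) * B ε, fun δ hδ0 hδ w hw => ?_⟩
  obtain ⟨c, hc, hscale⟩ := PrimeSquares.exists_scale hδ0 hδ (PrimeSquares.bigW_pos w)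
  obtain ⟨z₀, -, hz₀⟩ := hJ w hw
  have hw0 : 0 < w := by linarith
  have hκ : 0 < w ^ (-(1 / 2) : ℝ) := Real.rpow_pos_of_pos hw0 _
  have hsmall := PrimeSquares.eventually_error_le hδ0 hδ
    (A := 2000 * (PrimeSquares.bigW w : ℝ) ^ 4 * c ^ 3) (B := (2 * PrimeSquares.bigW w : ℝ) ^ 6)
    (by positivity) (by positivity) hκ
  have hlarge : ∀ᶠ N : ℕ in Filter.atTop, 1 + C₁ ≤ w ^ (-(1 / 2) : ℝ) * N :=
    (tendsto_natCast_atTop_atTop.const_mul_atTop hκ).eventually_ge_atTop _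
  obtain ⟨N₀, hN₀⟩ := Filter.eventually_atTop.mp (((hsmall.and hlarge).and
    ((PrimeSquares.tendsto_level hδ).eventually_ge_atTop z₀)).and (Filter.eventually_ge_atTop 2))
  refine ⟨N₀, fun N hN b _ hb hbW hsq r ε hε => ?_⟩
  obtain ⟨⟨⟨h1, h2⟩, h3⟩, h4⟩ := hN₀ N hN
  refine ((hscale N h4).norm_fourierHat_sub_le hw hb hbW hsq hC₁ (hz₀ _ h3) h2
    (lt_min hε (by norm_num)).le (min_le_right _ _) (hB ε hε).2 h1 r).trans ?_
  have hB1 := (hB ε hε).1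
  have hle : w ^ (-(1 / 2) + min ε (1 / 2) : ℝ) ≤ w ^ (-(1 / 2 : ℝ) + ε) :=
    Real.rpow_le_rpow_of_exponent_le hw (by linarith [min_le_left ε (1 / 2)])
  have hpos : 0 ≤ 2 + C₁ + 4 * (1 + C₁) * B ε := by positivity
  exact mul_le_mul_of_nonneg_right (mul_le_mul_of_nonneg_left hle hpos) (Nat.cast_nonneg _)
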